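/- For a partition $\mu=(\mu_1\ge\mu_2\ge\dots\ge\mu_n)$ let $M_\mu=\bigoplus_i \mathbb{C}[t]/(t^{\mu_i})$, a torsion $\mathbb{C}[t]$-module of complex dimension $|\mu|=\sum_i\mu_i$. For partitions $\alpha,\beta,\gamma$ let the Littlewood--Richardson coefficient $c_{\alpha,\beta}^{\gamma}$ be the number of Littlewood--Richardson tableaux of type $(\alpha,\beta;\gamma)$, that is, of semistandard skew tableaux of shape $\gamma/\alpha$ (rows weakly increasing from left to right, columns strictly increasing from top to bottom, entries $\ge 1$) in which each $k\ge1$ occurs exactly $\beta_k$ times and whose reverse lattice word (rows read from top to bottom, each row from right to left) contains, in every prefix and for every $k\ge 1$, at least as many $k$'s as $(k+1)$'s; in particular $c_{\alpha,\beta}^\gamma=0$ if $\alpha\not\subset\gamma$. Then, for all partitions $\alpha,\beta,\gamma$: (1) There exists a short exact sequence of $\mathbb{C}[t]$-modules $$0\to M_\alpha\to M_\gamma\to M_\beta\to 0$$ if and only if $c_{\alpha,\beta}^{\gamma}\neq 0$. (2) The coefficient $c_{\alpha,\beta}^{\gamma}$ counts such extensions in the following sense: it equals the number of irreducible components of the variety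 (the Satake fibre) $$\mathcal{G}_{\alpha,\beta}^{\gamma}=\{\,N\subset M_\gamma \text{ a } \mathbb{C}[t]\text{-submodule} \;:\; N\cong M_\alpha,\ M_\gamma/N\cong M_\beta\,\}$$ with the Zariski topology that it inherits as a subset of the Grassmannian of $|\alpha|$-dimensional complex subspaces of $M_\gamma$. -/

import Mathlib

open Polynomial

/-! ### Torsion modules

Partitions are Young diagrams `μ`: the parts are the row lengths
`μ.rowLen 0 ≥ μ.rowLen 1 ≥ …` and there are `μ.colLen 0` of them that are nonzero. -/

/-- The torsion module `M_μ = ⨁ i, ℂ[t] / (t ^ μ_i)` over `ℂ[t]`. -/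
abbrev TorsionModule (μ : YoungDiagram) : Type :=
  (i : Fin (μ.colLen 0)) → ℂ[X] ⧸ Ideal.span {(X : ℂ[X]) ^ μ.rowLen i}

/-! ### Littlewood-Richardson tableaux -/

/-- `T i j` is the entry in row `i` and column `j` (both counted from `0`) of a semistandard
skew tableau of shape `γ/α`, with entries `≥ 1` in the boxes of `γ/α`; the value `0` means
that there is no box. -/
structure IsSemistandardSkew (α γ : YoungDiagram) (T : ℕ → ℕ → ℕ) : Prop where
  le : α ≤ γ
  pos_iff : ∀ i j, 0 < T i j ↔ (i, j) ∈ γ ∧ (i, j) ∉ α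
  row_weak : ∀ i j₁ j₂, j₁ < j₂ → 0 < T i j₁ → 0 < T i j₂ → T i j₁ ≤ T i j₂
  col_strict : ∀ i₁ i₂ j, i₁ < i₂ → 0 < T i₁ j → 0 < T i₂ j → T i₁ j < T i₂ j

/-- Number of boxes of `T` (with shape inside `γ`) with entry `k`. -/
def contentCount (γ : YoungDiagram) (T : ℕ → ℕ → ℕ) (k : ℕ) : ℕ :=
  (γ.cells.filter fun c => T c.1 c.2 = k).card

/-- Number of occurrences of `k` in the prefix of the reverse lattice word of `T` that ends at
position `(i, j)`. The word reads the boxes row by row from top to bottom and each row from right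
to left. -/
def prefixCount (γ : YoungDiagram) (T : ℕ → ℕ → ℕ) (i j k : ℕ) : ℕ :=
  (γ.cells.filter fun c => (c.1 < i ∨ (c.1 = i ∧ j ≤ c.2)) ∧ T c.1 c.2 = k).card

/-- Littlewood-Richardson tableaux of type `(α, β; γ)`: semistandard skew tableaux of shape
`γ/α`, with `β_k` entries equal to `k` for all `k ≥ 1`, whose reverse lattice word satisfies the
Yamanouchi condition. -/
structure IsLittlewoodRichardson (α β γ : YoungDiagram) (T : ℕ → ℕ → ℕ) : Prop
    extends IsSemistandardSkew α γ T where
  content : ∀ k, contentCount γ T (k + 1) = β.rowLen k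
  yamanouchi : ∀ i j k, 1 ≤ k → prefixCount γ T i j (k + 1) ≤ prefixCount γ T i j k

/-- The Littlewood-Richardson coefficient: the number of Littlewood-Richardson tableaux of type
`(α, β; γ)`. -/
noncomputable def lrCoeff (α β γ : YoungDiagram) : ℕ :=
  {T : ℕ → ℕ → ℕ | IsLittlewoodRichardson α β γ T}.ncard

theorem finite_isLittlewoodRichardson (α β γ : YoungDiagram) :
    {T : ℕ → ℕ → ℕ | IsLittlewoodRichardson α β γ T}.Finite := by
  classical
  let F : (γ.cells → Fin (β.colLen 0 + 1)) → ℕ → ℕ → ℕ := fun f i j =>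
    if h : (i, j) ∈ γ.cells then (f ⟨(i, j), h⟩ : ℕ) else 0
  refine (Set.finite_range F).subset ?_
  intro T hT
  have hzero : ∀ i j, (i, j) ∉ γ.cells → T i j = 0 := by
    intro i j h
    by_contra h0
    exact h ((YoungDiagram.mem_cells _).2 ((hT.pos_iff i j).1 (Nat.pos_of_ne_zero h0)).1)
  have hbound : ∀ i j, T i j < β.colLen 0 + 1 := by
    intro i j
    by_contra hlt
    obtain ⟨k, hk⟩ : ∃ k, T i j = k + 1 := ⟨T i j - 1, by omega⟩
    have hpos : 0 < T i j := by omega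
    have hmem : (i, j) ∈ γ := ((hT.pos_iff i j).1 hpos).1
    have h1 : 0 < contentCount γ T (k + 1) :=
      Finset.card_pos.2 ⟨(i, j), Finset.mem_filter.2 ⟨(YoungDiagram.mem_cells _).2 hmem, hk⟩⟩
    rw [hT.content k] at h1
    have h2 : (k, 0) ∈ β := YoungDiagram.mem_iff_lt_rowLen.2 h1
    have h3 := YoungDiagram.mem_iff_lt_colLen.1 h2
    omega
  refine ⟨fun c => ⟨T c.1.1 c.1.2, hbound _ _⟩, ?_⟩
  funext i j
  by_cases h : (i, j) ∈ γ.cells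
  · simp only [F, h, dite_true]
  · simp only [F, h, dite_false, hzero i j h]

/-! ### Zariski topologies -/

/-- The Zariski topology of a finite-dimensional complex vector space `W`: the sets `{p ≠ 0}`
form a basis of open sets, where `p` runs over the polynomial functions on `W`, i.e. over the
algebra of functions generated by the linear forms. -/
@[reducible] def zariskiTopology (W : Type*) [AddCommGroup W] [Module ℂ W] : TopologicalSpace W :=
  TopologicalSpace.generateFrom
    {U | ∃ p ∈ Algebra.adjoin ℂ (Set.range fun φ : Module.Dual ℂ W => (φ : W → ℂ)),
      U = {w | p w ≠ 0}}

/-- Bases of `d`-dimensional subspaces of `V`. -/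
def Frame (d : ℕ) (V : Type*) [AddCommGroup V] [Module ℂ V] : Type _ :=
  {v : Fin d → V // LinearIndependent ℂ v}

/-- Frames form a Zariski open subset of `V ^ d` and carry the subspace topology. -/
instance (d : ℕ) (V : Type*) [AddCommGroup V] [Module ℂ V] : TopologicalSpace (Frame d V) :=
  (zariskiTopology (Fin d → V)).induced Subtype.val

/-- The Grassmannian of `d`-dimensional subspaces of `V`. -/
def SubspaceGrassmannian (d : ℕ) (V : Type*) [AddCommGroup V] [Module ℂ V] : Type _ :=
  {L : Submodule ℂ V // Module.finrank ℂ L = d}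

/-- The subspace spanned by a frame. -/
def Frame.span {d : ℕ} {V : Type*} [AddCommGroup V] [Module ℂ V] (v : Frame d V) :
    SubspaceGrassmannian d V :=
  ⟨Submodule.span ℂ (Set.range v.1), by
    simpa using finrank_span_eq_card v.2⟩

/-- The Zariski topology of the Grassmannian, as the quotient of the variety of frames by the
group `GL_d`: a set of subspaces is open if and only if the set of their bases is. -/
instance (d : ℕ) (V : Type*) [AddCommGroup V] [Module ℂ V] :
    TopologicalSpace (SubspaceGrassmannian d V) :=
  TopologicalSpace.coinduced Frame.span inferInstance

/-! ### The variety of extensions -/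

/-- The variety of all submodules `N` of `M_γ` with `N ≅ M_α` and `M_γ / N ≅ M_β`, as a subset of
the Grassmannian of `|α|`-dimensional subspaces of `M_γ`; equivalently, with `x` the nilpotent
operator `t` on `M_γ`, of the `x`-stable subspaces on which `x` has Jordan type `α`, and on the
quotient by which `x` has Jordan type `β`. -/
def extensionVariety (α β γ : YoungDiagram) :
    Set (SubspaceGrassmannian α.card (TorsionModule γ)) :=
  {L | ∃ N : Submodule ℂ[X] (TorsionModule γ), N.restrictScalars ℂ = L.1 ∧
    Nonempty (N ≃ₗ[ℂ[X]] TorsionModule α) ∧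
    Nonempty ((TorsionModule γ ⧸ N) ≃ₗ[ℂ[X]] TorsionModule β)}

/-!
Multiplication by `t` on a module `M_μ` is modelled by the backward shift on sequences that are
indexed by rows and positions and supported in the boxes of `μ` (`RowSeq`, `boxModule`); in this
model the modules `M_μ` are nested in each other.

A submodule `N` of `M_γ` of type `α` whose quotient is of type `β` defines the chain of submodules
`N_k = {x ∈ M_γ | t ^ k x ∈ N}`. Their types `ε k` form a chain of partitions from `α` to `γ`. Since
`t N_(k+1) ⊆ N_k ⊆ N_(k+1)`, its steps are vertical strips, and their sizes `dim N_(k+1) / N_k` are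
the column lengths of `β`. Since `t` induces injections `N_(k+2) / N_(k+1) → N_(k+1) / N_k` that
respect the kernels of the powers of `t`, the chain satisfies the Yamanouchi condition
(`IsVChain`, `IsExtensionSubmodule.exists_isVChain`). Thus the variety of extensions is the disjoint
union of strata that are indexed by these chains, and it suffices to see that the closures of the
strata are its irreducible components (`encard_irreducibleComponents_extension`).

* Every `N` in the stratum of `ε` is the image of the standard module `M_(ε 0)` under a composite of
  endomorphisms of the modules `M_(ε k)` (`exists_chain`). A generic endomorphism can be
  replaced by one of the unipotent automorphisms `stripMap`, whose coefficients are free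
  (`exists_stripMap_preserves`). Hence the stratum has the same closure as the image of an affine
  space (`vanishesOn_stratum_iff`), and it is irreducible.
* Parameters that satisfy an open condition of transversality do give elements of the stratum, and
  they are determined by them (`IsStripChain.mem_stripImage_iff`, `IsStripChain.param_unique`).
  Hall's theorem and the Yamanouchi condition show that such parameters exist
  (`VLattice.exists_isPivot`). So the dimension of the stratum is the number of parameters, which
  depends on `α`, `β` and `γ` only (`IsVChain.card_frameParam`).
* If a stratum is contained in the closure of another one, both have the same closure, as they have
  the same dimension (`ker_eq_of_ker_le`). As the dimensions that define the types are
  semicontinuous, the strata agree.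

The chains of vertical strips from `β` to `γ` with sizes given by `α` are in bijection with the
Littlewood-Richardson tableaux of type `(α, β; γ)`: both are sides of the same growth diagrams of
partitions (`ncard_isHChain_eq_ncard_isVChain`). This bijection exchanges the roles of `α` and `β`,
which is compensated by duality: with respect to a bilinear form on `M_γ` for which `t` is
self-adjoint, orthogonal complements define a homeomorphism between the varieties of type
`(α, β; γ)` and `(β, α; γ)` (`encard_irreducibleComponents_extensionVariety_comm`).

Finally, short exact sequences correspond to points of the variety, and a space is nonempty if and
only if it has an irreducible component (`nonempty_extensionVariety_iff`).
-/

/-! ### Growth squares -/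

/-- A square of partitions `lam ⊆ nu ⊆ rho`, `lam ⊆ mu ⊆ rho` whose left side `nu / lam` and right
side `rho / mu` are vertical strips and whose bottom side `mu / lam` and top side `rho / nu` are
horizontal strips. The connected components of `rho / lam` are ribbons; `D (i + 1) = 1` records that
the ribbon through rows `i` and `i + 1` starts, at its south-west end, with a box of the horizontal
strip `rho / nu`. The square is completed so that on each ribbon this south-west end has the same
kind (horizontal or vertical) with respect to `nu` as the north-east end has with respect to
`mu`. -/
structure IsGrowthSquare (lam nu mu rho D : ℕ → ℕ) : Prop where
  left : ∀ i, lam i ≤ nu i ∧ nu i ≤ lam i + 1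
  right : ∀ i, mu i ≤ rho i ∧ rho i ≤ mu i + 1
  bot : ∀ i, lam i ≤ mu i ∧ mu (i + 1) ≤ lam i
  top : ∀ i, nu i ≤ rho i ∧ rho (i + 1) ≤ nu i
  zero : D 0 = 0
  le_one : ∀ i, D i ≤ 1
  balance : ∀ i, rho i + lam i + D (i + 1) = nu i + mu i + D i
  down : ∀ i, D (i + 1) = 1 ↔ lam i < rho (i + 1) ∧ (nu (i + 1) = lam (i + 1) ∨ D (i + 1 + 1) = 1)
  up : ∀ i, D (i + 1) = 1 ↔ lam i < rho (i + 1) ∧ (rho i = mu i ∨ D i = 1)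

/-- The local rule: given strips are the left and top sides of a growth square. -/
theorem exists_isGrowthSquare_of_left_top {lam nu rho : ℕ → ℕ}
    (left : ∀ i, lam i ≤ nu i ∧ nu i ≤ lam i + 1) (top : ∀ i, nu i ≤ rho i ∧ rho (i + 1) ≤ nu i)
    (anti : ∀ i, lam (i + 1) ≤ lam i) :
    ∃ mu D, IsGrowthSquare lam nu mu rho D := by
  classical
  -- row `i` is connected to a lower row `p` whose first box in `rho / lam` is not in `nu`
  let C : ℕ → Prop := fun i => ∃ p, i < p ∧ nu p = lam p ∧ ∀ j, i ≤ j → j < p → lam j < rho (j + 1)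
  have hC : ∀ i, C i ↔ lam i < rho (i + 1) ∧ (nu (i + 1) = lam (i + 1) ∨ C (i + 1)) := by
    intro i
    constructor
    · rintro ⟨p, h1, h2, h3⟩
      refine ⟨h3 i le_rfl h1, ?_⟩
      rcases Nat.eq_or_lt_of_le (show i + 1 ≤ p from h1) with h | h
      · left; rw [h]; exact h2
      · right; exact ⟨p, h, h2, fun j hj hj' => h3 j (by omega) hj'⟩
    · rintro ⟨h1, h2 | ⟨p, h3, h4, h5⟩⟩
      · refine ⟨i + 1, by omega, h2, fun j hj hj' => ?_⟩
        obtain rfl : j = i := by omega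
        exact h1
      · refine ⟨p, by omega, h4, fun j hj hj' => ?_⟩
        rcases Nat.eq_or_lt_of_le hj with rfl | h
        · exact h1
        · exact h5 j h hj'
  let D : ℕ → ℕ := fun i => match i with
    | 0 => 0
    | i + 1 => if C i then 1 else 0
  have hD0 : D 0 = 0 := rfl
  have hD1 : ∀ i, D i ≤ 1 := by
    intro i
    cases i with
    | zero => simp [D]
    | succ i => simp only [D]; split_ifs <;> simp
  have hDC : ∀ i, D (i + 1) = 1 ↔ C i := by
    intro i; simp only [D]; split_ifs with h <;> simp [h]
  have hdown : ∀ i, D (i + 1) = 1 ↔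
      lam i < rho (i + 1) ∧ (nu (i + 1) = lam (i + 1) ∨ D (i + 1 + 1) = 1) := by
    intro i; rw [hDC, hDC, hC]
  have key : ∀ i, D i = 1 → lam i < rho i ∧ (nu i = lam i ∨ D (i + 1) = 1) := by
    intro i hi
    cases i with
    | zero => omega
    | succ i => have := (hdown i).1 hi; have := anti i; omega
  refine ⟨fun i => rho i + lam i + D (i + 1) - (nu i + D i), D, left, ?_, ?_, top, hD0, hD1, ?_,
    hdown, ?_⟩
  · intro i
    have := left i; have := top i; have := key i; have := hdown i; have := hD1 i
    have := hD1 (i + 1); have := hD1 (i + 1 + 1)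
    omega
  · intro i
    have := left i; have := top i; have := key i; have := hdown i; have := hD1 i
    have := hD1 (i + 1); have := hD1 (i + 1 + 1); have := left (i + 1); have := top (i + 1)
    have := key (i + 1); have := hdown (i + 1)
    omega
  · intro i
    have := left i; have := top i; have := key i; have := hdown i; have := hD1 i
    have := hD1 (i + 1); have := hD1 (i + 1 + 1)
    omega
  · intro i
    have := left i; have := top i; have := key i; have := hdown i; have := hD1 i
    have := hD1 (i + 1); have := hD1 (i + 1 + 1)
    omega

/-- The inverse local rule: given strips are the bottom and right sides of a growth square. -/
theorem exists_isGrowthSquare_of_bot_right {lam mu rho : ℕ → ℕ}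
    (right : ∀ i, mu i ≤ rho i ∧ rho i ≤ mu i + 1) (bot : ∀ i, lam i ≤ mu i ∧ mu (i + 1) ≤ lam i)
    (anti : ∀ i, rho (i + 1) ≤ rho i) :
    ∃ nu D, IsGrowthSquare lam nu mu rho D := by
  classical
  let D : ℕ → ℕ := fun i => Nat.rec (motive := fun _ => ℕ) 0
    (fun i d => if lam i < rho (i + 1) ∧ (rho i = mu i ∨ d = 1) then 1 else 0) i
  have hD0 : D 0 = 0 := rfl
  have hup : ∀ i, D (i + 1) = 1 ↔ lam i < rho (i + 1) ∧ (rho i = mu i ∨ D i = 1) := by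
    intro i
    change (if lam i < rho (i + 1) ∧ (rho i = mu i ∨ D i = 1) then 1 else 0) = 1 ↔ _
    split_ifs with h <;> simp [h]
  have hD1 : ∀ i, D i ≤ 1 := by
    intro i
    cases i with
    | zero => simp [hD0]
    | succ i =>
      change (if lam i < rho (i + 1) ∧ (rho i = mu i ∨ D i = 1) then 1 else 0) ≤ 1
      split_ifs <;> simp
  have key : ∀ i, D i = 1 → mu i < rho i := by
    intro i hi
    cases i with
    | zero => omega
    | succ i => have := (hup i).1 hi; have := bot i; omega
  refine ⟨fun i => rho i + lam i + D (i + 1) - (mu i + D i), D, ?_, right, bot, ?_, hD0, hD1, ?_,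
    ?_, hup⟩
  · intro i
    have := right i; have := bot i; have := key i; have := hup i; have := hD1 i
    have := hD1 (i + 1)
    omega
  · intro i
    have := right i; have := bot i; have := key i; have := hup i; have := hD1 i
    have := hD1 (i + 1); have := anti i; have := right (i + 1)
    omega
  · intro i
    have := right i; have := bot i; have := key i; have := hup i; have := hD1 i
    have := hD1 (i + 1)
    omega
  · intro i
    have := right i; have := bot i; have := key i; have := hup i; have := hD1 i
    have := hD1 (i + 1); have := right (i + 1); have := key (i + 1); have := hup (i + 1)
    have := hD1 (i + 1 + 1)
    omega

namespace IsGrowthSquare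

variable {lam nu mu rho D : ℕ → ℕ}

theorem D_eq_zero (h : IsGrowthSquare lam nu mu rho D) {i : ℕ} (hi : rho i = 0) : D i = 0 := by
  cases i with
  | zero => exact h.zero
  | succ i => have := h.down i; have := h.le_one (i + 1); omega

theorem unique_mu {n : ℕ} (h : IsGrowthSquare lam nu mu rho D) {mu' D' : ℕ → ℕ}
    (h' : IsGrowthSquare lam nu mu' rho D') (hn : ∀ i, n ≤ i → rho i = 0) : mu = mu' := by
  have key : ∀ t i, n ≤ i + t → D i = D' i := by
    intro t
    induction t with
    | zero => intro i hi; rw [h.D_eq_zero (hn i hi), h'.D_eq_zero (hn i hi)]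
    | succ t ih =>
      intro i hi
      cases i with
      | zero => rw [h.zero, h'.zero]
      | succ i =>
        have h1 := h.down i
        have h2 := h'.down i
        have h3 := ih (i + 1 + 1) (by omega)
        have := h.le_one (i + 1); have := h'.le_one (i + 1)
        rw [h3] at h1
        omega
  funext i
  have := h.balance i; have := h'.balance i; have := key n i (by omega)
  have := key n (i + 1) (by omega)
  omega

theorem unique_nu (h : IsGrowthSquare lam nu mu rho D) {nu' D' : ℕ → ℕ}
    (h' : IsGrowthSquare lam nu' mu rho D') : nu = nu' := by
  have key : ∀ i, D i = D' i := by
    intro i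
    induction i with
    | zero => rw [h.zero, h'.zero]
    | succ i ih =>
      have h1 := h.up i
      have h2 := h'.up i
      have := h.le_one (i + 1); have := h'.le_one (i + 1)
      rw [ih] at h1
      omega
  funext i
  have := h.balance i; have := h'.balance i; have := key i; have := key (i + 1)
  omega

/-- Opposite sides of a growth square have partial sizes that differ by `D`. -/
theorem sum_horizontal (h : IsGrowthSquare lam nu mu rho D) (i : ℕ) :
    ∑ j ∈ Finset.range i, ((mu j : ℤ) - lam j)
      = ∑ j ∈ Finset.range i, ((rho j : ℤ) - nu j) + D i := by
  induction i with
  | zero => simp [h.zero]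
  | succ i ih =>
    rw [Finset.sum_range_succ, Finset.sum_range_succ, ih]
    have := h.balance i
    omega

theorem sum_vertical (h : IsGrowthSquare lam nu mu rho D) (i : ℕ) :
    ∑ j ∈ Finset.range i, ((rho j : ℤ) - mu j) + D i
      = ∑ j ∈ Finset.range i, ((nu j : ℤ) - lam j) := by
  induction i with
  | zero => simp [h.zero]
  | succ i ih =>
    rw [Finset.sum_range_succ, Finset.sum_range_succ, ← ih]
    have := h.balance i
    omega

end IsGrowthSquare

/-- The Yamanouchi condition for two consecutive horizontal strips `b / a` and `c / b`. -/
def HLattice (a b c : ℕ → ℕ) : Prop :=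
  ∀ i, ∑ j ∈ Finset.range (i + 1), ((c j : ℤ) - b j) ≤ ∑ j ∈ Finset.range i, ((b j : ℤ) - a j)

/-- The Yamanouchi condition for two consecutive vertical strips `b / a` and `c / b` of partitions
with at most `n` rows, read from the last row upwards. -/
def VLattice (n : ℕ) (a b c : ℕ → ℕ) : Prop :=
  ∀ i, ∑ j ∈ Finset.Ico i n, ((c j : ℤ) - b j) ≤ ∑ j ∈ Finset.Ico i n, ((b j : ℤ) - a j)

section TwoSquares

variable {n : ℕ}

/-- For two growth squares side by side, the Yamanouchi conditions of the bottom and of the top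
sides are equivalent. -/
theorem hLattice_iff {l0 l1 l2 n0 n1 n2 D e : ℕ → ℕ} (h1 : IsGrowthSquare l0 n0 l1 n1 D)
    (h2 : IsGrowthSquare l1 n1 l2 n2 e) (hn : ∀ i, n ≤ i → n2 i = 0) :
    HLattice l0 l1 l2 ↔ HLattice n0 n1 n2 := by
  have key : ∀ i, ∑ j ∈ Finset.range i, ((l1 j : ℤ) - l0 j)
        - ∑ j ∈ Finset.range (i + 1), ((l2 j : ℤ) - l1 j)
      = ∑ j ∈ Finset.range i, ((n1 j : ℤ) - n0 j)
        - ∑ j ∈ Finset.range (i + 1), ((n2 j : ℤ) - n1 j) + D i - e (i + 1) := by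
    intro i
    rw [h1.sum_horizontal, h2.sum_horizontal]
    ring
  set P : ℕ → ℤ := fun i => ∑ j ∈ Finset.range i, ((n1 j : ℤ) - n0 j)
        - ∑ j ∈ Finset.range (i + 1), ((n2 j : ℤ) - n1 j) with hP
  have hPs : ∀ i, P (i + 1) = P i + (n1 i - n0 i) - (n2 (i + 1) - n1 (i + 1)) := by
    intro i
    simp only [hP, Finset.sum_range_succ]
    ring
  have hP0 : P 0 = - ((n2 0 : ℤ) - n1 0) := by simp [hP]
  have e1 : HLattice n0 n1 n2 ↔ ∀ i, 0 ≤ P i :=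
    forall_congr' fun i => by simp only [hP]; omega
  have e2 : HLattice l0 l1 l2 ↔ ∀ i, 0 ≤ P i + D i - e (i + 1) :=
    forall_congr' fun i => by have := key i; simp only [hP]; omega
  rw [e1, e2]
  constructor
  · -- A violation at `i` would propagate to `i - 1`, and finally to `0`, where `D` vanishes.
    intro h i
    induction i with
    | zero => have := h 0; have := h1.zero; omega
    | succ i ih =>
      by_contra hneg
      have := h (i + 1)
      have := hPs i
      have := h1.le_one (i + 1); have := h1.down i
      have := h1.top i; have := h1.left i; have := h2.top i
      omega
  · -- A violation at `i` would propagate to all larger rows.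
    intro h i
    by_contra hneg
    have step : ∀ t, P (i + t) = 0 ∧ D (i + t) = 0 ∧ e (i + t + 1) = 1 := by
      intro t
      induction t with
      | zero =>
        have := h i; have := h1.le_one i; have := h2.le_one (i + 1)
        simp only [add_zero]
        omega
      | succ t ih =>
        obtain ⟨p1, p2, p3⟩ := ih
        have := hPs (i + t)
        have := h (i + t + 1)
        have := h2.down (i + t)
        have := h1.balance (i + t); have := h1.le_one (i + t + 1)
        have := h1.top (i + t); have := h1.left (i + t)
        have := h1.down (i + t)
        have := h2.le_one (i + t + 1 + 1)
        have := h2.top (i + t); have := h2.left (i + t); have := h1.right (i + t)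
        have := h1.balance (i + t + 1)
        have := h1.le_one (i + t + 1 + 1)
        have := h1.left (i + t + 1)
        have := h1.right (i + t + 1)
        have := h2.left (i + t + 1)
        rw [show i + (t + 1) = i + t + 1 by ring]
        omega
    have := step n
    have := h2.D_eq_zero (hn (i + n + 1) (by omega))
    omega

/-- For two growth squares on top of each other, the Yamanouchi conditions of the left and of the
right sides are equivalent. -/
theorem vLattice_iff {l0 l1 l2 m0 m1 m2 D e : ℕ → ℕ} (h1 : IsGrowthSquare l0 l1 m0 m1 D)
    (h2 : IsGrowthSquare l1 l2 m1 m2 e) (hn : ∀ i, n ≤ i → m2 i = 0) :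
    VLattice n l0 l1 l2 ↔ VLattice n m0 m1 m2 := by
  have hn1 : ∀ i, n ≤ i → m1 i = 0 := fun i hi => by
    have := h2.right i; have := hn i hi; omega
  have hsum : ∀ {a b c d D' : ℕ → ℕ}, IsGrowthSquare a b c d D' → (∀ i, n ≤ i → d i = 0) →
      ∀ i, ∑ j ∈ Finset.Ico i n, ((d j : ℤ) - c j) = ∑ j ∈ Finset.Ico i n, ((b j : ℤ) - a j) + D' i
      := by
    intro a b c d D' hs hd i
    rcases le_total i n with hi | hi
    · have e1 := hs.sum_vertical i
      have e2 := hs.sum_vertical n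
      have e3 := hs.D_eq_zero (hd n le_rfl)
      rw [Finset.sum_Ico_eq_sub _ hi, Finset.sum_Ico_eq_sub _ hi]
      omega
    · rw [Finset.Ico_eq_empty_of_le hi, hs.D_eq_zero (hd i hi)]
      simp
  set Q : ℕ → ℤ := fun i => ∑ j ∈ Finset.Ico i n, ((l1 j : ℤ) - l0 j)
        - ∑ j ∈ Finset.Ico i n, ((l2 j : ℤ) - l1 j) with hQ
  have key : ∀ i, ∑ j ∈ Finset.Ico i n, ((m1 j : ℤ) - m0 j)
      - ∑ j ∈ Finset.Ico i n, ((m2 j : ℤ) - m1 j) = Q i + D i - e i := by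
    intro i
    rw [hsum h1 hn1, hsum h2 hn]
    ring
  have hl : ∀ i, n ≤ i → l0 i = 0 ∧ l1 i = 0 ∧ l2 i = 0 := fun i hi => by
    have := hn i hi; have := h2.right i; have := h2.left i; have := h1.left i; have := h2.top i
    omega
  have hQs : ∀ i, Q i = Q (i + 1) + (l1 i - l0 i) - (l2 i - l1 i) := by
    intro i
    rcases lt_or_ge i n with hi | hi
    · simp only [hQ, Finset.sum_eq_sum_Ico_succ_bot hi]
      ring
    · simp only [hQ, Finset.Ico_eq_empty_of_le hi,
        Finset.Ico_eq_empty_of_le (show n ≤ i + 1 by omega)]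
      have := hl i hi
      simp [this]
  have e1 : VLattice n l0 l1 l2 ↔ ∀ i, 0 ≤ Q i :=
    forall_congr' fun i => by simp only [hQ]; omega
  have e2 : VLattice n m0 m1 m2 ↔ ∀ i, 0 ≤ Q i + D i - e i :=
    forall_congr' fun i => by have := key i; omega
  rw [e1, e2]
  constructor
  · -- A violation at `m + 1` would propagate to all larger rows.
    intro h i
    by_contra hneg
    have := h1.le_one i; have := h2.le_one i; have := h i
    obtain ⟨m, rfl⟩ : ∃ m, i = m + 1 := by
      cases i with
      | zero => have := h2.zero; omega
      | succ m => exact ⟨m, rfl⟩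
    have step : ∀ t, Q (m + t + 1) = 0 ∧ D (m + t + 1) = 0 ∧ e (m + t + 1) = 1 := by
      intro t
      induction t with
      | zero => simp only [add_zero]; omega
      | succ t ih =>
        obtain ⟨p1, p2, p3⟩ := ih
        have := hQs (m + t); have := hQs (m + t + 1)
        have := h (m + t); have := h (m + t + 1 + 1)
        have := h2.down (m + t); have := h1.down (m + t)
        have := h1.left (m + t); have := h2.left (m + t)
        have := h1.left (m + t + 1); have := h2.left (m + t + 1)
        have := h2.balance (m + t + 1); have := h2.right (m + t + 1)
        have := h2.top (m + t); have := h2.top (m + t + 1); have := h1.top (m + t)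
        have := h1.le_one (m + t + 1 + 1); have := h2.le_one (m + t + 1 + 1)
        rw [show m + (t + 1) + 1 = m + t + 1 + 1 by ring]
        omega
    have := step n
    have := h2.D_eq_zero (hn (m + n + 1) (by omega))
    omega
  · -- A violation at `m + 1` would propagate to `m`, and finally to `0`.
    intro h
    have step : ∀ i, Q i < 0 → Q i = -1 ∧ D i = 1 ∧ e i = 0 := by
      intro i hi
      have := h i; have := h1.le_one i; have := h2.le_one i
      omega
    intro i
    induction i with
    | zero =>
      by_contra hneg
      have := step 0 (by omega); have := h1.zero
      omega
    | succ m ih =>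
      by_contra hneg
      have := step (m + 1) (by omega)
      have := hQs m; have := hQs (m + 1)
      have := h (m + 1 + 1)
      have := h2.down m; have := h1.down m
      have := h2.down (m + 1); have := h1.down (m + 1); have := h1.top (m + 1)
      have := h1.left m; have := h2.left m
      have := h1.left (m + 1); have := h2.left (m + 1)
      have := h1.balance (m + 1); have := h2.balance (m + 1)
      have := h2.right (m + 1); have := h1.right (m + 1)
      have := h2.top m; have := h2.top (m + 1); have := h1.top m
      have := h1.le_one (m + 1 + 1); have := h2.le_one (m + 1 + 1)
      have := h2.bot (m + 1)
      omega

end TwoSquares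

/-! ### Chains of strips and the growth bijection -/

/-- Chains of horizontal strips from `α` to `γ` with sizes `β_k` and the Yamanouchi condition:
Littlewood-Richardson tableaux of type `(α, β; γ)`, where `δ k i` is the number of boxes of `γ` in
row `i` that belong to `α` or have an entry `≤ k`. -/
structure IsHChain (α β γ : YoungDiagram) (δ : ℕ → ℕ → ℕ) : Prop where
  zero : δ 0 = α.rowLen
  strip : ∀ k i, δ k i ≤ δ (k + 1) i ∧ δ (k + 1) (i + 1) ≤ δ k i
  size : ∀ k, ∑ i ∈ Finset.range (γ.colLen 0), ((δ (k + 1) i : ℤ) - δ k i) = β.rowLen k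
  top : ∀ k, β.colLen 0 ≤ k → δ k = γ.rowLen
  lattice : ∀ k, HLattice (δ k) (δ (k + 1)) (δ (k + 2))

/-- Chains of vertical strips from `α` to `γ` whose sizes are the column lengths of `β`, with the
Yamanouchi condition: transposed Littlewood-Richardson tableaux. -/
structure IsVChain (α β γ : YoungDiagram) (ε : ℕ → ℕ → ℕ) : Prop where
  zero : ε 0 = α.rowLen
  anti : ∀ k i, ε k (i + 1) ≤ ε k i
  strip : ∀ k i, ε k i ≤ ε (k + 1) i ∧ ε (k + 1) i ≤ ε k i + 1
  size : ∀ k, ∑ i ∈ Finset.range (γ.colLen 0), ((ε (k + 1) i : ℤ) - ε k i) = β.colLen k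
  top : ∀ k, β.rowLen 0 ≤ k → ε k = γ.rowLen
  lattice : ∀ k, VLattice (γ.colLen 0) (ε k) (ε (k + 1)) (ε (k + 2))

theorem YoungDiagram.rowLen_eq_zero {μ : YoungDiagram} {i : ℕ} (h : μ.colLen 0 ≤ i) :
    μ.rowLen i = 0 := by
  by_contra h0
  have h1 : (i, 0) ∈ μ := YoungDiagram.mem_iff_lt_rowLen.2 (Nat.pos_of_ne_zero h0)
  have := YoungDiagram.mem_iff_lt_colLen.1 h1
  omega

theorem YoungDiagram.colLen_eq_zero {μ : YoungDiagram} {i : ℕ} (h : μ.rowLen 0 ≤ i) :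
    μ.colLen i = 0 := by
  by_contra h0
  have h1 : (0, i) ∈ μ := YoungDiagram.mem_iff_lt_colLen.2 (Nat.pos_of_ne_zero h0)
  have := YoungDiagram.mem_iff_lt_rowLen.1 h1
  omega

theorem YoungDiagram.lt_rowLen_iff {μ : YoungDiagram} {i j : ℕ} :
    j < μ.rowLen i ↔ i < μ.colLen j := by
  rw [← YoungDiagram.mem_iff_lt_rowLen, YoungDiagram.mem_iff_lt_colLen]

/-- A row of growth squares with given top sides and given left side. -/
theorem exists_growth_row {C : ℕ → ℕ → ℕ}
    (hC : ∀ k i, C k i ≤ C (k + 1) i ∧ C (k + 1) (i + 1) ≤ C k i) {lam : ℕ → ℕ}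
    (hlam : ∀ i, lam (i + 1) ≤ lam i) (left : ∀ i, lam i ≤ C 0 i ∧ C 0 i ≤ lam i + 1) :
    ∃ W : ℕ → ℕ → ℕ, W 0 = lam ∧
      ∀ k, ∃ D, IsGrowthSquare (W k) (C k) (W (k + 1)) (C (k + 1)) D := by
  classical
  let f : (ℕ → ℕ) → (ℕ → ℕ) → (ℕ → ℕ) → (ℕ → ℕ) := fun l n r =>
    if h : ∃ mu D, IsGrowthSquare l n mu r D then h.choose else l
  have hf : ∀ l n r, (∃ mu D, IsGrowthSquare l n mu r D) →
      ∃ D, IsGrowthSquare l n (f l n r) r D := by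
    intro l n r h
    simp only [f, dif_pos h]
    exact h.choose_spec
  let W : ℕ → ℕ → ℕ := fun k => Nat.rec (motive := fun _ => ℕ → ℕ) lam
    (fun k w => f w (C k) (C (k + 1))) k
  have hW : ∀ k, (∀ i, W k (i + 1) ≤ W k i) ∧ (∀ i, W k i ≤ C k i ∧ C k i ≤ W k i + 1) := by
    intro k
    induction k with
    | zero => exact ⟨hlam, left⟩
    | succ k ih =>
      obtain ⟨D, hD⟩ := hf _ _ _ (exists_isGrowthSquare_of_left_top ih.2 (hC k) ih.1)
      exact ⟨fun i => (hD.bot i).2.trans (hD.bot i).1, hD.right⟩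
  exact ⟨W, rfl, fun k => hf _ _ _ (exists_isGrowthSquare_of_left_top (hW k).2 (hC k) (hW k).1)⟩

/-- A column of growth squares with given right sides and given bottom side. -/
theorem exists_growth_column {C : ℕ → ℕ → ℕ}
    (hC : ∀ k i, C k i ≤ C (k + 1) i ∧ C (k + 1) i ≤ C k i + 1)
    (anti : ∀ k i, C k (i + 1) ≤ C k i)
    {lam : ℕ → ℕ} (bot : ∀ i, lam i ≤ C 0 i ∧ C 0 (i + 1) ≤ lam i) :
    ∃ W : ℕ → ℕ → ℕ, W 0 = lam ∧
      ∀ k, ∃ D, IsGrowthSquare (W k) (W (k + 1)) (C k) (C (k + 1)) D := by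
  classical
  let f : (ℕ → ℕ) → (ℕ → ℕ) → (ℕ → ℕ) → (ℕ → ℕ) := fun l m r =>
    if h : ∃ nu D, IsGrowthSquare l nu m r D then h.choose else l
  have hf : ∀ l m r, (∃ nu D, IsGrowthSquare l nu m r D) →
      ∃ D, IsGrowthSquare l (f l m r) m r D := by
    intro l m r h
    simp only [f, dif_pos h]
    exact h.choose_spec
  let W : ℕ → ℕ → ℕ := fun k => Nat.rec (motive := fun _ => ℕ → ℕ) lam
    (fun k w => f w (C k) (C (k + 1))) k
  have hW : ∀ k, (∀ i, W k i ≤ C k i ∧ C k (i + 1) ≤ W k i) := by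
    intro k
    induction k with
    | zero => exact bot
    | succ k ih =>
      obtain ⟨D, hD⟩ := hf _ _ _ (exists_isGrowthSquare_of_bot_right (hC k) ih (anti (k + 1)))
      exact hD.top
  exact ⟨W, rfl, fun k => hf _ _ _
    (exists_isGrowthSquare_of_bot_right (hC k) (hW k) (anti (k + 1)))⟩

theorem exists_growth_rows (L : ℕ → ℕ → ℕ)
    (hL : ∀ j i, L j i ≤ L (j + 1) i ∧ L (j + 1) i ≤ L j i + 1)
    (hLa : ∀ j i, L j (i + 1) ≤ L j i) (a : ℕ) :
    ∀ C : ℕ → ℕ → ℕ, (∀ k i, C k i ≤ C (k + 1) i ∧ C (k + 1) (i + 1) ≤ C k i) → C 0 = L a →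
    ∃ G : ℕ → ℕ → ℕ → ℕ, G a = C ∧ (∀ j, j ≤ a → G j 0 = L j) ∧
      ∀ j, j < a → ∀ k, ∃ D,
        IsGrowthSquare (G j k) (G (j + 1) k) (G j (k + 1)) (G (j + 1) (k + 1)) D := by
  induction a with
  | zero =>
    intro C hC h0
    refine ⟨fun _ => C, rfl, fun j hj => ?_, fun j hj => absurd hj (Nat.not_lt_zero j)⟩
    obtain rfl : j = 0 := by omega
    exact h0
  | succ a ih =>
    intro C hC h0
    obtain ⟨W, hW0, hW⟩ := exists_growth_row hC (hLa a) (by rw [h0]; exact hL a)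
    obtain ⟨G, hG, hG0, hGs⟩ := ih W (fun k => (hW k).choose_spec.bot) hW0
    refine ⟨fun j => if j ≤ a then G j else C, by simp, fun j hj => ?_, fun j hj k => ?_⟩
    · by_cases h : j ≤ a
      · simp [h, hG0 j h]
      · obtain rfl : j = a + 1 := by omega
        simp [h0]
    · rcases Nat.lt_or_ge j a with h | h
      · have h1 : j ≤ a := by omega
        have h2 : j + 1 ≤ a := by omega
        simp only [h1, h2, if_true]
        exact hGs j h k
      · obtain rfl : j = a := by omega
        simpa [hG] using hW k

theorem exists_growth_columns (L : ℕ → ℕ → ℕ)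
    (hL : ∀ j i, L j i ≤ L (j + 1) i ∧ L (j + 1) (i + 1) ≤ L j i) (a : ℕ) :
    ∀ C : ℕ → ℕ → ℕ, (∀ k i, C k i ≤ C (k + 1) i ∧ C (k + 1) i ≤ C k i + 1) →
      (∀ k i, C k (i + 1) ≤ C k i) → C 0 = L a →
    ∃ G : ℕ → ℕ → ℕ → ℕ, (∀ k, G k a = C k) ∧ (∀ j, j ≤ a → G 0 j = L j) ∧
      ∀ j, j < a → ∀ k, ∃ D,
        IsGrowthSquare (G k j) (G (k + 1) j) (G k (j + 1)) (G (k + 1) (j + 1)) D := by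
  induction a with
  | zero =>
    intro C hC hCa h0
    refine ⟨fun k _ => C k, fun _ => rfl, fun j hj => ?_, fun j hj => absurd hj (Nat.not_lt_zero j)⟩
    obtain rfl : j = 0 := by omega
    exact h0
  | succ a ih =>
    intro C hC hCa h0
    obtain ⟨W, hW0, hW⟩ := exists_growth_column hC hCa (by rw [h0]; exact hL a)
    have anti : ∀ k i, W k (i + 1) ≤ W k i := fun k i => by
      have := (hW k).choose_spec.bot i; have := (hW k).choose_spec.bot (i + 1); omega
    obtain ⟨G, hG, hG0, hGs⟩ := ih W (fun k => (hW k).choose_spec.left) anti hW0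
    refine ⟨fun k j => if j ≤ a then G k j else C k, by simp, fun j hj => ?_, fun j hj k => ?_⟩
    · by_cases h : j ≤ a
      · simp [h, hG0 j h]
      · obtain rfl : j = a + 1 := by omega
        simp [h0]
    · rcases Nat.lt_or_ge j a with h | h
      · have h1 : j ≤ a := by omega
        have h2 : j + 1 ≤ a := by omega
        simp only [h1, h2, if_true]
        exact hGs j h k
      · obtain rfl : j = a := by omega
        simpa [hG] using hW k

/-- A growth diagram of type `(α, β; γ)`: its left column fills `α` column by column, its bottom row
fills `β` row by row, and it ends in `γ`. -/
structure IsGrowthDiagram (α β γ : YoungDiagram) (G : ℕ → ℕ → ℕ → ℕ) : Prop where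
  square : ∀ j k, ∃ D, IsGrowthSquare (G j k) (G (j + 1) k) (G j (k + 1)) (G (j + 1) (k + 1)) D
  left : ∀ j i, G j 0 i = min (α.rowLen i) j
  bot : ∀ k i, G 0 k i = if i < k then β.rowLen i else 0
  corner : ∀ j k, α.rowLen 0 ≤ j → β.colLen 0 ≤ k → G j k = γ.rowLen

section Canonical

variable {n : ℕ}

/-- A Yamanouchi chain of horizontal strips that starts from the empty partition fills the rows one
after the other. -/
theorem hLattice_canonical {b : ℕ → ℕ} {δ : ℕ → ℕ → ℕ} (h0 : ∀ i, δ 0 i = 0)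
    (strip : ∀ k i, δ k i ≤ δ (k + 1) i ∧ δ (k + 1) (i + 1) ≤ δ k i)
    (lattice : ∀ k, HLattice (δ k) (δ (k + 1)) (δ (k + 2)))
    (hn : ∀ k i, n ≤ i → δ k i = 0)
    (size : ∀ k, ∑ i ∈ Finset.range n, ((δ (k + 1) i : ℤ) - δ k i) = b k) (k i : ℕ) :
    δ k i = if i < k then b i else 0 := by
  have hbound : ∀ k i, k ≤ i → δ k i = 0 := by
    intro k
    induction k with
    | zero => intro i _; exact h0 i
    | succ k ih =>
      intro i hi
      obtain ⟨i, rfl⟩ : ∃ m, i = m + 1 := ⟨i - 1, by omega⟩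
      have := (strip k i).2
      have := ih i (by omega)
      omega
  have hlow : ∀ k, ∑ j ∈ Finset.range k, ((δ (k + 1) j : ℤ) - δ k j) ≤ 0 := by
    intro k
    induction k with
    | zero => simp
    | succ k ih => exact (lattice k k).trans ih
  have hfix : ∀ k j, j < k → δ (k + 1) j = δ k j := by
    intro k j hj
    have h1 := (Finset.sum_eq_zero_iff_of_nonneg (s := Finset.range k)
      (f := fun j => (δ (k + 1) j : ℤ) - δ k j) (fun j _ => by have := (strip k j).1; omega)).1
      (le_antisymm (hlow k) (Finset.sum_nonneg fun j _ => by have := (strip k j).1; omega))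
      j (Finset.mem_range.2 hj)
    omega
  have hdiag : ∀ k, δ (k + 1) k = b k := by
    intro k
    have h1 := size k
    have h2 : ∀ i ∈ Finset.range n, i ≠ k → (δ (k + 1) i : ℤ) - δ k i = 0 := by
      intro i _ hik
      rcases Nat.lt_or_ge i k with h | h
      · rw [hfix k i h]; ring
      · rw [hbound (k + 1) i (by omega), hbound k i (by omega)]; simp
    rw [Finset.sum_eq_single k h2 ?_, hbound k k le_rfl] at h1
    · simpa using h1
    · intro hk
      simp only [Finset.mem_range, not_lt] at hk
      rw [hn _ _ hk, hn _ _ hk]; simp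
  induction k with
  | zero => simp [h0]
  | succ k ih =>
    rcases lt_trichotomy i k with h | h | h
    · rw [hfix k i h, ih]; simp [h, show i < k + 1 by omega]
    · subst h; simp [hdiag]
    · rw [hbound (k + 1) i (by omega)]; simp [show ¬ i < k + 1 by omega]

theorem sum_of_hLattice_canonical {β : YoungDiagram} {δ : ℕ → ℕ → ℕ}
    (h : ∀ k i, δ k i = if i < k then β.rowLen i else 0) (k m : ℕ) :
    ∑ j ∈ Finset.range m, ((δ (k + 1) j : ℤ) - δ k j) = if k < m then (β.rowLen k : ℤ) else 0 := by
  induction m with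
  | zero => simp
  | succ m ih =>
    rw [Finset.sum_range_succ, ih, h, h]
    rcases lt_trichotomy k m with h2 | rfl | h2
    · rw [if_pos h2, if_neg (by omega), if_neg (by omega), if_pos (by omega)]; simp
    · simp
    · rw [if_neg (by omega), if_pos (by omega), if_pos (by omega), if_neg (by omega)]; simp

theorem hLattice_of_canonical {β : YoungDiagram} {δ : ℕ → ℕ → ℕ}
    (h : ∀ k i, δ k i = if i < k then β.rowLen i else 0) (k : ℕ) :
    HLattice (δ k) (δ (k + 1)) (δ (k + 2)) := by
  intro i
  rw [sum_of_hLattice_canonical h (k + 1), sum_of_hLattice_canonical h k]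
  have := β.rowLen_anti k (k + 1) (by omega)
  split_ifs <;> omega

theorem eq_of_sum_initial {s : ℕ → ℤ} {c : ℕ} (h01 : ∀ i, 0 ≤ s i ∧ s i ≤ 1)
    (anti : ∀ i, s (i + 1) ≤ s i) (hn : ∀ i, n ≤ i → s i = 0)
    (hs : ∑ i ∈ Finset.range n, s i = c) (i : ℕ) : s i = if i < c then 1 else 0 := by
  have hanti : Antitone s := antitone_nat_of_succ_le anti
  have hc : s c = 0 := by
    by_contra hne
    have h1 : s c = 1 := by have := h01 c; omega
    have hcn : c < n := by
      by_contra h; have := hn c (by omega); omega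
    have : ∑ i ∈ Finset.range (c + 1), s i ≤ ∑ i ∈ Finset.range n, s i :=
      Finset.sum_le_sum_of_subset_of_nonneg (Finset.range_mono hcn) fun i _ _ => (h01 i).1
    have h2 : ∑ i ∈ Finset.range (c + 1), s i = ∑ i ∈ Finset.range (c + 1), (1 : ℤ) :=
      Finset.sum_congr rfl fun i hi => by
        have := hanti (show i ≤ c by have := Finset.mem_range.1 hi; omega)
        have := h01 i
        omega
    rw [h2] at this
    simp at this
    omega
  have hz : ∀ i, c ≤ i → s i = 0 := fun i hi => by
    have := hanti hi; have := h01 i; omega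
  split_ifs with hi
  · have h3 : ∑ i ∈ Finset.range n, s i = ∑ i ∈ Finset.range c, s i := by
      rcases le_total n c with h | h
      · refine Finset.sum_subset (Finset.range_mono h) fun i _ hi => hn i (by simpa using hi)
      · refine (Finset.sum_subset (Finset.range_mono h) fun i _ hi => hz i (by simpa using hi)).symm
    have h4 : ∑ i ∈ Finset.range c, (1 - s i) = 0 := by
      rw [Finset.sum_sub_distrib, ← h3, hs]; simp
    have h5 := (Finset.sum_eq_zero_iff_of_nonneg (fun i _ => by have := h01 i; omega)).1 h4 i
      (Finset.mem_range.2 hi)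
    omega
  · exact hz i (by omega)

/-- A Yamanouchi chain of vertical strips that starts from the empty partition fills the columns one
after the other. -/
theorem vLattice_canonical {α : YoungDiagram} {ε : ℕ → ℕ → ℕ} (h0 : ∀ i, ε 0 i = 0)
    (anti : ∀ k i, ε k (i + 1) ≤ ε k i)
    (strip : ∀ k i, ε k i ≤ ε (k + 1) i ∧ ε (k + 1) i ≤ ε k i + 1)
    (lattice : ∀ k, VLattice n (ε k) (ε (k + 1)) (ε (k + 2)))
    (hn : ∀ k i, n ≤ i → ε k i = 0)
    (size : ∀ k, ∑ i ∈ Finset.range n, ((ε (k + 1) i : ℤ) - ε k i) = α.colLen k) (k i : ℕ) :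
    ε k i = min (α.rowLen i) k := by
  induction k using Nat.strong_induction_on generalizing i with | _ k ih' =>
  cases k with
  | zero => simp [h0]
  | succ k =>
    have ih : ∀ i, ε k i = min (α.rowLen i) k := ih' k (by omega)
    have hanti : ∀ i, ((ε (k + 1) (i + 1) : ℤ) - ε k (i + 1)) ≤ (ε (k + 1) i : ℤ) - ε k i := by
      intro i
      rcases Nat.lt_or_ge (α.rowLen (i + 1)) k with h | h
      · -- The previous strip does not meet the rows from `i + 1` on.
        obtain ⟨k, rfl⟩ : ∃ m, k = m + 1 := ⟨k - 1, by omega⟩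
        have hz : ε (k + 1 + 1) (i + 1) = ε (k + 1) (i + 1) := by
          rcases Nat.lt_or_ge (i + 1) n with hin | hin
          · have h1 := lattice k (i + 1)
            have h2 : ∑ j ∈ Finset.Ico (i + 1) n, ((ε (k + 1) j : ℤ) - ε k j) = 0 := by
              refine Finset.sum_eq_zero fun j hj => ?_
              have h3 := α.rowLen_anti (i + 1) j (Finset.mem_Ico.1 hj).1
              rw [ih j, ih' k (by omega) j]
              omega
            rw [h2] at h1
            have h3 := (Finset.sum_eq_zero_iff_of_nonneg (s := Finset.Ico (i + 1) n)
              (f := fun j => (ε (k + 1 + 1) j : ℤ) - ε (k + 1) j)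
              (fun j _ => by have := (strip (k + 1) j).1; omega)).1
              (le_antisymm h1 (Finset.sum_nonneg fun j _ => by
                have := (strip (k + 1) j).1; omega)) (i + 1) (Finset.mem_Ico.2 ⟨le_rfl, hin⟩)
            omega
          · rw [hn _ _ hin, hn _ _ hin]
        have := (strip (k + 1) i).1
        omega
      · have h1 := ih (i + 1)
        have h2 := ih i
        have := α.rowLen_anti i (i + 1) (by omega)
        have := anti (k + 1) i
        omega
    have h1 := eq_of_sum_initial (n := n) (s := fun i => (ε (k + 1) i : ℤ) - ε k i)
      (c := α.colLen k) (fun i => by have := strip k i; omega) hanti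
      (fun i hi => by simp [hn _ _ hi]) (size k) i
    have h2 := @YoungDiagram.lt_rowLen_iff α i k
    have h3 := ih i
    split_ifs at h1 <;> omega

end Canonical

theorem sum_min_rowLen {α : YoungDiagram} {n : ℕ} (hn : ∀ i, n ≤ i → α.rowLen i = 0) (j : ℕ) :
    ∑ i ∈ Finset.range n, ((min (α.rowLen i) (j + 1) : ℕ) - (min (α.rowLen i) j : ℕ) : ℤ)
      = α.colLen j := by
  have hc : α.colLen j ≤ n := by
    by_contra h
    have := YoungDiagram.lt_rowLen_iff.2 (show n < α.colLen j by omega)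
    have := hn n le_rfl
    omega
  have h1 : ∀ i ∈ Finset.range n, ((min (α.rowLen i) (j + 1) : ℕ) - (min (α.rowLen i) j : ℕ) : ℤ)
      = if i < α.colLen j then 1 else 0 := by
    intro i _
    have := @YoungDiagram.lt_rowLen_iff α i j
    split_ifs <;> omega
  rw [Finset.sum_congr rfl h1, Finset.sum_boole]
  have : (Finset.range n).filter (fun i => i < α.colLen j) = Finset.range (α.colLen j) := by
    ext i; simp only [Finset.mem_filter, Finset.mem_range]; omega
  rw [this]
  simp

namespace IsGrowthDiagram

variable {α β γ : YoungDiagram} {G G' : ℕ → ℕ → ℕ → ℕ}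

theorem eq_zero (h : IsGrowthDiagram α β γ G) {j k i : ℕ} (hi : γ.colLen 0 ≤ i) : G j k i = 0 := by
  have h1 : ∀ t, G j k i ≤ G (j + t) k i := by
    intro t
    induction t with
    | zero => exact le_rfl
    | succ t ih => exact ih.trans ((h.square (j + t) k).choose_spec.left i).1
  have h2 : ∀ j' t, G j' k i ≤ G j' (k + t) i := by
    intro j' t
    induction t with
    | zero => exact le_rfl
    | succ t ih => exact ih.trans ((h.square j' (k + t)).choose_spec.bot i).1
  have h3 := (h1 (α.rowLen 0)).trans (h2 _ (β.colLen 0))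
  rw [h.corner _ _ (Nat.le_add_left _ _) (Nat.le_add_left _ _),
    YoungDiagram.rowLen_eq_zero hi] at h3
  omega

theorem sum_row (h : IsGrowthDiagram α β γ G) (j k : ℕ) :
    ∑ i ∈ Finset.range (γ.colLen 0), ((G j (k + 1) i : ℤ) - G j k i) = β.rowLen k := by
  induction j with
  | zero =>
    rw [sum_of_hLattice_canonical h.bot]
    split_ifs with hk
    · rfl
    · have := h.bot (k + 1) k
      rw [h.eq_zero (by omega)] at this
      simp at this
      omega
  | succ j ih =>
    obtain ⟨D, hD⟩ := h.square j k
    have h1 := hD.sum_horizontal (γ.colLen 0)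
    rw [hD.D_eq_zero (h.eq_zero le_rfl), ih] at h1
    simpa using h1.symm

theorem sum_column (h : IsGrowthDiagram α β γ G) (j k : ℕ) :
    ∑ i ∈ Finset.range (γ.colLen 0), ((G (j + 1) k i : ℤ) - G j k i) = α.colLen j := by
  induction k with
  | zero =>
    rw [← sum_min_rowLen (α := α) (n := γ.colLen 0) _ j]
    · exact Finset.sum_congr rfl fun i _ => by rw [h.left, h.left]
    · intro i hi
      have h1 := h.left (α.rowLen i) i
      rw [h.eq_zero hi] at h1
      simpa using h1.symm
  | succ k ih =>
    obtain ⟨D, hD⟩ := h.square j k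
    have h1 := hD.sum_vertical (γ.colLen 0)
    rw [hD.D_eq_zero (h.eq_zero le_rfl), ih] at h1
    simpa using h1

theorem isHChain (h : IsGrowthDiagram α β γ G) : IsHChain α β γ (G (α.rowLen 0)) where
  zero := by
    funext i
    rw [h.left, min_eq_left (α.rowLen_anti 0 i (by omega))]
  strip k i := (h.square (α.rowLen 0) k).choose_spec.bot i
  size k := h.sum_row _ k
  top k hk := h.corner _ _ le_rfl hk
  lattice k := by
    have : ∀ j, HLattice (G j k) (G j (k + 1)) (G j (k + 2)) := by
      intro j
      induction j with
      | zero => exact hLattice_of_canonical h.bot k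
      | succ j ih =>
        exact (hLattice_iff (n := γ.colLen 0) (h.square j k).choose_spec
          (h.square j (k + 1)).choose_spec fun i hi => h.eq_zero hi).1 ih
    exact this _

theorem isVChain (h : IsGrowthDiagram α β γ G) :
    IsVChain β α γ (fun j => G j (β.colLen 0)) where
  zero := by
    funext i
    rw [h.bot]
    split_ifs with hi
    · rfl
    · exact (YoungDiagram.rowLen_eq_zero (by omega)).symm
  anti j i := by
    have := (h.square j (β.colLen 0)).choose_spec.bot i
    have := (h.square j (β.colLen 0)).choose_spec.bot (i + 1)
    omega
  strip j i := (h.square j (β.colLen 0)).choose_spec.left i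
  size j := h.sum_column j _
  top j hj := h.corner _ _ hj le_rfl
  lattice j := by
    have : ∀ k, VLattice (γ.colLen 0) (G j k) (G (j + 1) k) (G (j + 2) k) := by
      intro k
      induction k with
      | zero =>
        intro i
        refine Finset.sum_le_sum fun m _ => ?_
        simp only [h.left]
        omega
      | succ k ih =>
        exact (vLattice_iff (n := γ.colLen 0) (h.square j k).choose_spec
          (h.square (j + 1) k).choose_spec fun i hi => h.eq_zero hi).1 ih
    exact this _

theorem row_unique (h : IsGrowthDiagram α β γ G) (h' : IsGrowthDiagram α β γ G')
    (hr : G (α.rowLen 0) = G' (α.rowLen 0)) (j k : ℕ) (hk : β.colLen 0 ≤ k) : G j k = G' j k := by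
  have key : ∀ t j, j + t = α.rowLen 0 → G j = G' j := by
    intro t
    induction t with
    | zero => intro j hj; rw [show j = α.rowLen 0 by omega, hr]
    | succ t ih =>
      intro j hj
      have h1 := ih (j + 1) (by omega)
      funext k
      induction k with
      | zero => funext i; rw [h.left, h'.left]
      | succ k ihk =>
        obtain ⟨D, hD⟩ := h.square j k
        obtain ⟨D', hD'⟩ := h'.square j k
        rw [← ihk, ← h1] at hD'
        exact hD.unique_mu (n := γ.colLen 0) hD' fun i hi => h.eq_zero hi
  rcases le_total j (α.rowLen 0) with hj | hj
  · rw [key (α.rowLen 0 - j) j (by omega)]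
  · rw [h.corner j k hj hk, h'.corner j k hj hk]

theorem column_unique (h : IsGrowthDiagram α β γ G) (h' : IsGrowthDiagram α β γ G')
    (hr : ∀ j, G j (β.colLen 0) = G' j (β.colLen 0)) (j k : ℕ) (hj : α.rowLen 0 ≤ j) :
    G j k = G' j k := by
  have key : ∀ t k, k + t = β.colLen 0 → ∀ j, G j k = G' j k := by
    intro t
    induction t with
    | zero => intro k hk j; rw [show k = β.colLen 0 by omega, hr]
    | succ t ih =>
      intro k hk j
      have h1 := ih (k + 1) (by omega)
      induction j with
      | zero => funext i; rw [h.bot, h'.bot]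
      | succ j ihj =>
        obtain ⟨D, hD⟩ := h.square j k
        obtain ⟨D', hD'⟩ := h'.square j k
        rw [← ihj, ← h1, ← h1] at hD'
        exact hD.unique_nu hD'
  rcases le_total k (β.colLen 0) with hk | hk
  · rw [key (β.colLen 0 - k) k (by omega)]
  · rw [h.corner j k hj hk, h'.corner j k hj hk]

end IsGrowthDiagram

variable {α β γ : YoungDiagram}

/-- The chain of a Littlewood-Richardson tableau is the last row of a growth diagram. The Yamanouchi
condition is passed on to the first row, which it forces to be the standard filling of `β`. -/
theorem IsHChain.exists_growth {δ : ℕ → ℕ → ℕ} (h : IsHChain α β γ δ) :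
    ∃ G, IsGrowthDiagram α β γ G ∧ G (α.rowLen 0) = δ := by
  have hα : ∀ i, α.rowLen (i + 1) ≤ α.rowLen i := fun i => α.rowLen_anti i (i + 1) (by omega)
  obtain ⟨G, hG, hG0, hGs⟩ := exists_growth_rows (fun j i => min (α.rowLen i) j)
    (fun j i => by omega) (fun j i => by have := hα i; omega)
    (α.rowLen 0) δ h.strip (by
      rw [h.zero]; funext i; exact (min_eq_left (α.rowLen_anti 0 i (by omega))).symm)
  let F : ℕ → ℕ → ℕ → ℕ := fun j => if j ≤ α.rowLen 0 then G j else δ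
  have hδ : ∀ k i, γ.colLen 0 ≤ i → δ k i = 0 := by
    intro k i hi
    have h1 : ∀ t, δ k i ≤ δ (k + t) i := by
      intro t
      induction t with
      | zero => exact le_rfl
      | succ t ih => exact ih.trans (h.strip (k + t) i).1
    have h2 := h1 (β.colLen 0)
    rw [h.top _ (Nat.le_add_left _ _), YoungDiagram.rowLen_eq_zero hi] at h2
    omega
  have hF : F (α.rowLen 0) = δ := by simp [F, hG]
  have hsq : ∀ j k, ∃ D, IsGrowthSquare (F j k) (F (j + 1) k) (F j (k + 1)) (F (j + 1) (k + 1)) D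
      := by
    intro j k
    rcases Nat.lt_or_ge j (α.rowLen 0) with hj | hj
    · simp only [F, show j ≤ α.rowLen 0 by omega, show j + 1 ≤ α.rowLen 0 by omega, if_true]
      exact hGs j hj k
    · have e1 : F j = δ := by
        rcases Nat.eq_or_lt_of_le hj with hj | hj
        · rw [← hj, hF]
        · simp [F, show ¬ j ≤ α.rowLen 0 by omega]
      have e2 : F (j + 1) = δ := by simp [F, show ¬ j + 1 ≤ α.rowLen 0 by omega]
      rw [e1, e2]
      refine ⟨fun _ => 0, ⟨fun i => by omega, fun i => by omega, h.strip k, h.strip k, rfl,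
        fun i => by omega, fun i => by omega, fun i => ?_, fun i => ?_⟩⟩ <;>
      · have := h.strip k i
        omega
  have hF0 : ∀ k i, γ.colLen 0 ≤ i → F 0 k i = 0 := by
    intro k i hi
    have h1 : ∀ t, F 0 k i ≤ F t k i := by
      intro t
      induction t with
      | zero => exact le_rfl
      | succ t ih => exact ih.trans ((hsq t k).choose_spec.left i).1
    have h2 := h1 (α.rowLen 0)
    rw [hF, hδ k i hi] at h2
    omega
  have hFn : ∀ j k i, j ≤ α.rowLen 0 → γ.colLen 0 ≤ i → F j k i = 0 := by
    intro j k i hj hi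
    have h1 : ∀ t, F j k i ≤ F (j + t) k i := by
      intro t
      induction t with
      | zero => exact le_rfl
      | succ t ih => exact ih.trans ((hsq (j + t) k).choose_spec.left i).1
    have h2 := h1 (α.rowLen 0 - j)
    rw [show j + (α.rowLen 0 - j) = α.rowLen 0 by omega, hF, hδ k i hi] at h2
    omega
  have hdown : ∀ t j, j + t = α.rowLen 0 →
      (∀ k, ∑ i ∈ Finset.range (γ.colLen 0), ((F j (k + 1) i : ℤ) - F j k i) = β.rowLen k) ∧
      (∀ k, HLattice (F j k) (F j (k + 1)) (F j (k + 2))) := by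
    intro t
    induction t with
    | zero =>
      intro j hj
      rw [show j = α.rowLen 0 by omega, hF]
      exact ⟨h.size, h.lattice⟩
    | succ t ih =>
      intro j hj
      obtain ⟨h1, h2⟩ := ih (j + 1) (by omega)
      refine ⟨fun k => ?_, fun k => ?_⟩
      · obtain ⟨D, hD⟩ := hsq j k
        have h3 := hD.sum_horizontal (γ.colLen 0)
        rw [hD.D_eq_zero (hFn _ _ _ (by omega) le_rfl), h1] at h3
        simpa using h3
      · exact (hLattice_iff (n := γ.colLen 0) (hsq j k).choose_spec (hsq j (k + 1)).choose_spec
          fun i hi => hFn _ _ _ (by omega) hi).2 (h2 k)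
  obtain ⟨hs0, hl0⟩ := hdown (α.rowLen 0) 0 (by omega)
  have hleft : ∀ j i, F j 0 i = min (α.rowLen i) j := by
    intro j i
    by_cases hj : j ≤ α.rowLen 0
    · simp [F, hj, hG0 j hj]
    · have := α.rowLen_anti 0 i (by omega)
      simp only [F, hj, if_false, h.zero]
      omega
  refine ⟨F, ⟨hsq, hleft, ?_, ?_⟩, hF⟩
  · exact hLattice_canonical (b := β.rowLen) (fun i => by simp [hleft])
      (fun k => (hsq 0 k).choose_spec.bot) hl0 hF0 hs0
  · intro j k hj hk
    have : F j = δ := by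
      rcases Nat.eq_or_lt_of_le hj with hj | hj
      · rw [← hj, hF]
      · simp [F, show ¬ j ≤ α.rowLen 0 by omega]
    rw [this, h.top k hk]

/-- A Yamanouchi chain of vertical strips is the last column of a growth diagram. -/
theorem IsVChain.exists_growth {ε : ℕ → ℕ → ℕ} (h : IsVChain β α γ ε) :
    ∃ G, IsGrowthDiagram α β γ G ∧ ∀ j, G j (β.colLen 0) = ε j := by
  have hβ : ∀ i, β.rowLen (i + 1) ≤ β.rowLen i := fun i => β.rowLen_anti i (i + 1) (by omega)
  obtain ⟨G, hG, hG0, hGs⟩ := exists_growth_columns (fun k i => if i < k then β.rowLen i else 0)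
    (fun j i => by have := hβ i; split_ifs <;> omega)
    (β.colLen 0) ε h.strip h.anti (by
      rw [h.zero]; funext i
      split_ifs with hi
      · rfl
      · exact YoungDiagram.rowLen_eq_zero (by omega))
  let F : ℕ → ℕ → ℕ → ℕ := fun j k => if k ≤ β.colLen 0 then G j k else ε j
  have hε : ∀ k i, γ.colLen 0 ≤ i → ε k i = 0 := by
    intro k i hi
    have h1 : ∀ t, ε k i ≤ ε (k + t) i := by
      intro t
      induction t with
      | zero => exact le_rfl
      | succ t ih => exact ih.trans (h.strip (k + t) i).1
    have h2 := h1 (α.rowLen 0)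
    rw [h.top _ (Nat.le_add_left _ _), YoungDiagram.rowLen_eq_zero hi] at h2
    omega
  have hFr : ∀ j k, β.colLen 0 ≤ k → F j k = ε j := by
    intro j k hk
    rcases Nat.eq_or_lt_of_le hk with rfl | hk
    · simp [F, hG]
    · simp [F, show ¬ k ≤ β.colLen 0 by omega]
  have hsq : ∀ j k, ∃ D, IsGrowthSquare (F j k) (F (j + 1) k) (F j (k + 1)) (F (j + 1) (k + 1)) D
      := by
    intro j k
    rcases Nat.lt_or_ge k (β.colLen 0) with hk | hk
    · simp only [F, show k ≤ β.colLen 0 by omega, show k + 1 ≤ β.colLen 0 by omega, if_true]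
      exact hGs k hk j
    · rw [hFr _ _ hk, hFr _ _ hk, hFr _ (k + 1) (by omega), hFr _ (k + 1) (by omega)]
      refine ⟨fun _ => 0, ⟨h.strip j, h.strip j, fun i => ⟨le_rfl, h.anti j i⟩,
        fun i => ⟨le_rfl, h.anti (j + 1) i⟩, rfl, fun i => by omega, fun i => by omega,
        fun i => ?_, fun i => ?_⟩⟩ <;>
      · have := h.strip j i; have := h.strip j (i + 1); have := h.anti j i
        have := h.anti (j + 1) i
        omega
  have hFn : ∀ j k i, k ≤ β.colLen 0 → γ.colLen 0 ≤ i → F j k i = 0 := by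
    intro j k i hk hi
    have h1 : ∀ t, F j k i ≤ F j (k + t) i := by
      intro t
      induction t with
      | zero => exact le_rfl
      | succ t ih => exact ih.trans ((hsq j (k + t)).choose_spec.bot i).1
    have h2 := h1 (β.colLen 0 - k)
    rw [hFr j (k + (β.colLen 0 - k)) (by omega), hε j i hi] at h2
    omega
  have hdown : ∀ t k, k + t = β.colLen 0 →
      (∀ j, ∑ i ∈ Finset.range (γ.colLen 0), ((F (j + 1) k i : ℤ) - F j k i) = α.colLen j) ∧
      (∀ j, VLattice (γ.colLen 0) (F j k) (F (j + 1) k) (F (j + 2) k)) := by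
    intro t
    induction t with
    | zero =>
      intro k hk
      simp only [hFr _ k (by omega)]
      exact ⟨h.size, h.lattice⟩
    | succ t ih =>
      intro k hk
      obtain ⟨h1, h2⟩ := ih (k + 1) (by omega)
      refine ⟨fun j => ?_, fun j => ?_⟩
      · obtain ⟨D, hD⟩ := hsq j k
        have h3 := hD.sum_vertical (γ.colLen 0)
        rw [hD.D_eq_zero (hFn _ _ _ (by omega) le_rfl), h1] at h3
        simpa using h3.symm
      · exact (vLattice_iff (n := γ.colLen 0) (hsq j k).choose_spec (hsq (j + 1) k).choose_spec
          fun i hi => hFn _ _ _ (by omega) hi).2 (h2 j)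
  obtain ⟨hs0, hl0⟩ := hdown (β.colLen 0) 0 (by omega)
  have hbot : ∀ k i, F 0 k i = if i < k then β.rowLen i else 0 := by
    intro k i
    by_cases hk : k ≤ β.colLen 0
    · simp [F, hk, hG0 k hk]
    · rw [hFr _ _ (by omega), h.zero]
      split_ifs with hi
      · rfl
      · exact YoungDiagram.rowLen_eq_zero (by omega)
  refine ⟨F, ⟨hsq, ?_, hbot, ?_⟩, fun j => hFr j _ le_rfl⟩
  · refine fun j => vLattice_canonical (n := γ.colLen 0) (ε := fun j => F j 0)
      (fun i => by simp [hbot]) (fun j i => ?_)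
      (fun j => (hsq j 0).choose_spec.left) hl0 (fun j i hi => hFn _ _ _ (by omega) hi) hs0 j
    have := (hsq j 0).choose_spec.bot i
    have := (hsq j 0).choose_spec.bot (i + 1)
    omega
  · intro j k hj hk
    rw [hFr _ _ hk, h.top j hj]

/-- The growth bijection between Littlewood-Richardson tableaux of type `(α, β; γ)` and transposed
Littlewood-Richardson tableaux of type `(βᵗ, αᵗ; γᵗ)`. -/
theorem ncard_isHChain_eq_ncard_isVChain (α β γ : YoungDiagram) :
    {δ | IsHChain α β γ δ}.ncard = {ε | IsVChain β α γ ε}.ncard := by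
  classical
  refine Set.ncard_congr
    (fun δ hδ => fun j => (IsHChain.exists_growth hδ).choose j (β.colLen 0)) ?_ ?_ ?_
  · intro δ hδ
    exact (IsHChain.exists_growth hδ).choose_spec.1.isVChain
  · intro δ δ' hδ hδ' heq
    obtain ⟨h1, h2⟩ := (IsHChain.exists_growth hδ).choose_spec
    obtain ⟨h1', h2'⟩ := (IsHChain.exists_growth hδ').choose_spec
    rw [← h2, ← h2']
    funext k
    exact h1.column_unique h1' (fun j => congrFun heq j) _ k le_rfl
  · intro ε hε
    obtain ⟨G, hG, hGε⟩ := IsVChain.exists_growth hε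
    refine ⟨G (α.rowLen 0), hG.isHChain, ?_⟩
    obtain ⟨h1, h2⟩ := (IsHChain.exists_growth hG.isHChain).choose_spec
    funext j
    rw [← hGε j]
    exact h1.row_unique hG h2 j _ le_rfl

/-! ### Littlewood-Richardson tableaux as chains of horizontal strips -/

/-- The filling `T` of `γ` corresponds to the chain `δ`: row `i` has its entries `≤ k` in the first
`δ k i` columns. -/
structure IsFillingOfChain (γ : YoungDiagram) (T δ : ℕ → ℕ → ℕ) : Prop where
  le_iff : ∀ i j k, j < γ.rowLen i → (T i j ≤ k ↔ j < δ k i)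
  le_rowLen : ∀ k i, δ k i ≤ γ.rowLen i
  eq_zero : ∀ i j, γ.rowLen i ≤ j → T i j = 0

theorem lt_card_filter_iff {m : ℕ} {p : ℕ → Prop} [DecidablePred p]
    (hp : ∀ i j, i ≤ j → j < m → p j → p i) {j : ℕ} (hj : j < m) :
    p j ↔ j < ((Finset.range m).filter p).card := by
  constructor
  · intro h
    have : Finset.range (j + 1) ⊆ (Finset.range m).filter p := by
      intro i hi
      have hi := Finset.mem_range.1 hi
      exact Finset.mem_filter.2 ⟨Finset.mem_range.2 (by omega), hp i j (by omega) hj h⟩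
    simpa using Finset.card_le_card this
  · intro h
    by_contra hn
    have : (Finset.range m).filter p ⊆ Finset.range j := by
      intro i hi
      obtain ⟨hi, hpi⟩ := Finset.mem_filter.1 hi
      rw [Finset.mem_range] at hi ⊢
      by_contra hij
      exact hn (hp j i (by omega) hi hpi)
    have := Finset.card_le_card this
    simp at this
    omega

theorem YoungDiagram.card_filter_lt (γ : YoungDiagram) (m : ℕ) (p : ℕ → ℕ → Prop)
    [∀ i j, Decidable (p i j)] :
    (γ.cells.filter fun c => c.1 < m ∧ p c.1 c.2).card
      = ∑ i ∈ Finset.range m, ((Finset.range (γ.rowLen i)).filter (p i)).card := by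
  rw [Finset.card_eq_sum_card_fiberwise (f := Prod.fst) (t := Finset.range m)]
  · refine Finset.sum_congr rfl fun i hi => ?_
    refine Finset.card_bij' (fun c _ => c.2) (fun j _ => (i, j)) ?_ ?_ ?_ ?_
    · rintro ⟨a, b⟩ h
      simp only [Finset.mem_filter, YoungDiagram.mem_cells, Finset.mem_range] at h ⊢
      obtain ⟨⟨h1, -, h2⟩, rfl⟩ := h
      exact ⟨YoungDiagram.mem_iff_lt_rowLen.1 h1, h2⟩
    · intro j h
      simp only [Finset.mem_filter, YoungDiagram.mem_cells, Finset.mem_range] at h hi ⊢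
      exact ⟨⟨YoungDiagram.mem_iff_lt_rowLen.2 h.1, hi, h.2⟩, trivial⟩
    · rintro ⟨a, b⟩ h
      simp only [Finset.mem_filter] at h
      simp [h.2]
    · intro j h
      rfl
  · intro c hc
    have hc := (Finset.mem_filter.1 hc).2
    simpa using hc.1

namespace IsFillingOfChain

variable {α β γ : YoungDiagram} {T δ : ℕ → ℕ → ℕ}

theorem mono (h : IsFillingOfChain γ T δ) (k i : ℕ) : δ k i ≤ δ (k + 1) i := by
  by_contra hlt
  have h1 : δ (k + 1) i < γ.rowLen i := by have := h.le_rowLen k i; omega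
  have h2 := (h.le_iff i _ k h1).2 (by omega)
  have h3 := (h.le_iff i _ (k + 1) h1).1 (by omega)
  omega

theorem card_entries (h : IsFillingOfChain γ T δ) (m k : ℕ) :
    ((γ.cells.filter fun c => c.1 < m ∧ T c.1 c.2 = k + 1).card : ℤ)
      = ∑ i ∈ Finset.range m, ((δ (k + 1) i : ℤ) - δ k i) := by
  rw [γ.card_filter_lt m (fun i j => T i j = k + 1)]
  push_cast
  refine Finset.sum_congr rfl fun i _ => ?_
  have h1 : (Finset.range (γ.rowLen i)).filter (fun j => T i j = k + 1)
      = Finset.Ico (δ k i) (δ (k + 1) i) := by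
    ext j
    simp only [Finset.mem_filter, Finset.mem_range, Finset.mem_Ico]
    constructor
    · rintro ⟨h1, h2⟩
      have := h.le_iff i j k h1; have := h.le_iff i j (k + 1) h1
      omega
    · rintro ⟨h1, h2⟩
      have h3 : j < γ.rowLen i := by have := h.le_rowLen (k + 1) i; omega
      have := h.le_iff i j k h3; have := h.le_iff i j (k + 1) h3
      omega
  rw [h1, Nat.card_Ico, Nat.cast_sub (h.mono k i)]

theorem contentCount_eq (h : IsFillingOfChain γ T δ) (k : ℕ) :
    (contentCount γ T (k + 1) : ℤ)
      = ∑ i ∈ Finset.range (γ.colLen 0), ((δ (k + 1) i : ℤ) - δ k i) := by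
  rw [← h.card_entries, contentCount]
  congr 2
  refine Finset.filter_congr fun c hc => ?_
  have h1 : γ.rowLen c.1 ≠ 0 := by
    have := YoungDiagram.mem_iff_lt_rowLen.1 ((YoungDiagram.mem_cells _).1 hc); omega
  have h2 : c.1 < γ.colLen 0 := by
    by_contra hlt; exact h1 (YoungDiagram.rowLen_eq_zero (by omega))
  simp [h2]

theorem isHChain (h : IsFillingOfChain γ T δ) (hT : IsLittlewoodRichardson α β γ T) :
    IsHChain α β γ δ where
  zero := by
    funext i
    have hle : α.rowLen i ≤ γ.rowLen i := by
      by_contra hlt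
      have h1 : (i, γ.rowLen i) ∈ α := YoungDiagram.mem_iff_lt_rowLen.2 (by omega)
      have := YoungDiagram.mem_iff_lt_rowLen.1 (hT.le h1)
      omega
    have key : ∀ j, j < γ.rowLen i → (j < α.rowLen i ↔ j < δ 0 i) := by
      intro j hj
      rw [← h.le_iff i j 0 hj, ← YoungDiagram.mem_iff_lt_rowLen, ← not_lt, hT.pos_iff]
      simp [YoungDiagram.mem_iff_lt_rowLen.2 hj]
    have := h.le_rowLen 0 i
    by_contra hne
    rcases Nat.lt_or_gt_of_ne hne with h1 | h1
    · have := (key (δ 0 i) (by omega)).1 h1; omega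
    · have := (key (α.rowLen i) (by omega)).2 h1; omega
  strip k i := by
    refine ⟨h.mono k i, ?_⟩
    by_contra hlt
    have h1 := h.le_rowLen (k + 1) (i + 1)
    have h2 := γ.rowLen_anti i (i + 1) (by omega)
    have h3 := h.le_iff i (δ k i) k (by omega)
    have h4 := (h.le_iff (i + 1) (δ k i) (k + 1) (by omega)).2 (by omega)
    have h5 : 0 < T i (δ k i) := by omega
    have h6 : 0 < T (i + 1) (δ k i) := by
      rw [hT.pos_iff] at h5 ⊢
      refine ⟨YoungDiagram.mem_iff_lt_rowLen.2 (by omega), fun hmem => h5.2 ?_⟩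
      rw [YoungDiagram.mem_iff_lt_rowLen] at hmem ⊢
      have := α.rowLen_anti i (i + 1) (by omega)
      omega
    have := hT.col_strict i (i + 1) _ (by omega) h5 h6
    omega
  size k := by rw [← h.contentCount_eq, hT.content]
  top k hk := by
    funext i
    have := h.le_rowLen k i
    by_contra hne
    have h1 := h.le_iff i (δ k i) k (by omega)
    obtain ⟨m, hm⟩ : ∃ m, T i (δ k i) = m + 1 := ⟨T i (δ k i) - 1, by omega⟩
    have hmem : (i, δ k i) ∈ γ := YoungDiagram.mem_iff_lt_rowLen.2 (by omega)
    have h2 : 0 < contentCount γ T (m + 1) :=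
      Finset.card_pos.2 ⟨(i, δ k i), Finset.mem_filter.2 ⟨(YoungDiagram.mem_cells _).2 hmem, hm⟩⟩
    rw [hT.content, YoungDiagram.rowLen_eq_zero (by omega)] at h2
    omega
  lattice k i := by
    rw [← h.card_entries, ← h.card_entries]
    have h0 := hT.yamanouchi i (δ (k + 1) i) (k + 1) (by omega)
    refine Int.ofNat_le.2 (le_trans (Finset.card_le_card fun c hc => ?_)
      (h0.trans (Finset.card_le_card fun c hc => ?_)))
    · simp only [Finset.mem_filter] at hc ⊢
      refine ⟨hc.1, ?_, hc.2.2⟩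
      have h1 := YoungDiagram.mem_iff_lt_rowLen.1 ((YoungDiagram.mem_cells _).1 hc.1)
      have h2 := h.le_iff c.1 c.2 (k + 1) h1
      rcases Nat.lt_or_ge c.1 i with h3 | h3
      · exact Or.inl h3
      · have h4 : c.1 = i := by omega
        refine Or.inr ⟨h4, ?_⟩
        rw [h4] at h2
        rw [h4] at hc
        omega
    · simp only [Finset.mem_filter] at hc ⊢
      refine ⟨hc.1, ?_, hc.2.2⟩
      have h1 := YoungDiagram.mem_iff_lt_rowLen.1 ((YoungDiagram.mem_cells _).1 hc.1)
      have h2 := h.le_iff c.1 c.2 (k + 1) h1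
      rcases hc.2.1 with h3 | ⟨h3, h4⟩
      · exact h3
      · rw [h3] at h2
        rw [h3] at hc
        omega

theorem isLittlewoodRichardson (h : IsFillingOfChain γ T δ) (hδ : IsHChain α β γ δ) :
    IsLittlewoodRichardson α β γ T where
  le := by
    rintro ⟨i, j⟩ hmem
    have h1 := YoungDiagram.mem_iff_lt_rowLen.1 hmem
    have h2 := h.le_rowLen 0 i
    rw [hδ.zero] at h2
    exact YoungDiagram.mem_iff_lt_rowLen.2 (by omega)
  pos_iff i j := by
    rw [YoungDiagram.mem_iff_lt_rowLen, YoungDiagram.mem_iff_lt_rowLen]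
    rcases Nat.lt_or_ge j (γ.rowLen i) with hj | hj
    · have := h.le_iff i j 0 hj
      rw [hδ.zero] at this
      omega
    · have := h.eq_zero i j hj
      omega
  row_weak i j₁ j₂ hj h1 h2 := by
    have hj₂ : j₂ < γ.rowLen i := by
      by_contra hn; have := h.eq_zero i j₂ (by omega); omega
    have := (h.le_iff i j₂ _ hj₂).1 le_rfl
    exact (h.le_iff i j₁ _ (by omega)).2 (by omega)
  col_strict i₁ i₂ j hi h1 h2 := by
    have hj₂ : j < γ.rowLen i₂ := by
      by_contra hn; have := h.eq_zero i₂ j (by omega); omega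
    have hj₁ : j < γ.rowLen i₁ := lt_of_lt_of_le hj₂ (γ.rowLen_anti i₁ i₂ hi.le)
    obtain ⟨k, hk⟩ : ∃ k, T i₂ j = k + 1 := ⟨T i₂ j - 1, by omega⟩
    have h3 := (h.le_iff i₂ j (k + 1) hj₂).1 hk.le
    obtain ⟨i, rfl⟩ : ∃ i, i₂ = i + 1 := ⟨i₂ - 1, by omega⟩
    have hanti : Antitone (δ k) := antitone_nat_of_succ_le fun m =>
      by have := hδ.strip k m; have := hδ.strip k (m + 1); omega
    have h4 := (hδ.strip k i).2
    have h5 := hanti (show i₁ ≤ i by omega)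
    have := (h.le_iff i₁ j k hj₁).2 (by omega)
    omega
  content k := by
    have := h.contentCount_eq k
    rw [hδ.size k] at this
    exact_mod_cast this
  yamanouchi i j k hk := by
    obtain ⟨k, rfl⟩ : ∃ m, k = m + 1 := ⟨k - 1, by omega⟩
    have h1 := hδ.lattice k i
    rw [← h.card_entries, ← h.card_entries] at h1
    refine le_trans (Finset.card_le_card fun c hc => ?_)
      ((Int.ofNat_le.1 h1).trans (Finset.card_le_card fun c hc => ?_))
    · simp only [Finset.mem_filter] at hc ⊢
      exact ⟨hc.1, by omega, hc.2.2⟩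
    · simp only [Finset.mem_filter] at hc ⊢
      exact ⟨hc.1, Or.inl hc.2.1, hc.2.2⟩

end IsFillingOfChain

variable {α β γ : YoungDiagram}

theorem IsLittlewoodRichardson.exists_chain {T : ℕ → ℕ → ℕ} (hT : IsLittlewoodRichardson α β γ T) :
    ∃ δ, IsFillingOfChain γ T δ := by
  refine ⟨fun k i => ((Finset.range (γ.rowLen i)).filter (fun j => T i j ≤ k)).card,
    fun i j k hj => ?_, fun k i => ?_, fun i j hj => ?_⟩
  · refine lt_card_filter_iff (p := fun j => T i j ≤ k) (fun a b hab hb h => ?_) hj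
    rcases Nat.eq_or_lt_of_le hab with rfl | hab
    · exact h
    · rcases Nat.eq_zero_or_pos (T i a) with h0 | h0
      · omega
      · have h1 : 0 < T i b := by
          have h2 := (hT.pos_iff i a).1 h0
          rw [hT.pos_iff]
          refine ⟨YoungDiagram.mem_iff_lt_rowLen.2 hb, fun hmem => h2.2 ?_⟩
          rw [YoungDiagram.mem_iff_lt_rowLen] at hmem ⊢
          omega
        exact (hT.row_weak i a b hab h0 h1).trans h
  · simpa using Finset.card_filter_le (Finset.range (γ.rowLen i)) (fun j => T i j ≤ k)
  · by_contra h0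
    have := ((hT.pos_iff i j).1 (Nat.pos_of_ne_zero h0)).1
    have := YoungDiagram.mem_iff_lt_rowLen.1 this
    omega

theorem IsHChain.exists_filling {δ : ℕ → ℕ → ℕ} (hδ : IsHChain α β γ δ) :
    ∃ T, IsFillingOfChain γ T δ := by
  have hmono : ∀ i, Monotone fun k => δ k i := fun i =>
    monotone_nat_of_le_succ fun k => (hδ.strip k i).1
  have hle : ∀ k i, δ k i ≤ γ.rowLen i := by
    intro k i
    rw [← hδ.top (k + β.colLen 0) (by omega)]
    exact hmono i (by omega)
  refine ⟨fun i j => if j < γ.rowLen i then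
    ((Finset.range (β.colLen 0)).filter (fun k => δ k i ≤ j)).card else 0,
    fun i j k hj => ?_, hle, fun i j hj => by simp [not_lt.2 hj]⟩
  simp only [hj, if_true]
  rcases Nat.lt_or_ge k (β.colLen 0) with hk | hk
  · have := lt_card_filter_iff (p := fun k => δ k i ≤ j)
      (fun a b hab _ h => (hmono i hab).trans h) hk
    omega
  · rw [hδ.top k hk]
    have := Finset.card_filter_le (Finset.range (β.colLen 0)) (fun k => δ k i ≤ j)
    rw [Finset.card_range] at this
    exact ⟨fun _ => hj, fun _ => this.trans hk⟩

theorem IsFillingOfChain.unique_chain {T δ δ' : ℕ → ℕ → ℕ} (h : IsFillingOfChain γ T δ)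
    (h' : IsFillingOfChain γ T δ') : δ = δ' := by
  funext k i
  have h1 := h.le_rowLen k i
  have h2 := h'.le_rowLen k i
  by_contra hne
  rcases Nat.lt_or_gt_of_ne hne with hlt | hlt
  · have := h.le_iff i (δ k i) k (by omega); have := h'.le_iff i (δ k i) k (by omega); omega
  · have := h.le_iff i (δ' k i) k (by omega); have := h'.le_iff i (δ' k i) k (by omega); omega

theorem IsFillingOfChain.unique_filling {T T' δ : ℕ → ℕ → ℕ} (h : IsFillingOfChain γ T δ)
    (h' : IsFillingOfChain γ T' δ) : T = T' := by
  funext i j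
  rcases Nat.lt_or_ge j (γ.rowLen i) with hj | hj
  · exact le_antisymm ((h.le_iff i j _ hj).2 ((h'.le_iff i j _ hj).1 le_rfl))
      ((h'.le_iff i j _ hj).2 ((h.le_iff i j _ hj).1 le_rfl))
  · rw [h.eq_zero i j hj, h'.eq_zero i j hj]

theorem lrCoeff_eq_ncard_isHChain (α β γ : YoungDiagram) :
    lrCoeff α β γ = {δ | IsHChain α β γ δ}.ncard := by
  refine Set.ncard_congr (fun T hT => (IsLittlewoodRichardson.exists_chain hT).choose) ?_ ?_ ?_
  · intro T hT
    exact (IsLittlewoodRichardson.exists_chain hT).choose_spec.isHChain hT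
  · intro T T' hT hT' heq
    have h1 := (IsLittlewoodRichardson.exists_chain hT).choose_spec
    have h2 := (IsLittlewoodRichardson.exists_chain hT').choose_spec
    rw [← show _ = _ from heq] at h2
    exact h1.unique_filling h2
  · intro δ hδ
    obtain ⟨T, hT⟩ := IsHChain.exists_filling hδ
    exact ⟨T, hT.isLittlewoodRichardson hδ,
      (IsLittlewoodRichardson.exists_chain (hT.isLittlewoodRichardson hδ)).choose_spec.unique_chain
        hT⟩

/-- The Littlewood-Richardson coefficient counts the chains of vertical strips that will index the
strata of the variety of extensions. -/
theorem lrCoeff_eq_ncard_isVChain (α β γ : YoungDiagram) :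
    lrCoeff α β γ = {ε | IsVChain β α γ ε}.ncard :=
  (lrCoeff_eq_ncard_isHChain α β γ).trans (ncard_isHChain_eq_ncard_isVChain α β γ)

theorem finite_isVChain (α β γ : YoungDiagram) : {ε | IsVChain β α γ ε}.Finite := by
  have hle : ∀ ε, IsVChain β α γ ε → ∀ k i, ε k i ≤ γ.rowLen i := by
    intro ε hε k i
    have h1 : Monotone fun k => ε k i := monotone_nat_of_le_succ fun k => (hε.strip k i).1
    rw [← hε.top (k + α.rowLen 0) (by omega)]
    exact h1 (by omega)
  refine Set.Finite.of_injOn (t := Set.univ)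
    (f := fun ε (k : Fin (α.rowLen 0)) (i : Fin (γ.colLen 0)) =>
      Fin.ofNat (γ.rowLen 0 + 1) (ε k i)) (Set.mapsTo_univ _ _) ?_ Set.finite_univ
  intro ε hε ε' hε' heq
  funext k i
  rcases Nat.lt_or_ge k (α.rowLen 0) with hk | hk
  · rcases Nat.lt_or_ge i (γ.colLen 0) with hi | hi
    · have h1 := congrArg Fin.val (congrFun (congrFun heq ⟨k, hk⟩) ⟨i, hi⟩)
      have h2 := hle ε hε k i
      have h3 := hle ε' hε' k i
      have h4 := γ.rowLen_anti 0 i (by omega)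
      simpa [Fin.ofNat, Nat.mod_eq_of_lt (show ε k i < γ.rowLen 0 + 1 by omega),
        Nat.mod_eq_of_lt (show ε' k i < γ.rowLen 0 + 1 by omega)] using h1
    · have h2 := hle ε hε k i
      have h3 := hle ε' hε' k i
      rw [YoungDiagram.rowLen_eq_zero hi] at h2 h3
      omega
  · rw [hε.top k hk, hε'.top k hk]

/-! ### Modules of truncated sequences -/

/-- Sequences indexed by rows `i` and positions `j`. With the backward shift these form the module
`⨁ i, R[t, t⁻¹] / t R[t]`, in which the torsion modules `M_μ` are nested in each other. -/
abbrev RowSeq (R : Type*) : Type _ := ℕ → ℕ → R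

section Ring

variable {R : Type*} [CommRing R]

/-- The action of `t` on `RowSeq R`. -/
def rowShift (R : Type*) [CommRing R] : RowSeq R →ₗ[R] RowSeq R where
  toFun x i j := x i (j + 1)
  map_add' _ _ := rfl
  map_smul' _ _ := rfl

@[simp] theorem rowShift_apply (x : RowSeq R) (i j : ℕ) : rowShift R x i j = x i (j + 1) := rfl

theorem rowShift_pow_apply (k : ℕ) (x : RowSeq R) (i j : ℕ) :
    (rowShift R ^ k) x i j = x i (j + k) := by
  induction k generalizing x j with
  | zero => rfl
  | succ k ih =>
    rw [pow_succ, Module.End.mul_apply, ih, rowShift_apply, add_assoc]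

/-- The sequences whose row `i` is supported in the first `μ i` positions: the torsion module `M_μ`,
embedded in `RowSeq R`. -/
def boxModule (R : Type*) [CommRing R] (μ : ℕ → ℕ) : Submodule R (RowSeq R) where
  carrier := {x | ∀ i j, μ i ≤ j → x i j = 0}
  zero_mem' _ _ _ := rfl
  add_mem' hx hy i j h := by simp [hx i j h, hy i j h]
  smul_mem' c x hx i j h := by simp [hx i j h]

theorem mem_boxModule {μ : ℕ → ℕ} {x : RowSeq R} :
    x ∈ boxModule R μ ↔ ∀ i j, μ i ≤ j → x i j = 0 := Iff.rfl

theorem boxModule_mono {μ ν : ℕ → ℕ} (h : ∀ i, ν i ≤ μ i) : boxModule R ν ≤ boxModule R μ :=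
  fun _ hx i j hj => hx i j ((h i).trans hj)

theorem rowShift_mem_boxModule {a b : ℕ → ℕ} (h : ∀ i, b i ≤ a i + 1) {x : RowSeq R}
    (hx : x ∈ boxModule R b) : rowShift R x ∈ boxModule R a :=
  fun i j hj => hx i (j + 1) (by have := h i; omega)

theorem rowShift_pow_mem_boxModule {b : ℕ → ℕ} (k : ℕ) {x : RowSeq R} (hx : x ∈ boxModule R b) :
    (rowShift R ^ k) x ∈ boxModule R b :=
  fun i j hj => by rw [rowShift_pow_apply]; exact hx i _ (by omega)

/-- The unipotent automorphism of `M_b` with parameters `A s i`, where `i < s` runs over the rows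
such that the strip `b / a` meets row `s` but not row `i`. It moves `M_a` inside `M_b`. -/
def stripMap (a b : ℕ → ℕ) (A : ℕ → ℕ → R) : RowSeq R →ₗ[R] RowSeq R where
  toFun x s j := x s j + ∑ i ∈ Finset.range s,
    if a s < b s ∧ b i ≤ a i then A s i * x i (j + (b i - b s)) else 0
  map_add' x y := by
    funext s j
    simp only [Pi.add_apply]
    rw [add_add_add_comm, ← Finset.sum_add_distrib]
    congr 1
    refine Finset.sum_congr rfl fun i _ => ?_
    split_ifs <;> ring
  map_smul' c x := by
    funext s j
    simp only [Pi.smul_apply, smul_eq_mul, RingHom.id_apply]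
    rw [mul_add, Finset.mul_sum]
    congr 1
    refine Finset.sum_congr rfl fun i _ => ?_
    split_ifs <;> ring

theorem stripMap_apply (a b : ℕ → ℕ) (A : ℕ → ℕ → R) (x : RowSeq R) (s j : ℕ) :
    stripMap a b A x s j = x s j + ∑ i ∈ Finset.range s,
      if a s < b s ∧ b i ≤ a i then A s i * x i (j + (b i - b s)) else 0 := rfl

theorem stripMap_apply_of_le {a b : ℕ → ℕ} (A : ℕ → ℕ → R) (x : RowSeq R) {s : ℕ} (h : b s ≤ a s)
    (j : ℕ) : stripMap a b A x s j = x s j := by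
  rw [stripMap_apply, Finset.sum_eq_zero, add_zero]
  intro i _
  rw [if_neg (by omega)]

theorem rowShift_stripMap (a b : ℕ → ℕ) (A : ℕ → ℕ → R) (x : RowSeq R) :
    rowShift R (stripMap a b A x) = stripMap a b A (rowShift R x) := by
  funext s j
  simp only [rowShift_apply, stripMap_apply]
  congr 1
  refine Finset.sum_congr rfl fun i _ => ?_
  rw [show j + 1 + (b i - b s) = j + (b i - b s) + 1 by omega]

theorem rowShift_pow_stripMap (a b : ℕ → ℕ) (A : ℕ → ℕ → R) (k : ℕ) (x : RowSeq R) :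
    (rowShift R ^ k) (stripMap a b A x) = stripMap a b A ((rowShift R ^ k) x) := by
  induction k generalizing x with
  | zero => rfl
  | succ k ih => rw [pow_succ, Module.End.mul_apply, rowShift_stripMap, ih]; rfl

theorem stripMap_mem_boxModule {a b : ℕ → ℕ} (A : ℕ → ℕ → R) {x : RowSeq R}
    (hx : x ∈ boxModule R b) : stripMap a b A x ∈ boxModule R b := by
  intro s j hj
  rw [stripMap_apply, hx s j hj, zero_add]
  refine Finset.sum_eq_zero fun i _ => ?_
  rw [hx i _ (by omega), mul_zero, ite_self]

theorem stripMap_neg_stripMap (a b : ℕ → ℕ) (A : ℕ → ℕ → R) (x : RowSeq R) :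
    stripMap a b (-A) (stripMap a b A x) = x := by
  funext s j
  rw [stripMap_apply, stripMap_apply, add_assoc, ← Finset.sum_add_distrib, Finset.sum_eq_zero,
    add_zero]
  intro i _
  split_ifs with h
  · rw [stripMap_apply_of_le A x h.2]
    simp
  · simp

theorem stripMap_stripMap_neg (a b : ℕ → ℕ) (A : ℕ → ℕ → R) (x : RowSeq R) :
    stripMap a b A (stripMap a b (-A) x) = x := by
  simpa using stripMap_neg_stripMap a b (-A) x

theorem stripMap_injective (a b : ℕ → ℕ) (A : ℕ → ℕ → R) : Function.Injective (stripMap a b A) :=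
  Function.LeftInverse.injective (stripMap_neg_stripMap a b A)

/-- The composite of the automorphisms `stripMap` along the strips `k`, …, `k + t - 1` of `ε`. -/
def stripComp (ε : ℕ → ℕ → ℕ) (A : ℕ → ℕ → ℕ → R) (k : ℕ) : ℕ → RowSeq R →ₗ[R] RowSeq R
  | 0 => LinearMap.id
  | t + 1 => stripMap (ε (k + t)) (ε (k + t + 1)) (A (k + t)) ∘ₗ stripComp ε A k t

theorem stripComp_succ_apply (ε : ℕ → ℕ → ℕ) (A : ℕ → ℕ → ℕ → R) (k t : ℕ) (x : RowSeq R) :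
    stripComp ε A k (t + 1) x
      = stripMap (ε (k + t)) (ε (k + t + 1)) (A (k + t)) (stripComp ε A k t x) := rfl

theorem stripComp_injective (ε : ℕ → ℕ → ℕ) (A : ℕ → ℕ → ℕ → R) (k t : ℕ) :
    Function.Injective (stripComp ε A k t) := by
  induction t with
  | zero => exact Function.injective_id
  | succ t ih => exact (stripMap_injective _ _ _).comp ih

theorem rowShift_pow_stripComp (ε : ℕ → ℕ → ℕ) (A : ℕ → ℕ → ℕ → R) (k t m : ℕ) (x : RowSeq R) :
    (rowShift R ^ m) (stripComp ε A k t x) = stripComp ε A k t ((rowShift R ^ m) x) := by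
  induction t with
  | zero => rfl
  | succ t ih => rw [stripComp_succ_apply, rowShift_pow_stripMap, ih]; rfl

theorem stripComp_mem_boxModule {ε : ℕ → ℕ → ℕ} (hε : ∀ k i, ε k i ≤ ε (k + 1) i)
    (A : ℕ → ℕ → ℕ → R) (k t : ℕ) {x : RowSeq R} (hx : x ∈ boxModule R (ε k)) :
    stripComp ε A k t x ∈ boxModule R (ε (k + t)) := by
  induction t with
  | zero => exact hx
  | succ t ih => exact stripMap_mem_boxModule _ (boxModule_mono (hε (k + t)) ih)

/-- The submodule of `M_(ε r)` with parameters `A`: the image of `M_(ε 0)`. -/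
def stripImage (ε : ℕ → ℕ → ℕ) (A : ℕ → ℕ → ℕ → R) (r : ℕ) : Submodule R (RowSeq R) :=
  (boxModule R (ε 0)).map (stripComp ε A 0 r)

theorem rowShift_pow_mem_stripImage {ε : ℕ → ℕ → ℕ} {A : ℕ → ℕ → ℕ → R} {r : ℕ} (m : ℕ)
    {x : RowSeq R} (hx : x ∈ stripImage ε A r) : (rowShift R ^ m) x ∈ stripImage ε A r := by
  obtain ⟨y, hy, rfl⟩ := hx
  exact ⟨_, rowShift_pow_mem_boxModule m hy, (rowShift_pow_stripComp ε A 0 r m y).symm⟩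

theorem stripMap_mem_stripImage {ε : ℕ → ℕ → ℕ} {A : ℕ → ℕ → ℕ → R} {r : ℕ} {x : RowSeq R} :
    stripMap (ε r) (ε (r + 1)) (A r) x ∈ stripImage ε A (r + 1) ↔ x ∈ stripImage ε A r := by
  constructor
  · rintro ⟨y, hy, hxy⟩
    refine ⟨y, hy, stripMap_injective (ε r) (ε (r + 1)) (A r) ?_⟩
    rw [← hxy, stripComp_succ_apply]
    simp only [zero_add]
  · rintro ⟨y, hy, rfl⟩
    refine ⟨y, hy, ?_⟩
    rw [stripComp_succ_apply]
    simp only [zero_add]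

/-- The parameters `A` of the strip `b / a` are transverse to the strip `c / b`: the span of the
rows of the second strip is mapped injectively to the quotient of `M_b` by the image of `M_a`. -/
def IsTransverse (a b c : ℕ → ℕ) (A : ℕ → ℕ → R) : Prop :=
  ∀ Y : ℕ → R, (∀ i, c i ≤ b i → Y i = 0) →
    (∀ u, a u < b u → Y u = ∑ i ∈ Finset.range u, if b i ≤ a i then A u i * Y i else 0) →
    ∀ i, Y i = 0

/-- Transversality excludes elements outside of `M_b` that `t` maps to the image of `M_a`. -/
theorem mem_boxModule_of_isTransverse {a b c : ℕ → ℕ} {A : ℕ → ℕ → R}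
    (hab : ∀ i, b i ≤ a i + 1) (hbc : ∀ i, c i ≤ b i + 1) (hb : Antitone b)
    (hA : IsTransverse a b c A) {y z : RowSeq R} (hy : y ∈ boxModule R c) (hz : z ∈ boxModule R a)
    (hyz : rowShift R y = stripMap a b A z) : y ∈ boxModule R b := by
  have hY := hA (fun i => y i (b i)) (fun i hi => hy i _ hi) (fun u hu => by
    have h1 := congrFun (congrFun hyz u) (b u - 1)
    rw [rowShift_apply, stripMap_apply, hz u _ (by have := hab u; omega), zero_add,
      show b u - 1 + 1 = b u by omega] at h1
    refine h1.trans (Finset.sum_congr rfl fun i hi => ?_)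
    have h2 := hb (Finset.mem_range.1 hi).le
    by_cases h3 : b i ≤ a i
    · rw [if_pos ⟨hu, h3⟩, if_pos h3, show b u - 1 + (b i - b u) = b i - 1 by omega]
      have h4 := congrFun (congrFun hyz i) (b i - 1)
      rw [rowShift_apply, stripMap_apply_of_le A z h3, show b i - 1 + 1 = b i by omega] at h4
      rw [← h4]
    · rw [if_neg (fun h => h3 h.2), if_neg h3])
  intro i j hj
  rcases Nat.eq_or_lt_of_le hj with rfl | hj
  · exact hY i
  · exact hy i j (by have := hbc i; omega)

/-- A chain of vertical strips of partitions. -/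
structure IsStripChain (ε : ℕ → ℕ → ℕ) : Prop where
  anti : ∀ k, Antitone (ε k)
  le : ∀ k i, ε k i ≤ ε (k + 1) i
  le_add_one : ∀ k i, ε (k + 1) i ≤ ε k i + 1

variable {ε : ℕ → ℕ → ℕ} {A A' : ℕ → ℕ → ℕ → R}

theorem IsStripChain.rowShift_pow_mem_stripImage (hε : IsStripChain ε) (r : ℕ) {x : RowSeq R}
    (hx : x ∈ boxModule R (ε r)) : (rowShift R ^ r) x ∈ stripImage ε A r := by
  induction r generalizing x with
  | zero => exact ⟨x, hx, rfl⟩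
  | succ r ih =>
    have h1 := stripMap_mem_boxModule (a := ε r) (-A r) hx
    have h2 := ih (rowShift_mem_boxModule (hε.le_add_one r) h1)
    rw [← stripMap_mem_stripImage (r := r), ← rowShift_pow_stripMap, rowShift_stripMap,
      stripMap_stripMap_neg] at h2
    exact h2

theorem IsStripChain.mem_map_stripMap (hε : IsStripChain ε) (r : ℕ)
    (hA : ∀ k, k + 1 ≤ r → IsTransverse (ε k) (ε (k + 1)) (ε (k + 2)) (A k))
    {x : RowSeq R} (hx : x ∈ boxModule R (ε (r + 1)))
    (hN : (rowShift R ^ r) x ∈ stripImage ε A (r + 1)) :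
    x ∈ (boxModule R (ε r)).map (stripMap (ε r) (ε (r + 1)) (A r)) := by
  induction r generalizing x with
  | zero => simpa [stripImage, stripComp] using hN
  | succ r ih =>
    set y := stripMap (ε (r + 1)) (ε (r + 1 + 1)) (-A (r + 1)) x with hy
    have hxy : stripMap (ε (r + 1)) (ε (r + 1 + 1)) (A (r + 1)) y = x :=
      stripMap_stripMap_neg _ _ _ _
    refine ⟨y, ?_, hxy⟩
    have hyc : y ∈ boxModule R (ε (r + 1 + 1)) := stripMap_mem_boxModule _ hx
    rw [← hxy, rowShift_pow_stripMap, stripMap_mem_stripImage, pow_succ, Module.End.mul_apply] at hN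
    obtain ⟨z, hz, hyz⟩ := ih (fun k hk => hA k (by omega))
      (rowShift_mem_boxModule (hε.le_add_one (r + 1)) hyc) hN
    exact mem_boxModule_of_isTransverse (hε.le_add_one r) (hε.le_add_one (r + 1)) (hε.anti (r + 1))
      (hA r le_rfl) hyc hz hyz.symm

/-- For transverse parameters, the submodule at level `k` is recovered from the one at level `0`
as the set of all elements mapped into it by `t ^ k`. -/
theorem IsStripChain.mem_stripImage_iff (hε : IsStripChain ε) (k t : ℕ)
    (hA : ∀ m, m + 2 ≤ k + t → IsTransverse (ε m) (ε (m + 1)) (ε (m + 2)) (A m)) (x : RowSeq R) :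
    (x ∈ boxModule R (ε (k + t)) ∧ (rowShift R ^ k) x ∈ stripImage ε A (k + t)) ↔
      x ∈ (boxModule R (ε k)).map (stripComp ε A k t) := by
  induction t generalizing x with
  | zero =>
    constructor
    · rintro ⟨h, -⟩; exact ⟨x, h, rfl⟩
    · rintro ⟨y, hy, rfl⟩; exact ⟨hy, hε.rowShift_pow_mem_stripImage k hy⟩
  | succ t ih =>
    constructor
    · rintro ⟨h1, h2⟩
      have h3 := _root_.rowShift_pow_mem_stripImage t h2
      rw [← Module.End.mul_apply, ← pow_add, add_comm t k] at h3
      obtain ⟨y, hy, rfl⟩ := hε.mem_map_stripMap (k + t) (fun m hm => hA m (by omega)) h1 h3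
      rw [rowShift_pow_stripMap] at h2
      obtain ⟨z, hz, rfl⟩ := (ih (fun m hm => hA m (by omega)) y).1
        ⟨hy, stripMap_mem_stripImage.1 h2⟩
      exact ⟨z, hz, rfl⟩
    · rintro ⟨z, hz, rfl⟩
      obtain ⟨h1, h2⟩ := (ih (fun m hm => hA m (by omega)) _).2 ⟨z, hz, rfl⟩
      refine ⟨stripComp_mem_boxModule hε.le A k (t + 1) hz, ?_⟩
      rw [stripComp_succ_apply, rowShift_pow_stripMap]
      exact stripMap_mem_stripImage.2 h2

theorem stripMap_congr {a b : ℕ → ℕ} {A A' : ℕ → ℕ → R}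
    (h : ∀ s i, i < s → a s < b s → b i ≤ a i → A s i = A' s i) :
    stripMap a b A = stripMap a b A' := by
  refine LinearMap.ext fun x => ?_
  funext s j
  rw [stripMap_apply, stripMap_apply]
  congr 1
  refine Finset.sum_congr rfl fun i hi => ?_
  split_ifs with hs
  · rw [h s i (Finset.mem_range.1 hi) hs.1 hs.2]
  · rfl

/-- The parameters of a strip are determined by the image of `M_a`. -/
theorem stripMap_param_unique {a b : ℕ → ℕ} {A A' : ℕ → ℕ → R} (hab : ∀ i, b i ≤ a i + 1)
    (hb : Antitone b)
    (h : (boxModule R a).map (stripMap a b A) ≤ (boxModule R a).map (stripMap a b A'))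
    {s i : ℕ} (his : i < s) (hs : a s < b s) (hi : b i ≤ a i) : A s i = A' s i := by
  have hbi : b s ≤ b i := hb his.le
  let x : RowSeq R := fun i' j => if i' = i ∧ j = b i - 1 then 1 else 0
  have hx : x ∈ boxModule R a := by
    intro i' j hj
    simp only [x]
    rw [if_neg]
    rintro ⟨rfl, rfl⟩
    omega
  have key : ∀ (A : ℕ → ℕ → R) (z : RowSeq R), z ∈ boxModule R a →
      (∀ i', b i' ≤ a i' → b s ≤ b i' → z i' (b i' - 1) = if i' = i then 1 else 0) →
      stripMap a b A z s (b s - 1) = A s i := by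
    intro A z hz hz1
    rw [stripMap_apply, hz s _ (by have := hab s; omega), zero_add,
      Finset.sum_eq_single_of_mem i (Finset.mem_range.2 his)]
    · rw [if_pos ⟨hs, hi⟩, show b s - 1 + (b i - b s) = b i - 1 by omega, hz1 i hi hbi, if_pos rfl,
        mul_one]
    · intro i' hi' hne
      have h1 := hb (Finset.mem_range.1 hi').le
      split_ifs with h2
      · rw [show b s - 1 + (b i' - b s) = b i' - 1 by omega, hz1 i' h2.2 h1, if_neg hne, mul_zero]
      · rfl
  have hx1 : ∀ i', b i' ≤ a i' → b s ≤ b i' → x i' (b i' - 1) = if i' = i then 1 else 0 := by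
    intro i' _ _
    by_cases h : i' = i
    · subst h; simp [x]
    · simp [x, h]
  obtain ⟨z, hz, hzx⟩ := h ⟨x, hx, rfl⟩
  rw [← key A x hx hx1, ← hzx]
  refine (key A' z hz fun i' h1 h2 => ?_)
  rw [← hx1 i' h1 h2, ← stripMap_apply_of_le A' z h1, hzx, stripMap_apply_of_le A x h1]

theorem IsStripChain.param_unique (hε : IsStripChain ε) (r : ℕ)
    (hA' : ∀ k, k + 2 ≤ r → IsTransverse (ε k) (ε (k + 1)) (ε (k + 2)) (A' k))
    (h : stripImage ε A r = stripImage ε A' r) {k s i : ℕ} (hk : k < r) (his : i < s)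
    (hs : ε k s < ε (k + 1) s) (hi : ε (k + 1) i ≤ ε k i) : A k s i = A' k s i := by
  induction r with
  | zero => omega
  | succ r ih =>
    have hr : ∀ s i, i < s → ε r s < ε (r + 1) s → ε (r + 1) i ≤ ε r i → A r s i = A' r s i := by
      intro s i his hs hi
      refine stripMap_param_unique (hε.le_add_one r) (hε.anti (r + 1)) ?_ his hs hi
      rintro x ⟨y, hy, rfl⟩
      refine hε.mem_map_stripMap r (fun k hk => hA' k (by omega))
        (stripMap_mem_boxModule _ (boxModule_mono (hε.le r) hy)) ?_
      rw [← h, rowShift_pow_stripMap]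
      exact stripMap_mem_stripImage.2 (hε.rowShift_pow_mem_stripImage r hy)
    rcases Nat.lt_or_ge k r with hkr | hkr
    · refine ih (fun k hk => hA' k (by omega)) ?_ hkr
      ext x
      rw [← stripMap_mem_stripImage (A := A), ← stripMap_mem_stripImage (A := A'), ← h,
        stripMap_congr hr]
    · obtain rfl : k = r := by omega
      exact hr s i his hs hi

theorem stripComp_congr {r : ℕ}
    (h : ∀ k s i, k < r → i < s → ε k s < ε (k + 1) s → ε (k + 1) i ≤ ε k i → A k s i = A' k s i) :
    stripComp ε A 0 r = stripComp ε A' 0 r := by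
  induction r with
  | zero => rfl
  | succ r ih =>
    rw [stripComp, stripComp, ih fun k s i hk => h k s i (by omega)]
    simp only [zero_add]
    rw [stripMap_congr fun s i => h r s i (by omega)]

/-- Applying a ring homomorphism to all entries. -/
def RowSeq.map {R R' : Type*} [CommRing R] [CommRing R'] (φ : R →+* R') (x : RowSeq R) :
    RowSeq R' := fun i j => φ (x i j)

theorem map_stripMap {R' : Type*} [CommRing R'] (φ : R →+* R') (a b : ℕ → ℕ) (A : ℕ → ℕ → R)
    (x : RowSeq R) :
    (stripMap a b A x).map φ = stripMap a b (fun s i => φ (A s i)) (x.map φ) := by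
  funext s j
  simp only [RowSeq.map, stripMap_apply, map_add, map_sum]
  congr 1
  refine Finset.sum_congr rfl fun i _ => ?_
  split_ifs <;> simp

theorem map_stripComp {R' : Type*} [CommRing R'] (φ : R →+* R') (ε : ℕ → ℕ → ℕ)
    (A : ℕ → ℕ → ℕ → R) (k t : ℕ) (x : RowSeq R) :
    (stripComp ε A k t x).map φ = stripComp ε (fun k s i => φ (A k s i)) k t (x.map φ) := by
  induction t with
  | zero => rfl
  | succ t ih => rw [stripComp_succ_apply, map_stripMap, ih]; rfl

end Ring

/-! ### Existence of transverse parameters -/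

section Transverse

/-- A system of pivots for the transversality of the strips `b / a` and `c / b`: an injection from
the rows of the second strip to those of the first one that does not decrease row numbers and is the
identity on common rows. -/
structure IsPivot (a b c ρ : ℕ → ℕ) : Prop where
  mem : ∀ s, b s < c s → a (ρ s) < b (ρ s)
  le : ∀ s, b s < c s → s ≤ ρ s
  inj : ∀ s s', b s < c s → b s' < c s' → ρ s = ρ s' → s = s'
  eq_self : ∀ s, b s < c s → a s < b s → ρ s = s

/-- Pivots exist by Hall's marriage theorem: the Yamanouchi condition compares the numbers of rows
of the two strips below any given row. -/
theorem VLattice.exists_isPivot {n : ℕ} {a b c : ℕ → ℕ} (h : VLattice n a b c)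
    (hab : ∀ i, a i ≤ b i ∧ b i ≤ a i + 1) (hbc : ∀ i, b i ≤ c i ∧ c i ≤ b i + 1)
    (hn : ∀ i, n ≤ i → c i = 0) : ∃ ρ, IsPivot a b c ρ := by
  classical
  let S1 : Finset ℕ := (Finset.range n).filter fun i => a i < b i
  let S2 : Finset ℕ := (Finset.range n).filter fun i => b i < c i
  have hS1 : ∀ i, i ∈ S1 ↔ a i < b i := by
    intro i
    simp only [S1, Finset.mem_filter, Finset.mem_range, and_iff_right_iff_imp]
    intro hi
    by_contra hlt
    have := hn i (by omega); have := hbc i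
    omega
  have hS2 : ∀ i, i ∈ S2 ↔ b i < c i := by
    intro i
    simp only [S2, Finset.mem_filter, Finset.mem_range, and_iff_right_iff_imp]
    intro hi
    by_contra hlt
    have := hn i (by omega)
    omega
  have hcard : ∀ m, ((S2 \ S1).filter (m ≤ ·)).card ≤ ((S1 \ S2).filter (m ≤ ·)).card := by
    intro m
    have e1 : ∀ (x y : ℕ → ℕ), (∀ i, x i ≤ y i ∧ y i ≤ x i + 1) → ∀ S : Finset ℕ,
        (∀ i, i ∈ S ↔ i < n ∧ x i < y i) →
        ∑ j ∈ Finset.Ico m n, ((y j : ℤ) - x j) = (S.filter (m ≤ ·)).card := by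
      intro x y hxy S hS
      have : ∀ j ∈ Finset.Ico m n, ((y j : ℤ) - x j) = if x j < y j then 1 else 0 := by
        intro j _
        have := hxy j
        split_ifs <;> omega
      rw [Finset.sum_congr rfl this, Finset.sum_boole]
      congr 2
      ext i
      simp only [Finset.mem_filter, Finset.mem_Ico, hS]
      tauto
    have h1 := h m
    rw [e1 b c hbc S2 (fun i => by simp [S2]), e1 a b hab S1 (fun i => by simp [S1])] at h1
    have h2 : ((S2 \ S1).filter (m ≤ ·)).card + ((S2 ∩ S1).filter (m ≤ ·)).card
        = (S2.filter (m ≤ ·)).card := by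
      rw [← Finset.card_union_of_disjoint, ← Finset.filter_union, Finset.sdiff_union_inter]
      exact Finset.disjoint_filter_filter (Finset.disjoint_sdiff_inter _ _)
    have h3 : ((S1 \ S2).filter (m ≤ ·)).card + ((S2 ∩ S1).filter (m ≤ ·)).card
        = (S1.filter (m ≤ ·)).card := by
      rw [Finset.inter_comm, ← Finset.card_union_of_disjoint, ← Finset.filter_union,
        Finset.sdiff_union_inter]
      exact Finset.disjoint_filter_filter (Finset.disjoint_sdiff_inter _ _)
    omega
  let t : {s // s ∈ S2 \ S1} → Finset ℕ := fun s => (S1 \ S2).filter (s.1 ≤ ·)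
  obtain ⟨f, hf, hft⟩ := (Finset.all_card_le_biUnion_card_iff_exists_injective t).1 (by
    intro X
    rcases X.eq_empty_or_nonempty with rfl | hX
    · simp
    · -- only the least element of `X` matters for the union of the admissible sets
      obtain ⟨m, hm, hmin⟩ := Finset.exists_min_image X (fun s => s.1) hX
      calc X.card = (X.map (Function.Embedding.subtype _)).card := by simp
        _ ≤ ((S2 \ S1).filter (m.1 ≤ ·)).card := by
            refine Finset.card_le_card fun s hs => ?_
            obtain ⟨x, hx, rfl⟩ := Finset.mem_map.1 hs
            exact Finset.mem_filter.2 ⟨x.2, hmin x hx⟩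
        _ ≤ ((S1 \ S2).filter (m.1 ≤ ·)).card := hcard m.1
        _ ≤ (X.biUnion t).card := Finset.card_le_card fun s hs => Finset.mem_biUnion.2 ⟨m, hm, hs⟩)
  have hft' : ∀ s, f s ∈ S1 ∧ f s ∉ S2 ∧ s.1 ≤ f s := fun s => by
    have := hft s
    simp only [t, Finset.mem_filter, Finset.mem_sdiff] at this
    tauto
  refine ⟨fun s => if hs : s ∈ S2 \ S1 then f ⟨s, hs⟩ else s, ?_, ?_, ?_, ?_⟩
  · intro s hs
    by_cases h1 : s ∈ S2 \ S1
    · simp only [h1, dite_true]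
      exact (hS1 _).1 (hft' _).1
    · simp only [h1, dite_false]
      have h2 := (hS2 s).2 hs
      rw [← hS1]
      by_contra h3
      exact h1 (Finset.mem_sdiff.2 ⟨h2, h3⟩)
  · intro s hs
    by_cases h1 : s ∈ S2 \ S1
    · simp only [h1, dite_true]
      exact (hft' ⟨s, h1⟩).2.2
    · simp only [h1, dite_false, le_refl]
  · intro s s' hs hs' heq
    have h2 := (hS2 s).2 hs
    have h2' := (hS2 s').2 hs'
    by_cases h1 : s ∈ S2 \ S1 <;> by_cases h1' : s' ∈ S2 \ S1
    · simp only [h1, h1', dite_true] at heq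
      exact congrArg Subtype.val (hf heq)
    · simp only [h1, h1', dite_true, dite_false] at heq
      exact absurd h2' (heq ▸ (hft' ⟨s, h1⟩).2.1)
    · simp only [h1, h1', dite_true, dite_false] at heq
      exact absurd h2 (heq.symm ▸ (hft' ⟨s', h1'⟩).2.1)
    · simpa only [h1, h1', dite_false] using heq
  · intro s _ hs
    have h1 : s ∉ S2 \ S1 := fun h => (Finset.mem_sdiff.1 h).2 ((hS1 s).2 hs)
    simp only [h1, dite_false]

variable {R : Type*} [CommRing R]

/-- The square matrix of the transversality equations in the rows selected by `ρ`. -/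
def transverseMatrix (n : ℕ) (a b c ρ : ℕ → ℕ) (A : ℕ → ℕ → R) :
    Matrix {i : Fin n // b i < c i} {i : Fin n // b i < c i} R := fun s' s =>
  (if ρ s'.1 = s.1 then 1 else 0) -
    if (s.1 : ℕ) < ρ s'.1 ∧ b s.1 ≤ a s.1 then A (ρ s'.1) s.1 else 0

/-- The rows selected by pivots already suffice to express transversality. -/
theorem isTransverse_of_det_ne_zero [IsDomain R] {n : ℕ} {a b c ρ : ℕ → ℕ} {A : ℕ → ℕ → R}
    (hn : ∀ i, n ≤ i → c i = 0) (hρ : IsPivot a b c ρ)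
    (hdet : (transverseMatrix n a b c ρ A).det ≠ 0) : IsTransverse a b c A := by
  classical
  intro Y hY hu
  have h1 : (fun s : {i : Fin n // b i < c i} => Y s.1) = 0 := by
    refine Matrix.eq_zero_of_mulVec_eq_zero hdet ?_
    funext s'
    have hs' := hu (ρ s'.1) (hρ.mem _ s'.2)
    have e1 : ∀ g : ℕ → R, (∀ i, c i ≤ b i → g i = 0) → (∀ m, (∀ i, m ≤ i → g i = 0) →
        ∑ s : {i : Fin n // b i < c i}, g s.1 = ∑ i ∈ Finset.range m, g i) := by
      intro g hg m hm
      have hgn : ∀ i, n ≤ i → g i = 0 := fun i hi => hg i (by rw [hn i hi]; omega)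
      have e2 : ∑ i ∈ Finset.range m, g i = ∑ i ∈ Finset.range n, g i := by
        rcases le_total m n with h | h
        · exact Finset.sum_subset (Finset.range_mono h) fun i _ hi => hm i (by simpa using hi)
        · exact (Finset.sum_subset (Finset.range_mono h) fun i _ hi =>
            hgn i (by simpa using hi)).symm
      rw [e2, Finset.sum_range,
        ← Fintype.sum_subtype_add_sum_subtype (fun i : Fin n => b i < c i) (fun i : Fin n => g i)]
      simp [fun x : {i : Fin n // ¬ b i < c i} => hg x.1 (not_lt.1 x.2)]
    have e3 : ∀ s : {i : Fin n // b i < c i}, transverseMatrix n a b c ρ A s' s * Y s.1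
        = (if ρ s'.1 = s.1 then Y s.1 else 0) -
          (if (s.1 : ℕ) < ρ s'.1 ∧ b s.1 ≤ a s.1 then A (ρ s'.1) s.1 * Y s.1 else 0) := by
      intro s
      rw [transverseMatrix]
      split_ifs <;> ring
    rw [Matrix.mulVec, dotProduct, Finset.sum_congr rfl fun s _ => e3 s, Finset.sum_sub_distrib,
      Pi.zero_apply, sub_eq_zero,
      e1 (fun i => if ρ s'.1 = i then Y i else 0) (fun i hi => by simp [hY i hi]) (ρ s'.1 + 1)
        (fun i hi => if_neg (by omega)),
      e1 (fun i => if i < ρ s'.1 ∧ b i ≤ a i then A (ρ s'.1) i * Y i else 0)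
        (fun i hi => by simp [hY i hi]) (ρ s'.1) (fun i hi => if_neg (by omega)),
      Finset.sum_ite_eq, if_pos (Finset.self_mem_range_succ _), hs']
    refine Finset.sum_congr rfl fun i hi => ?_
    simp [Finset.mem_range.1 hi]
  intro i
  rcases Nat.lt_or_ge (b i) (c i) with hi | hi
  · have hin : i < n := by
      by_contra hlt
      have := hn i (by omega); omega
    exact congrFun h1 ⟨⟨i, hin⟩, hi⟩
  · exact hY i hi

theorem map_det_transverseMatrix {R' : Type*} [CommRing R'] (φ : R →+* R') (n : ℕ)
    (a b c ρ : ℕ → ℕ) (A : ℕ → ℕ → R) :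
    φ (transverseMatrix n a b c ρ A).det
      = (transverseMatrix n a b c ρ fun s i => φ (A s i)).det := by
  rw [RingHom.map_det]
  congr 1
  ext s' s
  simp only [transverseMatrix, RingHom.mapMatrix_apply, Matrix.map_apply, map_sub]
  split_ifs <;> simp

/-- Parameters that are supported at the pivots are transverse. -/
theorem IsPivot.det_transverseMatrix {n : ℕ} {a b c ρ : ℕ → ℕ} (hρ : IsPivot a b c ρ)
    {A : ℕ → ℕ → R} (hA : ∀ s s', b s < c s → b s ≤ a s → b s' < c s' → s < ρ s' →
      A (ρ s') s = if s = s' then -1 else 0) :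
    (transverseMatrix n a b c ρ A).det = 1 := by
  suffices h : transverseMatrix n a b c ρ A = 1 by rw [h, Matrix.det_one]
  ext s' s
  rw [Matrix.one_apply, transverseMatrix]
  have hs := s.2
  have hs' := s'.2
  by_cases h1 : a s.1 < b s.1
  · rw [if_neg (show ¬ ((s.1 : ℕ) < ρ s'.1 ∧ b s.1 ≤ a s.1) by omega), sub_zero]
    have h2 := hρ.eq_self _ hs h1
    refine if_congr ⟨fun h => ?_, fun h => by rw [h, h2]⟩ rfl rfl
    exact Subtype.ext (Fin.ext (hρ.inj _ _ hs' hs (h.trans h2.symm)))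
  · have h3 : ρ s'.1 ≠ s.1 := fun h => h1 (h ▸ hρ.mem _ hs')
    rw [if_neg h3, zero_sub]
    by_cases h2 : (s.1 : ℕ) < ρ s'.1
    · rw [if_pos ⟨h2, by omega⟩, hA _ _ hs (by omega) hs' h2]
      by_cases h4 : s' = s
      · subst h4; simp
      · rw [if_neg h4, if_neg fun h => h4 (Subtype.ext (Fin.ext h.symm)), neg_zero]
    · rw [if_neg (fun h => h2 h.1), neg_zero, if_neg]
      rintro rfl
      have := hρ.le _ hs'
      omega

end Transverse

/-! ### Dimension of images of polynomial maps -/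

section Algebraic

/-- If homomorphisms from a domain `B` to an algebraic closure of its fraction field that do not
vanish at `q` are determined by their values at the elements `y`, then `B` is algebraic over the
algebra generated by the elements `y`. -/
theorem isAlgebraic_adjoin_of_algHom_ext {k B : Type} [Field k] [CommRing B] [IsDomain B]
    [Algebra k B] {ι : Type*} (y : ι → B) {q : B} (hq : q ≠ 0)
    (H : ∀ φ φ' : B →ₐ[k] AlgebraicClosure (FractionRing B), φ q ≠ 0 → φ' q ≠ 0 →
      (∀ i, φ (y i) = φ' (y i)) → φ = φ') :
    Algebra.IsAlgebraic (Algebra.adjoin k (Set.range y)) B := by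
  set A := Algebra.adjoin k (Set.range y) with hA
  obtain ⟨κ, x, hx⟩ := exists_isTranscendenceBasis' A B
  rw [← hx.isEmpty_iff_isAlgebraic]
  by_contra hne
  rw [not_isEmpty_iff] at hne
  obtain ⟨k0⟩ := hne
  let L := AlgebraicClosure (FractionRing B)
  let φ : B →ₐ[k] L := IsScalarTower.toAlgHom k B L
  have hφ : Function.Injective φ := by
    have : (φ : B → L) = algebraMap (FractionRing B) L ∘ algebraMap B (FractionRing B) := rfl
    rw [this]
    exact (RingHom.injective _).comp (IsFractionRing.injective B (FractionRing B))
  -- the second homomorphism translates the transcendence basis by `1`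
  let f : MvPolynomial κ A →ₐ[A] MvPolynomial κ A :=
    MvPolynomial.aeval fun i => MvPolynomial.X i + 1
  let f' : MvPolynomial κ A →ₐ[A] MvPolynomial κ A :=
    MvPolynomial.aeval fun i => MvPolynomial.X i - 1
  have hf : Function.Injective f := by
    have : f'.comp f = AlgHom.id A _ := by
      refine MvPolynomial.algHom_ext fun i => ?_
      simp [f, f']
    exact Function.LeftInverse.injective (g := f') fun p => DFunLike.congr_fun this p
  let : Algebra (MvPolynomial κ A) B := (MvPolynomial.aeval (R := A) x).toRingHom.toAlgebra
  let : Algebra (MvPolynomial κ A) L :=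
    ((φ.toRingHom.comp (MvPolynomial.aeval (R := A) x).toRingHom).comp f.toRingHom).toAlgebra
  have hCB : Function.Injective (algebraMap (MvPolynomial κ A) B) := hx.1
  have hCL : Function.Injective (algebraMap (MvPolynomial κ A) L) := (hφ.comp hx.1).comp hf
  have : Module.IsTorsionFree (MvPolynomial κ A) B :=
    Module.isTorsionFree_iff_algebraMap_injective.2 hCB
  have : Module.IsTorsionFree (MvPolynomial κ A) L :=
    Module.isTorsionFree_iff_algebraMap_injective.2 hCL
  have : Algebra.IsAlgebraic (MvPolynomial κ A) B := by
    have := hx.isAlgebraic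
    refine Algebra.IsAlgebraic.of_ringHom_of_comp_eq (S := Algebra.adjoin A (Set.range x)) (B := B)
      hx.1.aevalEquiv (RingHom.id B) hx.1.aevalEquiv.surjective Function.injective_id ?_
    ext <;> simp [RingHom.algebraMap_toAlgebra]
  let ψ : B →ₐ[MvPolynomial κ A] L := IsAlgClosed.lift
  have hψ : ∀ p : MvPolynomial κ A, ψ (MvPolynomial.aeval x p) = φ (MvPolynomial.aeval x (f p)) :=
    ψ.commutes
  let φ' : B →ₐ[k] L :=
    { ψ.toRingHom with
      commutes' := fun c => by
        have := hψ (MvPolynomial.C (algebraMap k A c))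
        rw [MvPolynomial.aeval_C, MvPolynomial.algHom_C, MvPolynomial.algebraMap_eq,
          MvPolynomial.aeval_C, ← IsScalarTower.algebraMap_apply] at this
        exact this.trans (φ.commutes c) }
  have hq' : φ' q ≠ 0 := by
    intro h
    obtain ⟨r, hr, hqr⟩ :=
      (Algebra.IsAlgebraic.isAlgebraic (R := MvPolynomial κ A) q).exists_nonzero_dvd
        (mem_nonZeroDivisors_of_ne_zero hq)
    have h1 := map_dvd φ' hqr
    rw [h, zero_dvd_iff] at h1
    have h2 : algebraMap (MvPolynomial κ A) L r = 0 := (ψ.commutes r).symm.trans h1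
    exact hr (hCL (h2.trans (map_zero _).symm))
  have h1 := H φ φ' (fun h => hq (hφ (h.trans (map_zero φ).symm))) hq' (fun i => by
    have h2 := hψ (MvPolynomial.C ⟨y i, Algebra.subset_adjoin ⟨i, rfl⟩⟩)
    rw [MvPolynomial.aeval_C, MvPolynomial.algHom_C, MvPolynomial.algebraMap_eq,
      MvPolynomial.aeval_C] at h2
    exact h2.symm)
  have h2 := hψ (MvPolynomial.X k0)
  have h3 : φ (x k0) = φ' (x k0) := by rw [← h1]
  simp only [MvPolynomial.aeval_X, f, map_add, map_one] at h2
  have h4 : φ' (x k0) = ψ (x k0) := rfl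
  rw [h4, h2] at h3
  simp at h3

open Cardinal in
/-- If the kernel of one polynomial map is contained in that of another one with as many parameters,
and the parameters of the second one are algebraic over its image, then the kernels agree: an
irreducible closed subset of the same dimension is everything. -/
theorem ker_eq_of_ker_le {k : Type} [Field k] {ι σ τ : Type} [Finite σ] [Finite τ]
    (hcard : Nat.card σ = Nat.card τ) (Ψ : MvPolynomial ι k →ₐ[k] MvPolynomial σ k)
    (Θ : MvPolynomial ι k →ₐ[k] MvPolynomial τ k) (hle : RingHom.ker Ψ ≤ RingHom.ker Θ)
    (halg : Algebra.IsAlgebraic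
      (Algebra.adjoin k (Set.range fun i => Θ (MvPolynomial.X i))) (MvPolynomial τ k)) :
    RingHom.ker Ψ = RingHom.ker Θ := by
  obtain ⟨t, ht, hbasis⟩ := exists_isTranscendenceBasis_subset (R := k) (A := MvPolynomial τ k)
    (Set.range fun i => Θ (MvPolynomial.X i))
  choose j hj using fun z : t => ht z.2
  have hcardt : #t = #τ := by
    rw [hbasis.cardinalMk_eq_trdeg, MvPolynomial.trdeg_of_isDomain]; simp
  have : Finite t := by
    rw [← Cardinal.mk_lt_aleph0_iff, hcardt]; exact Cardinal.mk_lt_aleph0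
  let I : MvPolynomial t k →ₐ[k] MvPolynomial ι k := MvPolynomial.rename j
  have hΘI : Function.Injective (Θ.comp I) := by
    have : Θ.comp I = MvPolynomial.aeval ((↑) : t → MvPolynomial τ k) :=
      MvPolynomial.algHom_ext fun z => by simp [I, hj]
    rw [this]; exact hbasis.1
  have hS : IsTranscendenceBasis k fun z : t => Ψ (MvPolynomial.X (j z)) := by
    have hind : AlgebraicIndependent k fun z : t => Ψ (MvPolynomial.X (j z)) := by
      have : Ψ.comp I = MvPolynomial.aeval fun z : t => Ψ (MvPolynomial.X (j z)) :=
        MvPolynomial.algHom_ext fun z => by simp [I]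
      rw [AlgebraicIndependent, ← this]
      refine (injective_iff_map_eq_zero _).2 fun p hp => ?_
      exact (injective_iff_map_eq_zero _).1 hΘI p (hle hp)
    refine hind.isTranscendenceBasis_of_trdeg_le_of_finite ?_
    rw [hcardt, MvPolynomial.trdeg_of_isDomain, Cardinal.lift_id, ← Nat.cast_card, hcard,
      Nat.cast_card]
  refine le_antisymm hle fun p hp => ?_
  by_contra hpS
  have halgS := hS.isAlgebraic
  obtain ⟨q, hq0, hq⟩ := (halgS.isAlgebraic (Ψ p)).exists_nonzero_coeff_and_aeval_eq_zero
    (mem_nonZeroDivisors_of_ne_zero hpS)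
  -- lift the algebraic equation to the polynomial ring in the variables `ι`
  have hlift : ∀ a : Algebra.adjoin k (Set.range fun z : t => Ψ (MvPolynomial.X (j z))),
      ∃ b, Ψ (I b) = a := by
    rintro ⟨a, ha⟩
    rw [Algebra.adjoin_range_eq_range_aeval] at ha
    obtain ⟨b, rfl⟩ := ha
    refine ⟨b, ?_⟩
    have : Ψ.comp I = MvPolynomial.aeval fun z : t => Ψ (MvPolynomial.X (j z)) :=
      MvPolynomial.algHom_ext fun z => by simp [I]
    exact DFunLike.congr_fun this b
  choose b hb using hlift
  let P : MvPolynomial ι k := ∑ m ∈ Finset.range (q.natDegree + 1), I (b (q.coeff m)) * p ^ m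
  have hP : Ψ P = 0 := by
    rw [← hq, Polynomial.aeval_eq_sum_range]
    simp only [P, map_sum, map_mul, map_pow, hb, Algebra.smul_def]
    rfl
  have hP' : Θ P = 0 := hle hP
  simp only [P, map_sum, map_mul, map_pow, show Θ p = 0 from hp] at hP'
  rw [Finset.sum_eq_single_of_mem 0 (by simp) (fun m _ hm => by simp [hm]), pow_zero,
    mul_one] at hP'
  have h0 : b (q.coeff 0) = 0 := (injective_iff_map_eq_zero _).1 hΘI _ hP'
  have h1 := hb (q.coeff 0)
  rw [h0, map_zero, map_zero] at h1
  exact hq0 (Subtype.ext h1.symm)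

end Algebraic

/-! ### Jordan types of submodules -/

section HasType

variable {K : Type*} [Field K]

/-- Coordinates on the module `M_μ`. -/
def boxEquiv (K : Type*) [Field K] {n : ℕ} {μ : ℕ → ℕ} (hn : ∀ i, n ≤ i → μ i = 0) :
    boxModule K μ ≃ₗ[K] ((i : Fin n) → Fin (μ i) → K) where
  toFun x i j := x.1 i j
  map_add' _ _ := rfl
  map_smul' _ _ := rfl
  invFun y := ⟨fun i j => if h : i < n ∧ j < μ i then y ⟨i, h.1⟩ ⟨j, h.2⟩ else 0,
    fun i j hj => dif_neg fun h => by omega⟩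
  left_inv x := by
    refine Subtype.ext ?_
    funext i j
    by_cases h : i < n ∧ j < μ i
    · exact dif_pos h
    · refine (dif_neg h).trans (x.2 i j ?_).symm
      by_contra hlt
      have := hn i
      omega
  right_inv y := by
    funext i j
    exact dif_pos ⟨i.2, j.2⟩

theorem finiteDimensional_boxModule {n : ℕ} {μ : ℕ → ℕ} (hn : ∀ i, n ≤ i → μ i = 0) :
    FiniteDimensional K (boxModule K μ) :=
  (boxEquiv K hn).symm.finiteDimensional

theorem finrank_boxModule {n : ℕ} {μ : ℕ → ℕ} (hn : ∀ i, n ≤ i → μ i = 0) :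
    Module.finrank K (boxModule K μ) = ∑ i ∈ Finset.range n, μ i := by
  rw [(boxEquiv K hn).finrank_eq, Module.finrank_pi_fintype, Finset.sum_range]
  simp

theorem mem_ker_rowShift_pow {j : ℕ} {x : RowSeq K} :
    x ∈ LinearMap.ker (rowShift K ^ j) ↔ ∀ i m, j ≤ m → x i m = 0 := by
  rw [LinearMap.mem_ker]
  constructor
  · intro h i m hm
    have := congrFun (congrFun h i) (m - j)
    rwa [rowShift_pow_apply, Nat.sub_add_cancel hm] at this
  · intro h
    funext i m
    rw [rowShift_pow_apply, h i _ (by omega)]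
    rfl

theorem boxModule_inf_ker (μ : ℕ → ℕ) (j : ℕ) :
    boxModule K μ ⊓ LinearMap.ker (rowShift K ^ j) = boxModule K fun i => min (μ i) j := by
  ext x
  rw [Submodule.mem_inf, mem_ker_rowShift_pow, mem_boxModule, mem_boxModule]
  constructor
  · rintro ⟨h1, h2⟩ i m hm
    rcases min_le_iff.1 hm with h | h
    · exact h1 i m h
    · exact h2 i m h
  · intro h
    exact ⟨fun i m hm => h i m (min_le_iff.2 (Or.inl hm)),
      fun i m hm => h i m (min_le_iff.2 (Or.inr hm))⟩

/-- The nilpotent operator `t` on `N` has Jordan type `(μ 0, …, μ (n - 1))`. -/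
def HasType (n : ℕ) (μ : ℕ → ℕ) (N : Submodule K (RowSeq K)) : Prop :=
  ∀ j, Module.finrank K (N ⊓ LinearMap.ker (rowShift K ^ j) : Submodule K (RowSeq K))
    = ∑ i ∈ Finset.range n, min (μ i) j

theorem rowShift_pow_comm {g : RowSeq K →ₗ[K] RowSeq K}
    (hg : ∀ x, g (rowShift K x) = rowShift K (g x)) (j : ℕ) (x : RowSeq K) :
    g ((rowShift K ^ j) x) = (rowShift K ^ j) (g x) := by
  induction j generalizing x with
  | zero => rfl
  | succ j ih => rw [pow_succ, Module.End.mul_apply, ih, hg]; rfl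

theorem hasType_map_boxModule {n : ℕ} {μ : ℕ → ℕ} (hn : ∀ i, n ≤ i → μ i = 0)
    {g : RowSeq K →ₗ[K] RowSeq K} (hg : ∀ x, g (rowShift K x) = rowShift K (g x))
    (hinj : Set.InjOn g (boxModule K μ)) : HasType n μ ((boxModule K μ).map g) := by
  intro j
  have h1 : (boxModule K μ).map g ⊓ LinearMap.ker (rowShift K ^ j)
      = (boxModule K fun i => min (μ i) j).map g := by
    rw [← boxModule_inf_ker]
    ext x
    constructor
    · rintro ⟨⟨y, hy, rfl⟩, h⟩
      refine ⟨y, ⟨hy, ?_⟩, rfl⟩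
      rw [SetLike.mem_coe, LinearMap.mem_ker, ← rowShift_pow_comm hg] at h
      exact hinj (rowShift_pow_mem_boxModule j hy) (zero_mem _) (h.trans (map_zero g).symm)
    · rintro ⟨y, ⟨hy, h⟩, rfl⟩
      refine ⟨⟨y, hy, rfl⟩, ?_⟩
      rw [SetLike.mem_coe, LinearMap.mem_ker] at h ⊢
      rw [← rowShift_pow_comm hg, h, map_zero]
  have hinj' : Function.Injective (g.domRestrict (boxModule K fun i => min (μ i) j)) := by
    rintro ⟨x, hx⟩ ⟨y, hy⟩ hxy
    exact Subtype.ext (hinj (boxModule_mono (fun i => min_le_left _ _) hx)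
      (boxModule_mono (fun i => min_le_left _ _) hy) hxy)
  rw [h1, ← finrank_boxModule (K := K) (μ := fun i => min (μ i) j)
    (fun i hi => by simp [hn i hi])]
  have h2 : (boxModule K fun i => min (μ i) j).map g
      = LinearMap.range (g.domRestrict (boxModule K fun i => min (μ i) j)) := by
    rw [LinearMap.range_domRestrict]
  rw [h2, LinearMap.finrank_range_of_inj hinj']

/-- The Jordan type is determined by the submodule. -/
theorem HasType.unique {n : ℕ} {μ ν : ℕ → ℕ} {N : Submodule K (RowSeq K)} (hμ : Antitone μ)
    (hν : Antitone ν) (hμn : ∀ i, n ≤ i → μ i = 0) (hνn : ∀ i, n ≤ i → ν i = 0)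
    (h : HasType n μ N) (h' : HasType n ν N) : μ = ν := by
  classical
  have h1 : ∀ j, ∑ i ∈ Finset.range n, min (μ i) j = ∑ i ∈ Finset.range n, min (ν i) j :=
    fun j => (h j).symm.trans (h' j)
  have h2 : ∀ (ξ : ℕ → ℕ) j, ∑ i ∈ Finset.range n, min (ξ i) (j + 1)
      = ∑ i ∈ Finset.range n, min (ξ i) j + ((Finset.range n).filter fun i => j < ξ i).card := by
    intro ξ j
    rw [Finset.card_filter, ← Finset.sum_add_distrib]
    refine Finset.sum_congr rfl fun i _ => ?_
    split_ifs <;> omega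
  have h3 : ∀ (ξ : ℕ → ℕ), Antitone ξ → (∀ i, n ≤ i → ξ i = 0) → ∀ i j,
      j < ξ i ↔ i < ((Finset.range n).filter fun i => j < ξ i).card := by
    intro ξ hξ hξn i j
    constructor
    · intro hj
      have : Finset.range (i + 1) ⊆ (Finset.range n).filter fun i => j < ξ i := by
        intro m hm
        have h4 := hξ (Nat.lt_succ_iff.1 (Finset.mem_range.1 hm))
        refine Finset.mem_filter.2 ⟨Finset.mem_range.2 ?_, by omega⟩
        by_contra hlt
        have := hξn m (by omega)
        omega
      have := Finset.card_le_card this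
      rw [Finset.card_range] at this
      omega
    · intro hi
      by_contra hj
      have : ((Finset.range n).filter fun i => j < ξ i) ⊆ Finset.range i := by
        intro m hm
        rw [Finset.mem_range]
        by_contra hlt
        have h4 := hξ (not_lt.1 hlt)
        have := (Finset.mem_filter.1 hm).2
        omega
      have := Finset.card_le_card this
      rw [Finset.card_range] at this
      omega
  funext i
  refine eq_of_forall_lt_iff fun j => ?_
  rw [h3 μ hμ hμn, h3 ν hν hνn]
  have e1 := h2 μ j
  have e2 := h2 ν j
  rw [h1, h1] at e1
  rw [show ((Finset.range n).filter fun i => j < μ i).card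
    = ((Finset.range n).filter fun i => j < ν i).card by omega]

end HasType

/-! ### Submodules between `t M_μ` and `M_μ` -/

section Between

variable {K : Type*} [Field K]

/-- The coordinates of `M_μ / t M_μ` with respect to the generators: the last entry of each row.
For an empty row this is the first entry, which vanishes on `M_μ`. -/
def topCoord (K : Type*) [Field K] (μ : ℕ → ℕ) : RowSeq K →ₗ[K] ℕ → K where
  toFun x i := x i (μ i - 1)
  map_add' _ _ := rfl
  map_smul' _ _ := rfl

theorem topCoord_apply (μ : ℕ → ℕ) (x : RowSeq K) (i : ℕ) :
    topCoord K μ x i = x i (μ i - 1) := rfl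

theorem mem_boxModule_sub_one {μ : ℕ → ℕ} {x : RowSeq K} (hx : x ∈ boxModule K μ)
    (h : topCoord K μ x = 0) : x ∈ boxModule K fun i => μ i - 1 := by
  intro i j hj
  change μ i - 1 ≤ j at hj
  rcases Nat.eq_or_lt_of_le hj with rfl | hj
  · exact congrFun h i
  · exact hx i j (by omega)

/-- The unipotent endomorphism of `M_μ` that adds to the generator of each row `i` the combination
of the generators of the rows `s > i` with coefficients `c i s`. -/
def lowerMap (μ : ℕ → ℕ) (c : ℕ → ℕ → K) : RowSeq K →ₗ[K] RowSeq K where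
  toFun x s j := x s j + ∑ i ∈ Finset.range s, c i s * x i (j + (μ i - μ s))
  map_add' x y := by
    funext s j
    simp only [Pi.add_apply, mul_add, Finset.sum_add_distrib]
    ring
  map_smul' a x := by
    funext s j
    simp only [Pi.smul_apply, smul_eq_mul, RingHom.id_apply, mul_add, Finset.mul_sum]
    congr 1
    exact Finset.sum_congr rfl fun i _ => by ring

theorem lowerMap_apply (μ : ℕ → ℕ) (c : ℕ → ℕ → K) (x : RowSeq K) (s j : ℕ) :
    lowerMap μ c x s j = x s j + ∑ i ∈ Finset.range s, c i s * x i (j + (μ i - μ s)) := rfl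

theorem lowerMap_rowShift (μ : ℕ → ℕ) (c : ℕ → ℕ → K) (x : RowSeq K) :
    lowerMap μ c (rowShift K x) = rowShift K (lowerMap μ c x) := by
  funext s j
  simp only [rowShift_apply, lowerMap_apply, add_right_comm]

theorem lowerMap_mem_boxModule {μ : ℕ → ℕ} (c : ℕ → ℕ → K) {x : RowSeq K}
    (hx : x ∈ boxModule K μ) : lowerMap μ c x ∈ boxModule K μ := by
  intro s j hj
  rw [lowerMap_apply, hx s j hj, zero_add]
  exact Finset.sum_eq_zero fun i _ => by rw [hx i _ (by omega), mul_zero]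

theorem lowerMap_injective (μ : ℕ → ℕ) (c : ℕ → ℕ → K) : Function.Injective (lowerMap μ c) := by
  refine (injective_iff_map_eq_zero _).2 fun x hx => ?_
  have : ∀ s j, x s j = 0 := by
    intro s
    induction s using Nat.strong_induction_on with
    | _ s ih =>
      intro j
      have h := congrFun (congrFun hx s) j
      rw [lowerMap_apply, Finset.sum_eq_zero fun i hi => by
        rw [ih i (Finset.mem_range.1 hi), mul_zero], add_zero] at h
      exact h
  funext s j
  exact this s j

/-- Renumbering the rows. -/
def permRows (K : Type*) [Field K] (π : Equiv.Perm ℕ) : RowSeq K →ₗ[K] RowSeq K where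
  toFun x s := x (π.symm s)
  map_add' _ _ := rfl
  map_smul' _ _ := rfl

theorem map_permRows_boxModule (π : Equiv.Perm ℕ) (μ : ℕ → ℕ) :
    (boxModule K fun i => μ (π i)).map (permRows K π) = boxModule K μ := by
  ext x
  constructor
  · rintro ⟨y, hy, rfl⟩ i j hj
    exact hy _ j (by simpa using hj)
  · intro hx
    refine ⟨fun i => x (π i), fun i j hj => hx _ j hj, ?_⟩
    funext s
    simp [permRows]

theorem permRows_injective (π : Equiv.Perm ℕ) : Function.Injective (permRows K π) := by
  intro x y h
  funext i
  have := congrFun h (π i)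
  simpa [permRows] using this

/-- A subset of the rows of `μ` can be moved to the top inside each group of rows of the same
length. -/
theorem exists_perm_antitone {n : ℕ} {μ : ℕ → ℕ} (hμ : Antitone μ) (hn : ∀ i, n ≤ i → μ i = 0)
    (ν : ℕ → ℕ) (hν : ∀ i, ν i ≤ μ i ∧ μ i ≤ ν i + 1) :
    ∃ π : Equiv.Perm ℕ, (∀ i, μ (π i) = μ i) ∧ Antitone fun i => ν (π i) := by
  let f : Fin n → ℕᵒᵈ := fun i => OrderDual.toDual (ν i + μ i)
  let σ := Tuple.sort f
  have hsort : ∀ i j : Fin n, i ≤ j → ν (σ j) + μ (σ j) ≤ ν (σ i) + μ (σ i) :=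
    fun i j hij => Tuple.monotone_sort f hij
  have h1 : (fun i : Fin n => OrderDual.toDual (μ i)) ∘ σ
      = (fun i : Fin n => OrderDual.toDual (μ i)) ∘ (1 : Equiv.Perm (Fin n)) := by
    refine Tuple.unique_monotone ?_ ?_
    · intro i j hij
      have := hsort i j hij
      have := hν (σ i); have := hν (σ j)
      change μ (σ j) ≤ μ (σ i)
      omega
    · intro i j hij
      exact hμ hij
  have hμσ : ∀ i : Fin n, μ (σ i) = μ i := fun i => congrFun h1 i
  let e : Fin n ≃ {i // i < n} := Fin.equivSubtype
  let π : Equiv.Perm ℕ := σ.extendDomain e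
  have hπ : ∀ i : Fin n, π i = σ i := fun i => σ.extendDomain_apply_image e i
  have hπ' : ∀ i, n ≤ i → π i = i := fun i hi =>
    σ.extendDomain_apply_not_subtype e (by omega)
  refine ⟨π, fun i => ?_, fun i j hij => ?_⟩
  · rcases Nat.lt_or_ge i n with hi | hi
    · exact (congrArg μ (hπ ⟨i, hi⟩)).trans (hμσ ⟨i, hi⟩)
    · rw [hπ' i hi]
  · change ν (π j) ≤ ν (π i)
    rcases Nat.lt_or_ge j n with hj | hj
    · have h2 := hsort ⟨i, by omega⟩ ⟨j, hj⟩ hij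
      rw [← hπ, ← hπ] at h2
      have := hν (π i); have := hν (π j)
      simp only at h2
      omega
    · rw [hπ' j hj]
      have := hν j; have := hn j hj
      omega

/-- A submodule between `t M_μ` and `M_μ` is the image of a standard one under an automorphism of
`M_μ`. -/
theorem exists_eq_map_boxModule {n : ℕ} {μ : ℕ → ℕ} (hμ : Antitone μ) (hn : ∀ i, n ≤ i → μ i = 0)
    {N : Submodule K (RowSeq K)} (h1 : (boxModule K fun i => μ i - 1) ≤ N)
    (h2 : N ≤ boxModule K μ) :
    ∃ ν, Antitone ν ∧ (∀ i, ν i ≤ μ i ∧ μ i ≤ ν i + 1) ∧ ∃ g : RowSeq K →ₗ[K] RowSeq K,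
      (∀ x, g (rowShift K x) = rowShift K (g x)) ∧ (∀ x ∈ boxModule K μ, g x ∈ boxModule K μ) ∧
      Function.Injective g ∧ N = (boxModule K ν).map g := by
  classical
  -- the pivots of an echelon basis of `N / t M_μ`
  let J : Set ℕ := {i | ∃ y ∈ N, (∀ i' < i, topCoord K μ y i' = 0) ∧ topCoord K μ y i = 1}
  have hJ : ∀ i, ∃ y, i ∈ J →
      y ∈ N ∧ (∀ i' < i, topCoord K μ y i' = 0) ∧ topCoord K μ y i = 1 := by
    intro i
    by_cases h : i ∈ J
    · obtain ⟨y, hy⟩ := h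
      exact ⟨y, fun _ => hy⟩
    · exact ⟨0, fun h' => absurd h' h⟩
  choose y hy using hJ
  have htop : ∀ x ∈ boxModule K μ, ∀ i, n ≤ i → topCoord K μ x i = 0 :=
    fun x hx i hi => hx i _ (by rw [hn i hi])
  let c : ℕ → ℕ → K := fun i => if i ∈ J then topCoord K μ (y i) else Pi.single i 1
  have hc0 : ∀ i s, s < i → c i s = 0 := by
    intro i s hs
    simp only [c]
    split_ifs with h
    · exact (hy i h).2.1 s hs
    · exact Pi.single_eq_of_ne hs.ne _
  have hc1 : ∀ i, c i i = 1 := by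
    intro i
    simp only [c]
    split_ifs with h
    · exact (hy i h).2.2
    · exact Pi.single_eq_same _ _
  have hcz : ∀ i s, i < s → μ s = 0 → c i s = 0 := by
    intro i s his hs
    simp only [c]
    split_ifs with h
    · exact h2 (hy i h).1 s _ (by omega)
    · exact Pi.single_eq_of_ne his.ne' _
  have htopg : ∀ x ∈ boxModule K μ, ∀ s, topCoord K μ (lowerMap μ c x) s
      = ∑ i ∈ Finset.range n, topCoord K μ x i * c i s := by
    intro x hx s
    have e1 : topCoord K μ (lowerMap μ c x) s
        = ∑ i ∈ Finset.range (s + 1), topCoord K μ x i * c i s := by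
      rw [Finset.sum_range_succ, hc1, mul_one, topCoord_apply, lowerMap_apply, add_comm]
      refine congrArg₂ _ (Finset.sum_congr rfl fun i hi => ?_) rfl
      have his := Finset.mem_range.1 hi
      have := hμ his.le
      rw [topCoord_apply, mul_comm]
      rcases Nat.eq_zero_or_pos (μ s) with h0 | h0
      · rw [hcz i s his h0, mul_zero, mul_zero]
      · rw [show μ s - 1 + (μ i - μ s) = μ i - 1 by omega]
    rw [e1]
    rcases le_total (s + 1) n with h | h
    · refine Finset.sum_subset (Finset.range_mono h) fun i _ hi => ?_
      rw [hc0 i s (by simpa using hi), mul_zero]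
    · refine (Finset.sum_subset (Finset.range_mono h) fun i _ hi => ?_).symm
      rw [htop x hx i (by simpa using hi), zero_mul]
  let ν' : ℕ → ℕ := fun i => if i ∈ J then μ i else μ i - 1
  have hν' : ∀ i, ν' i ≤ μ i ∧ μ i ≤ ν' i + 1 := by
    intro i
    simp only [ν']
    split_ifs <;> omega
  have hN : N = (boxModule K ν').map (lowerMap μ c) := by
    refine le_antisymm (fun z hz => ?_) ?_
    · have hsurj : ∃ x ∈ boxModule K μ, lowerMap μ c x = z := by
        have := finiteDimensional_boxModule (K := K) hn
        let g' : boxModule K μ →ₗ[K] boxModule K μ :=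
          (lowerMap μ c).restrict fun x hx => lowerMap_mem_boxModule c hx
        have hg' : Function.Injective g' := by
          rintro ⟨x, hx⟩ ⟨x', hx'⟩ h
          exact Subtype.ext (lowerMap_injective μ c (congrArg Subtype.val h))
        obtain ⟨x, hx⟩ := LinearMap.injective_iff_surjective.1 hg' ⟨z, h2 hz⟩
        exact ⟨x.1, x.2, congrArg Subtype.val hx⟩
      obtain ⟨x, hx, rfl⟩ := hsurj
      refine ⟨x, ?_, rfl⟩
      have key : ∀ i, i ∉ J → topCoord K μ x i = 0 := by
        intro i
        induction i using Nat.strong_induction_on with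
        | _ i ih =>
        intro hi
        by_contra hne
        have hin : i < n := by
          by_contra hlt
          exact hne (htop x hx i (by omega))
        refine hi ⟨(topCoord K μ x i)⁻¹ • (lowerMap μ c x
          - ∑ m ∈ Finset.range n, if m ∈ J then topCoord K μ x m • y m else 0), ?_, ?_⟩
        · refine N.smul_mem _ (N.sub_mem hz (N.sum_mem fun m _ => ?_))
          split_ifs with h
          · exact N.smul_mem _ (hy m h).1
          · exact N.zero_mem
        · have e2 : ∀ s, topCoord K μ (lowerMap μ c x
              - ∑ m ∈ Finset.range n, if m ∈ J then topCoord K μ x m • y m else 0) s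
              = ∑ m ∈ Finset.range n,
                if m ∈ J then 0 else if s = m then topCoord K μ x m else 0 := by
            intro s
            rw [map_sub, Pi.sub_apply, htopg x hx, map_sum, Finset.sum_apply,
              ← Finset.sum_sub_distrib]
            refine Finset.sum_congr rfl fun m _ => ?_
            simp only [c]
            split_ifs with h h'
            · rw [map_smul, Pi.smul_apply, smul_eq_mul, sub_self]
            · subst h'; simp
            · simp [h']
          constructor
          · intro s hs
            rw [map_smul, Pi.smul_apply, e2, Finset.sum_eq_zero, smul_zero]
            intro m _
            split_ifs with h h'
            · rfl
            · exact ih m (by omega) h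
            · rfl
          · rw [map_smul, Pi.smul_apply, e2, Finset.sum_eq_single_of_mem i (Finset.mem_range.2 hin)]
            · rw [if_neg hi, if_pos rfl, smul_eq_mul, inv_mul_cancel₀ hne]
            · intro m _ hm
              rw [if_neg hm.symm, ite_self]
      intro i j hj
      simp only [ν'] at hj
      split_ifs at hj with h
      · exact hx i j hj
      · rcases Nat.eq_or_lt_of_le hj with rfl | hj
        · exact key i h
        · exact hx i j (by omega)
    · rintro _ ⟨x, hx, rfl⟩
      have hxμ : x ∈ boxModule K μ := boxModule_mono (fun i => (hν' i).1) hx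
      have hsum : ∑ m ∈ Finset.range n, (if m ∈ J then topCoord K μ x m • y m else 0) ∈ N := by
        refine N.sum_mem fun m _ => ?_
        split_ifs with h
        · exact N.smul_mem _ (hy m h).1
        · exact N.zero_mem
      rw [← N.sub_mem_iff_left hsum]
      refine h1 (mem_boxModule_sub_one ((boxModule K μ).sub_mem
        (lowerMap_mem_boxModule c hxμ) (h2 hsum)) ?_)
      funext s
      rw [map_sub, Pi.sub_apply, htopg x hxμ, map_sum, Finset.sum_apply,
        ← Finset.sum_sub_distrib]
      refine Finset.sum_eq_zero fun m _ => ?_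
      simp only [c]
      split_ifs with h
      · rw [map_smul, Pi.smul_apply, smul_eq_mul, sub_self]
      · rw [topCoord_apply, hx m _ (by simp [ν', h])]
        simp
  obtain ⟨π, hπ, hanti⟩ := exists_perm_antitone hμ hn ν' hν'
  refine ⟨fun i => ν' (π i), hanti, fun i => ?_, lowerMap μ c ∘ₗ permRows K π, fun x => ?_,
    fun x hx => ?_, (lowerMap_injective μ c).comp (permRows_injective π), ?_⟩
  · have := hν' (π i)
    rwa [hπ] at this
  · rw [LinearMap.comp_apply, LinearMap.comp_apply, ← lowerMap_rowShift]
    rfl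
  · refine lowerMap_mem_boxModule c ?_
    rw [← map_permRows_boxModule π μ]
    refine ⟨x, ?_, rfl⟩
    simpa [hπ] using hx
  · rw [Submodule.map_comp, map_permRows_boxModule, hN]

end Between

/-! ### The chain of submodules of an extension -/

section Level

variable {K : Type*} [Field K]

/-- The composite `g (t - 1) ∘ ⋯ ∘ g 0`. -/
def chainComp (g : ℕ → RowSeq K →ₗ[K] RowSeq K) : ℕ → RowSeq K →ₗ[K] RowSeq K
  | 0 => LinearMap.id
  | t + 1 => g t ∘ₗ chainComp g t

theorem chainComp_succ' (g : ℕ → RowSeq K →ₗ[K] RowSeq K) (t : ℕ) :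
    chainComp g (t + 1) = chainComp (fun k => g (k + 1)) t ∘ₗ g 0 := by
  induction t with
  | zero => rfl
  | succ t ih => rw [chainComp, ih]; rfl

theorem chainComp_rowShift {g : ℕ → RowSeq K →ₗ[K] RowSeq K}
    (hg : ∀ k x, g k (rowShift K x) = rowShift K (g k x)) (t : ℕ) (x : RowSeq K) :
    chainComp g t (rowShift K x) = rowShift K (chainComp g t x) := by
  induction t with
  | zero => rfl
  | succ t ih => rw [chainComp, LinearMap.comp_apply, ih, hg]; rfl

theorem chainComp_injective {g : ℕ → RowSeq K →ₗ[K] RowSeq K}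
    (hg : ∀ k, Function.Injective (g k)) (t : ℕ) : Function.Injective (chainComp g t) := by
  induction t with
  | zero => exact Function.injective_id
  | succ t ih => exact (hg t).comp ih

/-- The elements of `M_γ` that are mapped into `N` by `t ^ k`. -/
def levelSubmodule (γ : ℕ → ℕ) (N : Submodule K (RowSeq K)) (k : ℕ) : Submodule K (RowSeq K) :=
  boxModule K γ ⊓ N.comap (rowShift K ^ k)

theorem mem_levelSubmodule {γ : ℕ → ℕ} {N : Submodule K (RowSeq K)} {k : ℕ} {x : RowSeq K} :
    x ∈ levelSubmodule γ N k ↔ x ∈ boxModule K γ ∧ (rowShift K ^ k) x ∈ N := Iff.rfl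

theorem levelSubmodule_levelSubmodule (γ : ℕ → ℕ) (N : Submodule K (RowSeq K)) (j k : ℕ) :
    levelSubmodule γ (levelSubmodule γ N j) k = levelSubmodule γ N (j + k) := by
  ext x
  rw [mem_levelSubmodule, mem_levelSubmodule, mem_levelSubmodule, pow_add, Module.End.mul_apply]
  exact ⟨fun h => ⟨h.1, h.2.2⟩, fun h => ⟨h.1, rowShift_pow_mem_boxModule k h.1, h.2⟩⟩

theorem levelSubmodule_zero {γ : ℕ → ℕ} {N : Submodule K (RowSeq K)} (h : N ≤ boxModule K γ) :
    levelSubmodule γ N 0 = N :=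
  le_antisymm (fun _ hx => hx.2) fun _ hx => ⟨h hx, hx⟩

theorem exists_rowShift_eq {μ : ℕ → ℕ} {x : RowSeq K} (hx : x ∈ boxModule K fun i => μ i - 1) :
    ∃ y ∈ boxModule K μ, rowShift K y = x := by
  refine ⟨fun i j => if j = 0 then 0 else x i (j - 1), fun i j hj => ?_, ?_⟩
  · dsimp only
    split_ifs
    · rfl
    · exact hx i _ (show μ i - 1 ≤ j - 1 by omega)
  · funext i j
    rw [rowShift_apply, if_neg (by omega), Nat.add_sub_cancel]

/-- A submodule `N` of `M_γ` is obtained from a standard one by a chain of automorphisms of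
standard modules whose types are those of the modules `levelSubmodule γ N k`. -/
theorem exists_chain {n : ℕ} {γ : ℕ → ℕ} (hγ : Antitone γ) (hn : ∀ i, n ≤ i → γ i = 0) (r : ℕ)
    {N : Submodule K (RowSeq K)} (hN : N ≤ boxModule K γ) (hτ : ∀ x ∈ N, rowShift K x ∈ N)
    (hr : ∀ x ∈ boxModule K γ, (rowShift K ^ r) x ∈ N) :
    ∃ (ε : ℕ → ℕ → ℕ) (g : ℕ → RowSeq K →ₗ[K] RowSeq K), (∀ k, r ≤ k → ε k = γ) ∧
      IsStripChain ε ∧ (∀ k, HasType n (ε k) (levelSubmodule γ N k)) ∧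
      (∀ k x, g k (rowShift K x) = rowShift K (g k x)) ∧
      (∀ k, ∀ x ∈ boxModule K (ε (k + 1)), g k x ∈ boxModule K (ε (k + 1))) ∧
      (∀ k, Function.Injective (g k)) ∧ N = (boxModule K (ε 0)).map (chainComp g r) := by
  induction r generalizing N with
  | zero =>
    obtain rfl : N = boxModule K γ := le_antisymm hN hr
    refine ⟨fun _ => γ, fun _ => LinearMap.id, fun _ _ => rfl,
      ⟨fun _ => hγ, fun _ _ => le_rfl, fun _ _ => Nat.le_succ _⟩, fun k => ?_, fun _ _ => rfl,
      fun _ _ h => h, fun _ => Function.injective_id, ?_⟩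
    · have h1 := hasType_map_boxModule (K := K) (g := LinearMap.id) hn (fun _ => rfl)
        Function.injective_id.injOn
      rw [Submodule.map_id] at h1
      have h2 : levelSubmodule γ (boxModule K γ) k = boxModule K γ :=
        le_antisymm inf_le_left fun x hx => ⟨hx, rowShift_pow_mem_boxModule k hx⟩
      rwa [h2]
    · exact (Submodule.map_id _).symm
  | succ r ih =>
    have hN1 : levelSubmodule γ N 1 ≤ boxModule K γ := inf_le_left
    obtain ⟨ε, g, htop, hε, htype, hcomm, hpres, hinj, hNg⟩ := ih hN1
      (fun x hx => ⟨rowShift_pow_mem_boxModule 1 hx.1, hτ _ hx.2⟩)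
      (fun x hx => ⟨rowShift_pow_mem_boxModule r hx, by
        have := hr x hx
        rwa [add_comm, pow_add] at this⟩)
    -- pull `N` back along the chain of the submodule `N_1` of the elements mapped into `N` by `t`
    set G := chainComp g r with hG
    have hle : N ≤ levelSubmodule γ N 1 := fun x hx => ⟨hN hx, hτ x hx⟩
    have hGcomm := chainComp_rowShift hcomm r
    have hε0 : ∀ k i, n ≤ i → ε k i = 0 := by
      intro k i hi
      have h1 : ∀ t, ε k i ≤ ε (k + t) i := by
        intro t
        induction t with
        | zero => exact le_rfl
        | succ t iht => exact iht.trans (hε.le _ i)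
      have h2 := h1 r
      rw [htop (k + r) (by omega), hn i hi] at h2
      omega
    obtain ⟨ν, hν, hνε, g0, hg0, hg0', hg0i, hg0N⟩ := exists_eq_map_boxModule (hε.anti 0) (hε0 0)
      (N := N.comap G ⊓ boxModule K (ε 0)) (fun x hx => by
        refine ⟨?_, boxModule_mono (fun i => Nat.sub_le _ _) hx⟩
        obtain ⟨y, hy, rfl⟩ := exists_rowShift_eq hx
        change G _ ∈ N
        rw [hG, hGcomm]
        have : chainComp g r y ∈ levelSubmodule γ N 1 := hNg ▸ ⟨y, hy, rfl⟩
        exact this.2) inf_le_right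
    have hmap : N = (N.comap G ⊓ boxModule K (ε 0)).map G := by
      refine le_antisymm (fun x hx => ?_) ?_
      · have h1 := hle hx
        rw [hNg] at h1
        obtain ⟨y, hy, rfl⟩ := h1
        exact ⟨y, ⟨hx, hy⟩, rfl⟩
      · rintro _ ⟨y, hy, rfl⟩
        exact hy.1
    let ε' : ℕ → ℕ → ℕ := fun k => Nat.casesOn k ν ε
    let g' : ℕ → RowSeq K →ₗ[K] RowSeq K := fun k => Nat.casesOn k g0 g
    have hcomm' : ∀ k x, g' k (rowShift K x) = rowShift K (g' k x) := by
      intro k; cases k with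
      | zero => exact hg0
      | succ k => exact hcomm k
    have hinj' : ∀ k, Function.Injective (g' k) := by
      intro k; cases k with
      | zero => exact hg0i
      | succ k => exact hinj k
    have hNg' : N = (boxModule K (ε' 0)).map (chainComp g' (r + 1)) := by
      rw [chainComp_succ', Submodule.map_comp]
      change N = ((boxModule K ν).map g0).map G
      rw [← hg0N]
      exact hmap
    refine ⟨ε', g', fun k hk => ?_, ⟨fun k => ?_, fun k i => ?_, fun k i => ?_⟩, fun k => ?_,
      hcomm', fun k => ?_, hinj', hNg'⟩
    · cases k with
      | zero => omega
      | succ k => exact htop k (by omega)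
    · cases k with
      | zero => exact hν
      | succ k => exact hε.anti k
    · cases k with
      | zero => exact (hνε i).1
      | succ k => exact hε.le k i
    · cases k with
      | zero => exact (hνε i).2
      | succ k => exact hε.le_add_one k i
    · cases k with
      | zero =>
        rw [levelSubmodule_zero hN, hNg']
        refine hasType_map_boxModule (fun i hi => ?_) (chainComp_rowShift hcomm' _)
          (chainComp_injective hinj' _).injOn
        have h1 := (hνε i).1
        rw [hε0 0 i hi] at h1
        exact Nat.le_zero.1 h1
      | succ k =>
        rw [show levelSubmodule γ N (k + 1) = levelSubmodule γ (levelSubmodule γ N 1) k by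
          rw [levelSubmodule_levelSubmodule, add_comm]]
        exact htype k
    · cases k with
      | zero => exact hg0'
      | succ k => exact hpres k

end Level

section Extension

variable {K : Type*} [Field K]

theorem finrank_eq_map_add_inf_ker {V W : Type*} [AddCommGroup V] [Module K V] [AddCommGroup W]
    [Module K W] (f : V →ₗ[K] W) (A : Submodule K V) [FiniteDimensional K A] :
    Module.finrank K A = Module.finrank K (A.map f)
      + Module.finrank K (A ⊓ LinearMap.ker f : Submodule K V) := by
  have h := LinearMap.finrank_range_add_finrank_ker (f.domRestrict A)
  rw [LinearMap.range_domRestrict, LinearMap.ker_domRestrict] at h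
  rw [← h]
  congr 1
  have : A ⊓ LinearMap.ker f = (Submodule.comap A.subtype (LinearMap.ker f)).map A.subtype := by
    rw [Submodule.map_comap_subtype]
  rw [this, Submodule.finrank_map_subtype_eq]

theorem finrank_add_le_of_map_le {V : Type*} [AddCommGroup V] [Module K V] (f : V →ₗ[K] V)
    {A B C : Submodule K V} [FiniteDimensional K A] [FiniteDimensional K B] (hCB : C ≤ B)
    (hAB : A.map f ≤ B) :
    Module.finrank K A + Module.finrank K C
      ≤ Module.finrank K (A ⊓ C.comap f : Submodule K V) + Module.finrank K B := by
  have h1 := finrank_eq_map_add_inf_ker (C.mkQ ∘ₗ f) A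
  have h2 := finrank_eq_map_add_inf_ker C.mkQ B
  rw [LinearMap.ker_comp, Submodule.ker_mkQ] at h1
  rw [Submodule.ker_mkQ, inf_eq_right.2 hCB] at h2
  have h3 : Module.finrank K (A.map (C.mkQ ∘ₗ f)) ≤ Module.finrank K (B.map C.mkQ) := by
    refine Submodule.finrank_mono ?_
    rw [Submodule.map_comp]
    exact Submodule.map_mono hAB
  omega

/-- The suffix form of the Yamanouchi condition follows from its version for the suffixes that
consist of the rows of bounded length. -/
theorem vLattice_of_card_le {n : ℕ} {a b c : ℕ → ℕ} (hb : Antitone b)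
    (hc : Antitone c) (hab : ∀ i, a i ≤ b i ∧ b i ≤ a i + 1) (hbc : ∀ i, b i ≤ c i ∧ c i ≤ b i + 1)
    (h : ∀ j, ((Finset.range n).filter fun i => b i < c i ∧ b i < j).card
      ≤ ((Finset.range n).filter fun i => a i < b i ∧ b i < j).card) : VLattice n a b c := by
  intro i
  have e1 : ∀ (x y : ℕ → ℕ), (∀ i, x i ≤ y i ∧ y i ≤ x i + 1) →
      ∑ j ∈ Finset.Ico i n, ((y j : ℤ) - x j)
        = (((Finset.range n).filter fun m => x m < y m ∧ i ≤ m).card : ℤ) := by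
    intro x y hxy
    have h1 : ∀ j ∈ Finset.Ico i n, ((y j : ℤ) - x j) = if x j < y j then 1 else 0 := by
      intro j _
      have := hxy j
      split_ifs <;> omega
    rw [Finset.sum_congr rfl h1, Finset.sum_boole]
    congr 2
    ext m
    simp only [Finset.mem_filter, Finset.mem_Ico, Finset.mem_range]
    tauto
  rw [e1 b c hbc, e1 a b hab, Nat.cast_le]
  by_cases hi : b i < c i
  · -- all rows above row `i` of the same length meet the second strip
    have h1 := h (b i + 1)
    have h2 : ((Finset.range n).filter fun m => b m < c m ∧ b m < b i + 1).card
        = ((Finset.range n).filter fun m => b m < c m ∧ i ≤ m).card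
          + ((Finset.range n).filter fun m => m < i ∧ b m = b i).card := by
      rw [← Finset.card_union_of_disjoint]
      · congr 1
        ext m
        simp only [Finset.mem_filter, Finset.mem_union, Finset.mem_range]
        have := hbc m
        rcases Nat.lt_or_ge m i with hm | hm
        · have := hb hm.le; have := hc hm.le
          omega
        · have := hb hm
          omega
      · rw [Finset.disjoint_filter]
        omega
    have h3 : ((Finset.range n).filter fun m => a m < b m ∧ b m < b i + 1).card
        ≤ ((Finset.range n).filter fun m => a m < b m ∧ i ≤ m).card
          + ((Finset.range n).filter fun m => m < i ∧ b m = b i).card := by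
      rw [← Finset.card_union_of_disjoint]
      · refine Finset.card_le_card fun m => ?_
        simp only [Finset.mem_filter, Finset.mem_union, Finset.mem_range]
        rcases Nat.lt_or_ge m i with hm | hm
        · have := hb hm.le
          omega
        · omega
      · rw [Finset.disjoint_filter]
        omega
    omega
  · -- no row below row `i` of the same length meets the second strip
    calc ((Finset.range n).filter fun m => b m < c m ∧ i ≤ m).card
        ≤ ((Finset.range n).filter fun m => b m < c m ∧ b m < b i).card := by
          refine Finset.card_le_card fun m => ?_
          simp only [Finset.mem_filter, Finset.mem_range]
          rintro ⟨h1, h2, h3⟩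
          have := hb h3; have := hc h3; have := hbc i
          omega
      _ ≤ _ := h (b i)
      _ ≤ _ := by
          refine Finset.card_le_card fun m => ?_
          simp only [Finset.mem_filter, Finset.mem_range]
          rintro ⟨h1, h2, h3⟩
          refine ⟨h1, h2, ?_⟩
          by_contra h4
          have := hb (not_le.1 h4).le
          omega

/-- With `N_k = levelSubmodule γ N k`, multiplication by `t` induces an injection from
`N_(k+2) / N_(k+1)` to `N_(k+1) / N_k` that maps the image of the kernel of `t ^ (j + 1)` into the
image of the kernel of `t ^ j`. This is the source of the Yamanouchi condition. -/
theorem finrank_levelSubmodule_add_le {n : ℕ} {γ : ℕ → ℕ} (hn : ∀ i, n ≤ i → γ i = 0)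
    {N : Submodule K (RowSeq K)} (hτ : ∀ x ∈ N, rowShift K x ∈ N) (k j : ℕ) :
    Module.finrank K (levelSubmodule γ N (k + 2) ⊓ LinearMap.ker (rowShift K ^ (j + 1)) :
        Submodule K (RowSeq K))
      + Module.finrank K (levelSubmodule γ N k ⊓ LinearMap.ker (rowShift K ^ j) :
        Submodule K (RowSeq K))
    ≤ Module.finrank K (levelSubmodule γ N (k + 1) ⊓ LinearMap.ker (rowShift K ^ (j + 1)) :
        Submodule K (RowSeq K))
      + Module.finrank K (levelSubmodule γ N (k + 1) ⊓ LinearMap.ker (rowShift K ^ j) :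
        Submodule K (RowSeq K)) := by
  have := finiteDimensional_boxModule (K := K) hn
  have hfin : ∀ k j, FiniteDimensional K
      (levelSubmodule γ N k ⊓ LinearMap.ker (rowShift K ^ j) : Submodule K (RowSeq K)) :=
    fun k j => Submodule.finiteDimensional_of_le (inf_le_left.trans inf_le_left)
  have hfin1 := hfin (k + 2) (j + 1)
  have hfin2 := hfin (k + 1) j
  have hle : levelSubmodule γ N k ≤ levelSubmodule γ N (k + 1) := fun x hx =>
    ⟨hx.1, by
      change (rowShift K ^ (k + 1)) x ∈ N
      rw [pow_succ']; exact hτ _ hx.2⟩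
  have h := finrank_add_le_of_map_le (rowShift K)
    (A := levelSubmodule γ N (k + 2) ⊓ LinearMap.ker (rowShift K ^ (j + 1)))
    (B := levelSubmodule γ N (k + 1) ⊓ LinearMap.ker (rowShift K ^ j))
    (C := levelSubmodule γ N k ⊓ LinearMap.ker (rowShift K ^ j))
    (inf_le_inf_right _ hle) (by
      rintro _ ⟨x, ⟨⟨hx1, hx2⟩, hx3⟩, rfl⟩
      refine ⟨⟨rowShift_pow_mem_boxModule 1 hx1, ?_⟩, ?_⟩
      · exact hx2
      · exact hx3)
  refine h.trans_eq (congrArg₂ _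
    (congrArg (fun P : Submodule K (RowSeq K) => Module.finrank K P) ?_) rfl)
  symm
  ext x
  constructor
  · rintro ⟨⟨hx1, hx2⟩, hx3⟩
    refine ⟨⟨⟨hx1, ?_⟩, hx3⟩, ⟨rowShift_pow_mem_boxModule 1 hx1, ?_⟩, ?_⟩
    · change (rowShift K ^ (k + 1 + 1)) x ∈ N
      rw [pow_succ']; exact hτ _ hx2
    · exact hx2
    · exact hx3
  · rintro ⟨⟨⟨hx1, -⟩, hx3⟩, ⟨-, hx2⟩, -⟩
    exact ⟨⟨hx1, hx2⟩, hx3⟩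

theorem HasType.of_support {n m : ℕ} {μ : ℕ → ℕ} (hn : ∀ i, n ≤ i → μ i = 0)
    (hm : ∀ i, m ≤ i → μ i = 0) {N : Submodule K (RowSeq K)} (h : HasType n μ N) :
    HasType m μ N := by
  intro j
  rw [h j]
  rcases le_total n m with hnm | hnm
  · exact Finset.sum_subset (Finset.range_mono hnm) fun i _ hi => by
      rw [hn i (by simpa using hi), zero_min]
  · exact (Finset.sum_subset (Finset.range_mono hnm) fun i _ hi => by
      rw [hm i (by simpa using hi), zero_min]).symm

theorem HasType.finrank_eq {n : ℕ} {γ μ : ℕ → ℕ} (hγ : Antitone γ) (hμ : ∀ i, μ i ≤ γ i)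
    {N : Submodule K (RowSeq K)} (hN : N ≤ boxModule K γ) (h : HasType n μ N) :
    Module.finrank K N = ∑ i ∈ Finset.range n, μ i := by
  have h1 := h (γ 0)
  rw [inf_eq_left.2] at h1
  · rw [h1]
    refine Finset.sum_congr rfl fun i _ => min_eq_left ((hμ i).trans (hγ (Nat.zero_le i)))
  · intro x hx
    rw [mem_ker_rowShift_pow]
    exact fun i m hm => hN hx i m ((hγ (Nat.zero_le i)).trans hm)

theorem IsStripChain.le_of_le {ε : ℕ → ℕ → ℕ} (hε : IsStripChain ε) {k l : ℕ} (h : k ≤ l) (i : ℕ) :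
    ε k i ≤ ε l i :=
  monotone_nat_of_le_succ (fun k => hε.le k i) h

/-- `N` is a submodule of `M_γ` of type `α` whose quotient is of type `β`: the kernel of `t ^ k` on
the quotient has dimension `β'_0 + ⋯ + β'_(k-1)`, where `β'` is the conjugate partition. -/
structure IsExtensionSubmodule (α β γ : YoungDiagram) (N : Submodule K (RowSeq K)) : Prop where
  le : N ≤ boxModule K γ.rowLen
  shift : ∀ x ∈ N, rowShift K x ∈ N
  sub : HasType (α.colLen 0) α.rowLen N
  quot : ∀ k, Module.finrank K (levelSubmodule γ.rowLen N k)
    = Module.finrank K N + ∑ j ∈ Finset.range k, β.colLen j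

theorem YoungDiagram.antitone_rowLen (μ : YoungDiagram) : Antitone μ.rowLen :=
  fun _ _ h => μ.rowLen_anti _ _ h

theorem IsExtensionSubmodule.exists_isVChain {α β γ : YoungDiagram} {N : Submodule K (RowSeq K)}
    (hN : IsExtensionSubmodule α β γ N) :
    ∃ (ε : ℕ → ℕ → ℕ) (g : ℕ → RowSeq K →ₗ[K] RowSeq K), IsVChain α β γ ε ∧
      (∀ k, HasType (γ.colLen 0) (ε k) (levelSubmodule γ.rowLen N k)) ∧
      (∀ k x, g k (rowShift K x) = rowShift K (g k x)) ∧
      (∀ k, ∀ x ∈ boxModule K (ε (k + 1)), g k x ∈ boxModule K (ε (k + 1))) ∧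
      N = (boxModule K (ε 0)).map (chainComp g (β.rowLen 0)) := by
  have hn : ∀ i, γ.colLen 0 ≤ i → γ.rowLen i = 0 := fun i => YoungDiagram.rowLen_eq_zero
  have hγ := γ.antitone_rowLen
  have hfd := finiteDimensional_boxModule (K := K) hn
  set r := β.rowLen 0 with hr
  have hlevel : ∀ k, levelSubmodule γ.rowLen N k ≤ boxModule K γ.rowLen := fun k => inf_le_left
  have hall : ∀ x ∈ boxModule K γ.rowLen, (rowShift K ^ r) x ∈ N := by
    -- the dimensions of the levels from `r` on agree, and the levels exhaust `M_γ`
    have h1 : levelSubmodule γ.rowLen N (r + γ.rowLen 0) = boxModule K γ.rowLen := by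
      refine le_antisymm inf_le_left fun x hx => ⟨hx, ?_⟩
      have : (rowShift K ^ (r + γ.rowLen 0)) x = 0 := by
        funext i j
        rw [rowShift_pow_apply, hx i _ (by have := hγ (Nat.zero_le i); omega)]
        rfl
      change (rowShift K ^ (r + γ.rowLen 0)) x ∈ N
      rw [this]; exact N.zero_mem
    have h2 : levelSubmodule γ.rowLen N r = boxModule K γ.rowLen := by
      refine Submodule.eq_of_le_of_finrank_eq inf_le_left ?_
      rw [← h1, hN.quot, hN.quot, Finset.sum_range_add]
      rw [Finset.sum_eq_zero (s := Finset.range (γ.rowLen 0)), add_zero]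
      intro j _
      exact YoungDiagram.colLen_eq_zero (by omega)
    intro x hx
    rw [← h2] at hx
    exact hx.2
  obtain ⟨ε, g, htop, hε, htype, hcomm, hpres, -, hNg⟩ := exists_chain hγ hn r hN.le hN.shift hall
  have hεγ : ∀ k i, ε k i ≤ γ.rowLen i := by
    intro k i
    have h1 := hε.le_of_le (Nat.le_add_left k r) i
    rwa [htop _ (Nat.le_add_right r k)] at h1
  have hεn : ∀ k i, γ.colLen 0 ≤ i → ε k i = 0 := fun k i hi =>
    Nat.le_zero.1 ((hεγ k i).trans_eq (hn i hi))
  have hdim : ∀ k, Module.finrank K (levelSubmodule γ.rowLen N k)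
      = ∑ i ∈ Finset.range (γ.colLen 0), ε k i := fun k =>
    (htype k).finrank_eq hγ (hεγ k) (hlevel k)
  refine ⟨ε, g, ⟨?_, fun k i => hε.anti k (Nat.le_succ i),
    fun k i => ⟨hε.le k i, hε.le_add_one k i⟩, fun k => ?_, htop, fun k => ?_⟩, htype, hcomm, hpres,
    hNg⟩
  · have h0 := htype 0
    rw [levelSubmodule_zero hN.le] at h0
    set m := max (γ.colLen 0) (α.colLen 0) with hm
    have hm1 : ∀ i, m ≤ i → ε 0 i = 0 := fun i hi => hεn 0 i (by omega)
    have hm2 : ∀ i, m ≤ i → α.rowLen i = 0 := fun i hi => YoungDiagram.rowLen_eq_zero (by omega)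
    exact HasType.unique (hε.anti 0) α.antitone_rowLen hm1 hm2 (h0.of_support (hεn 0) hm1)
      (hN.sub.of_support (fun i => YoungDiagram.rowLen_eq_zero) hm2)
  · have h1 := hN.quot k
    have h2 := hN.quot (k + 1)
    rw [Finset.sum_range_succ, ← add_assoc, ← h1, hdim, hdim] at h2
    rw [Finset.sum_sub_distrib]
    have h3 : ((∑ i ∈ Finset.range (γ.colLen 0), ε (k + 1) i : ℕ) : ℤ)
      = ((∑ i ∈ Finset.range (γ.colLen 0), ε k i + β.colLen k : ℕ) : ℤ) := congrArg _ h2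
    push_cast at h3
    linarith
  · refine vLattice_of_card_le (hε.anti (k + 1)) (hε.anti (k + 2))
      (fun i => ⟨hε.le k i, hε.le_add_one k i⟩)
      (fun i => ⟨hε.le (k + 1) i, hε.le_add_one (k + 1) i⟩) fun j => ?_
    cases j with
    | zero => simp
    | succ j =>
      have h1 := finrank_levelSubmodule_add_le hn hN.shift k j
      rw [htype, htype, htype, htype, ← Finset.sum_add_distrib, ← Finset.sum_add_distrib] at h1
      rw [Finset.card_filter, Finset.card_filter]
      have h2 : ∑ i ∈ Finset.range (γ.colLen 0),
          (min (ε (k + 2) i) (j + 1) + min (ε k i) j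
            + if ε k i < ε (k + 1) i ∧ ε (k + 1) i < j + 1 then 1 else 0)
          = ∑ i ∈ Finset.range (γ.colLen 0),
          (min (ε (k + 1) i) (j + 1) + min (ε (k + 1) i) j
            + if ε (k + 1) i < ε (k + 2) i ∧ ε (k + 1) i < j + 1 then 1 else 0) := by
        refine Finset.sum_congr rfl fun i _ => ?_
        have := hε.le k i; have := hε.le_add_one k i
        have e1 : ε (k + 1) i ≤ ε (k + 2) i := hε.le (k + 1) i
        have e2 : ε (k + 2) i ≤ ε (k + 1) i + 1 := hε.le_add_one (k + 1) i
        split_ifs <;> omega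
      rw [Finset.sum_add_distrib, Finset.sum_add_distrib (f := fun i =>
        min (ε (k + 1) i) (j + 1) + min (ε (k + 1) i) j)] at h2
      omega

end Extension

/-! ### Density of the standard parameters -/

section Density

variable {K : Type*} [Field K]

/-- The sequence with a single nonzero entry. -/
def unitSeq (K : Type*) [Field K] (i j : ℕ) : RowSeq K := Pi.single i (Pi.single j 1)

theorem unitSeq_apply (i j i' j' : ℕ) :
    unitSeq K i j i' j' = if i' = i ∧ j' = j then 1 else 0 := by
  unfold unitSeq
  by_cases h : i' = i
  · subst h; simp [Pi.single_apply]
  · simp [h]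

/-- An endomorphism of `M_b` acts on `M_b / t M_b` by a matrix. -/
theorem topCoord_map_eq_sum {n : ℕ} {b : ℕ → ℕ} (hn : ∀ i, n ≤ i → b i = 0)
    {g : RowSeq K →ₗ[K] RowSeq K} (hg : ∀ x, g (rowShift K x) = rowShift K (g x))
    (hgb : ∀ x ∈ boxModule K b, g x ∈ boxModule K b) {x : RowSeq K} (hx : x ∈ boxModule K b)
    {s : ℕ} (hs : 0 < b s) :
    topCoord K b (g x) s
      = ∑ i ∈ Finset.range n, topCoord K b (g (unitSeq K i (b i - 1))) s * topCoord K b x i := by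
  have hsum : ∑ i ∈ Finset.range n, topCoord K b x i • unitSeq K i (b i - 1) ∈ boxModule K b := by
    refine Submodule.sum_mem _ fun i _ => ?_
    rcases Nat.eq_zero_or_pos (b i) with h | h
    · rw [topCoord_apply, hx i _ (by omega), zero_smul]
      exact Submodule.zero_mem _
    · refine Submodule.smul_mem _ _ fun i' j hj => ?_
      rw [unitSeq_apply, if_neg]
      rintro ⟨rfl, rfl⟩
      omega
  have h1 : topCoord K b
      (x - ∑ i ∈ Finset.range n, topCoord K b x i • unitSeq K i (b i - 1)) = 0 := by
    funext i
    rw [map_sub, map_sum, Pi.sub_apply, Finset.sum_apply]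
    have : ∀ m ∈ Finset.range n, topCoord K b (topCoord K b x m • unitSeq K m (b m - 1)) i
        = if i = m then topCoord K b x i else 0 := by
      intro m _
      rw [map_smul, Pi.smul_apply, topCoord_apply b (unitSeq K m (b m - 1)), unitSeq_apply]
      by_cases h : i = m
      · subst h; simp
      · simp [h]
    rw [Finset.sum_congr rfl this, Finset.sum_ite_eq, Pi.zero_apply]
    split_ifs with h
    · exact sub_self _
    · rw [topCoord_apply, hx i _ (by rw [hn i (by simpa using h)]), sub_zero]
  obtain ⟨y, hy, hyx⟩ := exists_rowShift_eq (mem_boxModule_sub_one (Submodule.sub_mem _ hx hsum) h1)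
  have h2 : topCoord K b (g (rowShift K y)) s = 0 := by
    rw [hg, topCoord_apply, rowShift_apply, Nat.sub_add_cancel hs]
    exact hgb y hy s _ le_rfl
  rw [hyx, map_sub, map_sub, Pi.sub_apply, sub_eq_zero, map_sum, map_sum, Finset.sum_apply] at h2
  rw [h2]
  refine Finset.sum_congr rfl fun i _ => ?_
  rw [map_smul, map_smul, Pi.smul_apply, smul_eq_mul, mul_comm]

/-- An endomorphism maps generators of short rows into `t M_b` plus the span of the generators of
rows that are not longer. -/
theorem topCoord_map_unitSeq_eq_zero {b : ℕ → ℕ} {g : RowSeq K →ₗ[K] RowSeq K}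
    (hg : ∀ x, g (rowShift K x) = rowShift K (g x)) {i s : ℕ} (hi : 0 < b i) (his : b i < b s) :
    topCoord K b (g (unitSeq K i (b i - 1))) s = 0 := by
  have h1 : (rowShift K ^ b i) (unitSeq K i (b i - 1)) = 0 := by
    funext i' j
    rw [rowShift_pow_apply, unitSeq_apply, if_neg (by omega)]
    rfl
  have h2 := rowShift_pow_comm hg (b i) (unitSeq K i (b i - 1))
  rw [h1, map_zero] at h2
  have h3 := congrFun (congrFun h2 s) (b s - 1 - b i)
  rw [rowShift_pow_apply, show b s - 1 - b i + b i = b s - 1 by omega] at h3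
  exact h3.symm

/-- A generic endomorphism of `M_b` factors on `M_a` through one of the maps `stripMap`: this is the
big cell of the variety of submodules of `M_b` isomorphic to `M_a`. -/
theorem exists_stripMap_preserves {n : ℕ} {a b : ℕ → ℕ} (ha : Antitone a) (hb : Antitone b)
    (hab : ∀ i, a i ≤ b i ∧ b i ≤ a i + 1) (hn : ∀ i, n ≤ i → b i = 0)
    {g : RowSeq K →ₗ[K] RowSeq K} (hg : ∀ x, g (rowShift K x) = rowShift K (g x))
    (hgb : ∀ x ∈ boxModule K b, g x ∈ boxModule K b) :
    ∃ S : Finset K, ∀ z ∉ S, ∃ A : ℕ → ℕ → K, ∀ x ∈ boxModule K a,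
      stripMap a b (-A) (g x + z • x) ∈ boxModule K a := by
  classical
  let G : ℕ → ℕ → K := fun s i => topCoord K b (g (unitSeq K i (b i - 1))) s
  let J : ℕ → Finset ℕ := fun s => (Finset.range s).filter fun i => b i ≤ a i
  have hJ : ∀ s i, i ∈ J s ↔ i < s ∧ b i ≤ a i := fun s i => by simp [J]
  -- the scalars `z` for which `g + z` is generic are those that are not eigenvalues of the minors
  let M : (s : ℕ) → Matrix (J s) (J s) K := fun s => Matrix.of fun i' i => - G i' i
  refine ⟨(Finset.range n).biUnion fun s => (M s).charpoly.roots.toFinset, fun z hz => ?_⟩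
  let m : (s : ℕ) → Matrix (J s) (J s) K := fun s => Matrix.scalar _ z - M s
  have hdet : ∀ s < n, IsUnit (m s).det := by
    intro s hs
    rw [isUnit_iff_ne_zero, ← Matrix.eval_charpoly]
    intro h0
    refine hz (Finset.mem_biUnion.2 ⟨s, Finset.mem_range.2 hs, ?_⟩)
    rw [Multiset.mem_toFinset, Polynomial.mem_roots (Matrix.charpoly_monic _).ne_zero]
    exact h0
  have hm : ∀ s i' i, m s i' i = G i' i + if i' = i then z else 0 := by
    intro s i' i
    simp only [m, M, Matrix.sub_apply, Matrix.of_apply, Matrix.scalar_apply, Matrix.diagonal_apply]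
    ring
  let A : ℕ → ℕ → K := fun s i =>
    if h : i ∈ J s then Matrix.vecMul (fun i' : J s => G s i') (m s)⁻¹ ⟨i, h⟩ else 0
  have hA : ∀ s < n, ∀ i : J s, ∑ i' : J s, A s i' * m s i' i = G s i := by
    intro s hs i
    have h1 : Matrix.vecMul (fun i' : J s => A s i') (m s) = fun i' : J s => G s i' := by
      have : (fun i' : J s => A s i') = Matrix.vecMul (fun i' : J s => G s i') (m s)⁻¹ := by
        funext i'
        exact dif_pos i'.2
      rw [this, Matrix.vecMul_vecMul, Matrix.nonsing_inv_mul _ (hdet s hs), Matrix.vecMul_one]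
    exact congrFun h1 i
  refine ⟨A, fun x hx => ?_⟩
  have hxb : x ∈ boxModule K b := boxModule_mono (fun i => (hab i).1) hx
  set y := g x + z • x with hy
  have hyb : y ∈ boxModule K b := Submodule.add_mem _ (hgb x hxb) (Submodule.smul_mem _ z hxb)
  have htop : ∀ s, 0 < b s → topCoord K b y s
      = ∑ i ∈ Finset.range n, (G s i + if s = i then z else 0) * topCoord K b x i := by
    intro s hs
    rw [hy, map_add, Pi.add_apply, topCoord_map_eq_sum hn hg hgb hxb hs, map_smul, Pi.smul_apply]
    simp only [add_mul, Finset.sum_add_distrib, ite_mul, zero_mul]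
    rw [Finset.sum_ite_eq, if_pos, smul_eq_mul]
    rw [Finset.mem_range]
    by_contra hlt
    rw [hn s (by omega)] at hs
    omega
  intro s j hj
  rcases Nat.lt_or_ge j (b s) with hjb | hjb
  swap
  · exact stripMap_mem_boxModule _ hyb s j hjb
  have hs : a s < b s := by omega
  have hsn : s < n := by
    by_contra hlt
    rw [hn s (by omega)] at hjb
    omega
  obtain rfl : j = b s - 1 := by have := hab s; omega
  have h1 : stripMap a b (-A) y s (b s - 1)
      = topCoord K b y s - ∑ i' : J s, A s i' * topCoord K b y i' := by
    rw [stripMap_apply, sub_eq_add_neg, topCoord_apply, ← Finset.sum_neg_distrib]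
    congr 1
    rw [Finset.sum_coe_sort (J s) fun i' => -(A s i' * topCoord K b y i'), Finset.sum_filter]
    refine Finset.sum_congr rfl fun i hi => ?_
    have := hb (Finset.mem_range.1 hi).le
    by_cases h : b i ≤ a i
    · rw [if_pos ⟨hs, h⟩, if_pos h, show b s - 1 + (b i - b s) = b i - 1 by omega]
      simp [topCoord_apply]
    · rw [if_neg (fun h' => h h'.2), if_neg h]
  rw [h1, sub_eq_zero, htop s (by omega)]
  have h2 : ∀ i' : J s, A s i' * topCoord K b y i'
      = ∑ i ∈ Finset.range n, A s i' * (G i' i + if (i' : ℕ) = i then z else 0)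
        * topCoord K b x i := by
    intro i'
    have := hb ((hJ s _).1 i'.2).1.le
    rw [htop i' (by omega), Finset.mul_sum]
    exact Finset.sum_congr rfl fun i _ => (mul_assoc _ _ _).symm
  rw [Finset.sum_congr rfl fun i' _ => h2 i', Finset.sum_comm]
  refine Finset.sum_congr rfl fun i _ => ?_
  rw [← Finset.sum_mul]
  by_cases hiJ : i ∈ J s
  · congr 1
    have h3 := hA s hsn ⟨i, hiJ⟩
    rw [if_neg (fun h => by have := (hJ s i).1 hiJ; omega), add_zero, ← h3]
    refine Finset.sum_congr rfl fun i' _ => ?_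
    rw [hm]
    simp only [Subtype.ext_iff]
  · by_cases hxi : topCoord K b x i = 0
    · rw [hxi, mul_zero, mul_zero]
    have hi : b i ≤ a i ∧ 0 < b i := by
      constructor
      · by_contra h
        exact hxi (hx i _ (by omega))
      · by_contra h
        exact hxi (hxb i _ (by omega))
    have hbs : b i < b s := by
      have h3 : ¬ i < s := fun h => hiJ ((hJ s i).2 ⟨h, hi.1⟩)
      have := ha (not_lt.1 h3)
      have := hab s
      omega
    have hG : ∀ s', b s ≤ b s' → G s' i = 0 := fun s' hs' =>
      topCoord_map_unitSeq_eq_zero hg hi.2 (by omega)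
    rw [hG s le_rfl, if_neg (by rintro rfl; omega), zero_add, zero_mul, Finset.sum_eq_zero,
      zero_mul]
    intro i' _
    have := hb ((hJ s _).1 i'.2).1.le
    rw [hG i' this, if_neg, zero_add, mul_zero]
    intro h
    exact hiJ (h ▸ i'.2)

/-- Evaluation of polynomials in the entries of `d` sequences. -/
noncomputable def seqEval {d : ℕ} (v : Fin d → RowSeq K) :
    MvPolynomial (Fin d × ℕ × ℕ) K →ₐ[K] K :=
  MvPolynomial.aeval fun x => v x.1 x.2.1 x.2.2

theorem exists_seqEval_stripMap (d : ℕ) (a b : ℕ → ℕ) (A : ℕ → ℕ → K)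
    (f : MvPolynomial (Fin d × ℕ × ℕ) K) :
    ∃ f' : MvPolynomial (Fin d × ℕ × ℕ) K, ∀ v : Fin d → RowSeq K,
      seqEval v f' = seqEval (fun l => stripMap a b A (v l)) f := by
  refine ⟨MvPolynomial.aeval (fun x : Fin d × ℕ × ℕ => MvPolynomial.X (R := K) x
    + ∑ i ∈ Finset.range x.2.1, if a x.2.1 < b x.2.1 ∧ b i ≤ a i then
      MvPolynomial.C (A x.2.1 i) * MvPolynomial.X (x.1, i, x.2.2 + (b i - b x.2.1)) else 0) f,
    fun v => ?_⟩
  rw [← AlgHom.comp_apply]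
  refine DFunLike.congr_fun (MvPolynomial.algHom_ext fun x => ?_) f
  rw [AlgHom.comp_apply, MvPolynomial.aeval_X]
  simp only [seqEval, MvPolynomial.aeval_X, stripMap_apply, map_add, map_sum]
  congr 1
  refine Finset.sum_congr rfl fun i _ => ?_
  split_ifs <;> simp

/-- A polynomial that vanishes on all `d`-tuples of elements of the submodules `stripImage ε A r`,
vanishes on the `d`-tuples that arise from arbitrary chains of endomorphisms. -/
theorem seqEval_chainComp_eq_zero [Infinite K] {d n : ℕ} {ε : ℕ → ℕ → ℕ} (hε : IsStripChain ε)
    (hn : ∀ k i, n ≤ i → ε k i = 0) {g : ℕ → RowSeq K →ₗ[K] RowSeq K}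
    (hcomm : ∀ k x, g k (rowShift K x) = rowShift K (g k x))
    (hpres : ∀ k, ∀ x ∈ boxModule K (ε (k + 1)), g k x ∈ boxModule K (ε (k + 1))) (r : ℕ)
    (f : MvPolynomial (Fin d × ℕ × ℕ) K)
    (hf : ∀ (A : ℕ → ℕ → ℕ → K) (h : Fin d → RowSeq K), (∀ l, h l ∈ boxModule K (ε 0)) →
      seqEval (fun l => stripComp ε A 0 r (h l)) f = 0)
    {h : Fin d → RowSeq K} (hh : ∀ l, h l ∈ boxModule K (ε 0)) :
    seqEval (fun l => chainComp g r (h l)) f = 0 := by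
  suffices H : ∀ q : RowSeq K →ₗ[K] RowSeq K, (∀ x, q (rowShift K x) = rowShift K (q x)) →
      (∀ x ∈ boxModule K (ε r), q x ∈ boxModule K (ε r)) →
      seqEval (fun l => q (chainComp g r (h l))) f = 0 from
    H LinearMap.id (fun _ => rfl) (fun _ h => h)
  induction r generalizing f with
  | zero =>
    intro q _ hq
    exact hf 0 (fun l => q (h l)) fun l => hq _ (hh l)
  | succ r ih =>
    intro q hqc hq
    let w : Fin d → RowSeq K := fun l => chainComp g r (h l)
    let G : RowSeq K →ₗ[K] RowSeq K := q ∘ₗ g r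
    have hG : ∀ x, G (rowShift K x) = rowShift K (G x) := fun x => by
      simp only [G, LinearMap.comp_apply, hcomm, hqc]
    have hGb : ∀ x ∈ boxModule K (ε (r + 1)), G x ∈ boxModule K (ε (r + 1)) :=
      fun x hx => hq _ (hpres r x hx)
    obtain ⟨S, hS⟩ := exists_stripMap_preserves (hε.anti r) (hε.anti (r + 1))
      (fun i => ⟨hε.le r i, hε.le_add_one r i⟩) (hn (r + 1)) hG hGb
    -- deform the endomorphism `G` to the generic endomorphism `G + z`
    let F : K[X] := MvPolynomial.aeval (fun x : Fin d × ℕ × ℕ =>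
      Polynomial.C (G (w x.1) x.2.1 x.2.2) + Polynomial.X * Polynomial.C (w x.1 x.2.1 x.2.2)) f
    have hF : ∀ z, F.eval z = seqEval (fun l => G (w l) + z • w l) f := by
      intro z
      have : ((Polynomial.aeval z : K[X] →ₐ[K] K).comp (MvPolynomial.aeval (fun x : Fin d × ℕ × ℕ =>
          Polynomial.C (G (w x.1) x.2.1 x.2.2) + Polynomial.X * Polynomial.C (w x.1 x.2.1 x.2.2))))
          = seqEval (fun l => G (w l) + z • w l) := by
        refine MvPolynomial.algHom_ext fun x => ?_
        simp [seqEval]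
        exact mul_comm _ _
      rw [← this]
      simp [F]
    have hroot : ∀ z ∉ S, F.eval z = 0 := by
      intro z hz
      obtain ⟨A, hA⟩ := hS z hz
      let Q : RowSeq K →ₗ[K] RowSeq K := stripMap (ε r) (ε (r + 1)) (-A) ∘ₗ (G + z • LinearMap.id)
      obtain ⟨f', hf'⟩ := exists_seqEval_stripMap d (ε r) (ε (r + 1)) A f
      have h1 := ih f' (fun A' h' hh' => by
        rw [hf']
        have h2 := hf (fun k => if k = r then A else A' k) h' hh'
        rw [← h2]
        congr 1
        refine congrArg seqEval (funext fun l => ?_)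
        rw [stripComp_succ_apply, zero_add, if_pos rfl]
        rw [stripComp_congr (A := fun k => if k = r then A else A' k) (A' := A')
          fun k s i hk _ _ _ => by rw [if_neg (by omega)]]) Q (fun x => by
          simp only [Q, LinearMap.comp_apply, LinearMap.add_apply, hG, LinearMap.smul_apply,
            LinearMap.id_apply, rowShift_stripMap, map_add, map_smul]) (fun x hx => hA x hx)
      rw [hf'] at h1
      rw [hF, ← h1]
      refine congrArg (fun v => seqEval v f) (funext fun l => ?_)
      exact (stripMap_stripMap_neg _ _ A _).symm
    have hF0 : F = 0 := by
      refine Polynomial.eq_zero_of_infinite_isRoot F ?_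
      refine Set.Infinite.mono (s := (S : Set K)ᶜ) (fun z hz => hroot z hz) ?_
      exact S.finite_toSet.infinite_compl
    have h0 := hF 0
    rw [hF0, Polynomial.eval_zero] at h0
    rw [h0]
    refine congrArg (fun v => seqEval v f) (funext fun l => ?_)
    rw [zero_smul, add_zero]
    rfl

end Density

/-! ### Generic parameters -/

section Generic

theorem IsVChain.isStripChain {α β γ : YoungDiagram} {ε : ℕ → ℕ → ℕ} (h : IsVChain α β γ ε) :
    IsStripChain ε :=
  ⟨fun k => antitone_nat_of_succ_le (h.anti k), fun k i => (h.strip k i).1,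
    fun k i => (h.strip k i).2⟩

theorem IsVChain.le_rowLen {α β γ : YoungDiagram} {ε : ℕ → ℕ → ℕ} (h : IsVChain α β γ ε)
    (k i : ℕ) : ε k i ≤ γ.rowLen i := by
  have h1 := h.isStripChain.le_of_le (Nat.le_add_left k (β.rowLen 0)) i
  rwa [h.top _ (Nat.le_add_right _ k)] at h1

theorem IsVChain.eq_zero {α β γ : YoungDiagram} {ε : ℕ → ℕ → ℕ} (h : IsVChain α β γ ε)
    (k i : ℕ) (hi : γ.colLen 0 ≤ i) : ε k i = 0 :=
  Nat.le_zero.1 ((h.le_rowLen k i).trans_eq (YoungDiagram.rowLen_eq_zero hi))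

/-- The element of `M_a` with prescribed coordinates in the boxes of `a`, which are numbered
by `e`. -/
def boxVec {R : Type*} [CommRing R] {d n : ℕ} {a : ℕ → ℕ} (e : Fin d ≃ (i : Fin n) × Fin (a i)) :
    (Fin d → R) →ₗ[R] RowSeq R where
  toFun u i j := if h : i < n ∧ j < a i then u (e.symm ⟨⟨i, h.1⟩, ⟨j, h.2⟩⟩) else 0
  map_add' u v := by
    funext i j
    by_cases h : i < n ∧ j < a i <;> simp [h]
  map_smul' c u := by
    funext i j
    by_cases h : i < n ∧ j < a i <;> simp [h]

section BoxVec

variable {R : Type*} [CommRing R] {d n : ℕ} {a : ℕ → ℕ} (e : Fin d ≃ (i : Fin n) × Fin (a i))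

theorem boxVec_apply (u : Fin d → R) (c : (i : Fin n) × Fin (a i)) :
    boxVec e u c.1 c.2 = u (e.symm c) := dif_pos ⟨c.1.2, c.2.2⟩

theorem boxVec_mem (u : Fin d → R) : boxVec e u ∈ boxModule R a := fun i j hj =>
  dif_neg fun h => by omega

theorem boxVec_injective : Function.Injective (boxVec (R := R) e) := by
  intro u v h
  funext l
  have h1 := congrFun (congrFun h (e l).1) (e l).2
  rwa [boxVec_apply, boxVec_apply, e.symm_apply_apply] at h1

theorem range_boxVec (hn : ∀ i, n ≤ i → a i = 0) :
    LinearMap.range (boxVec (R := R) e) = boxModule R a := by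
  refine le_antisymm ?_ fun x hx => ?_
  · rintro _ ⟨u, rfl⟩
    exact boxVec_mem e u
  · refine ⟨fun l => x (e l).1 (e l).2, ?_⟩
    funext i j
    by_cases h : i < n ∧ j < a i
    · have h1 := boxVec_apply e (fun l => x (e l).1 (e l).2) ⟨⟨i, h.1⟩, ⟨j, h.2⟩⟩
      rw [e.apply_symm_apply] at h1
      exact h1
    · refine (dif_neg h).trans (hx i j ?_).symm
      by_contra hlt
      have := hn i
      omega

theorem map_boxVec {R' : Type*} [CommRing R'] (φ : R →+* R') (u : Fin d → R) :
    (boxVec e u).map φ = boxVec e fun l => φ (u l) := by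
  funext i j
  by_cases h : i < n ∧ j < a i
  · exact (congrArg φ (boxVec_apply e u ⟨⟨i, h.1⟩, ⟨j, h.2⟩⟩)).trans
      (boxVec_apply e (fun l => φ (u l)) ⟨⟨i, h.1⟩, ⟨j, h.2⟩⟩).symm
  · simp [RowSeq.map, boxVec, h]

theorem span_boxVec {L : Type*} [Field L] (hn : ∀ i, n ≤ i → a i = 0)
    {H : Matrix (Fin d) (Fin d) L} (hH : H.det ≠ 0) :
    Submodule.span L (Set.range fun l => boxVec e (H l)) = boxModule L a := by
  have h1 : Submodule.span L (Set.range fun l => H l) = ⊤ := by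
    refine LinearIndependent.span_eq_top_of_card_eq_finrank' ?_ (by simp)
    exact Matrix.linearIndependent_rows_of_det_ne_zero hH
  have h2 : (Set.range fun l => boxVec e (H l)) = boxVec e '' Set.range fun l => H l := by
    rw [← Set.range_comp]; rfl
  rw [h2, Submodule.span_image, h1, Submodule.map_top, range_boxVec e hn]

end BoxVec

/-- The coefficients on which `stripMap` along the first `r` strips of `ε` depends. -/
abbrev StripParam (ε : ℕ → ℕ → ℕ) (r n : ℕ) : Type :=
  {x : Fin r × Fin n × Fin n // x.2.2 < x.2.1 ∧ ε x.1 x.2.1 < ε (x.1 + 1) x.2.1 ∧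
    ε (x.1 + 1) x.2.2 ≤ ε x.1 x.2.2}

/-- The parameters of a submodule together with a tuple of `d` elements: the coefficients of the
maps `stripMap` and a square matrix. -/
abbrev FrameParam (ε : ℕ → ℕ → ℕ) (r n d : ℕ) : Type := StripParam ε r n ⊕ Fin d × Fin d

section ParamVec

variable {R : Type*} [CommRing R] {d n r : ℕ} {ε : ℕ → ℕ → ℕ}

/-- The coefficients of the maps `stripMap` that belong to the parameters `p`. -/
def stripCoeff (p : FrameParam ε r n d → R) (k s i : ℕ) : R :=
  if h : ∃ (_ : k < r) (_ : s < n) (_ : i < n),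
    i < s ∧ ε k s < ε (k + 1) s ∧ ε (k + 1) i ≤ ε k i then
    p (Sum.inl ⟨(⟨k, h.1⟩, ⟨s, h.2.1⟩, ⟨i, h.2.2.1⟩), h.2.2.2⟩)
  else 0

theorem stripCoeff_apply (p : FrameParam ε r n d → R) (x : StripParam ε r n) :
    stripCoeff p x.1.1 x.1.2.1 x.1.2.2 = p (Sum.inl x) := by
  rw [stripCoeff, dif_pos ⟨x.1.1.2, x.1.2.1.2, x.1.2.2.2, x.2⟩]

theorem map_stripCoeff {R' : Type*} [CommRing R'] (φ : R →+* R') (p : FrameParam ε r n d → R)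
    (k s i : ℕ) : φ (stripCoeff p k s i) = stripCoeff (fun x => φ (p x)) k s i := by
  unfold stripCoeff
  split_ifs
  · rfl
  · exact map_zero φ

/-- The tuple of vectors with parameters `p`. -/
def paramVec (e : Fin d ≃ (i : Fin n) × Fin (ε 0 i)) (p : FrameParam ε r n d → R) (l : Fin d) :
    RowSeq R :=
  stripComp ε (stripCoeff p) 0 r (boxVec e fun m => p (Sum.inr (l, m)))

theorem map_paramVec {R' : Type*} [CommRing R'] (φ : R →+* R')
    (e : Fin d ≃ (i : Fin n) × Fin (ε 0 i)) (p : FrameParam ε r n d → R) (l : Fin d) :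
    (paramVec e p l).map φ = paramVec e (fun x => φ (p x)) l := by
  simp only [paramVec, map_stripComp, map_boxVec, map_stripCoeff]

/-- The polynomial in the parameters that expresses their genericity. -/
noncomputable def genericDet (ρ : ℕ → ℕ → ℕ) (p : FrameParam ε r n d → R) : R :=
  (∏ k ∈ Finset.range (r - 1),
    (transverseMatrix n (ε k) (ε (k + 1)) (ε (k + 2)) (ρ k) (stripCoeff p k)).det)
  * (Matrix.of fun l m => p (Sum.inr (l, m))).det

theorem map_genericDet {R' : Type*} [CommRing R'] (φ : R →+* R') (ρ : ℕ → ℕ → ℕ)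
    (p : FrameParam ε r n d → R) :
    φ (genericDet ρ p) = genericDet ρ fun x => φ (p x) := by
  rw [genericDet, map_mul, map_prod, genericDet, RingHom.map_det]
  congr 1
  refine Finset.prod_congr rfl fun k _ => ?_
  rw [map_det_transverseMatrix]
  simp only [map_stripCoeff]

theorem exists_genericDet_eq_one (hn : ∀ k i, n ≤ i → ε k i = 0)
    {ρ : ℕ → ℕ → ℕ} (hρ : ∀ k, IsPivot (ε k) (ε (k + 1)) (ε (k + 2)) (ρ k)) :
    ∃ p : FrameParam ε r n d → R, genericDet ρ p = 1 := by
  classical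
  let p : FrameParam ε r n d → R := Sum.elim
    (fun x => if ε (x.1.1 + 1) x.1.2.2 < ε (x.1.1 + 2) x.1.2.2 ∧ ρ x.1.1 x.1.2.2 = x.1.2.1
      then -1 else 0) (fun x => if x.1 = x.2 then 1 else 0)
  refine ⟨p, ?_⟩
  have h1 : (Matrix.of fun l m => p (Sum.inr (l, m)) : Matrix (Fin d) (Fin d) R) = 1 := by
    ext l m
    simp [p, Matrix.one_apply]
  rw [genericDet, h1, Matrix.det_one, mul_one]
  refine Finset.prod_eq_one fun k hk => ?_
  refine (hρ k).det_transverseMatrix fun s s' hs hs1 hs' hlt => ?_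
  have hkr : k < r := by have := Finset.mem_range.1 hk; omega
  have hmem := (hρ k).mem s' hs'
  have hρn : ρ k s' < n := by
    by_contra h
    have := hn (k + 1) (ρ k s') (by omega)
    omega
  have h2 := stripCoeff_apply p ⟨(⟨k, hkr⟩, ⟨ρ k s', hρn⟩, ⟨s, by omega⟩), hlt, hmem, hs1⟩
  simp only at h2
  rw [h2]
  simp only [p, Sum.elim_inl]
  refine if_congr ⟨fun h => (hρ k).inj s s' h.1 hs' h.2, ?_⟩ rfl rfl
  rintro rfl
  exact ⟨hs, rfl⟩

variable {L : Type*} [Field L]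

theorem isTransverse_of_genericDet_ne_zero (hn : ∀ k i, n ≤ i → ε k i = 0)
    {ρ : ℕ → ℕ → ℕ} (hρ : ∀ k, IsPivot (ε k) (ε (k + 1)) (ε (k + 2)) (ρ k))
    {p : FrameParam ε r n d → L} (hp : genericDet ρ p ≠ 0) (k : ℕ) (hk : k + 2 ≤ r) :
    IsTransverse (ε k) (ε (k + 1)) (ε (k + 2)) (stripCoeff p k) :=
  isTransverse_of_det_ne_zero (hn (k + 2)) (hρ k)
    (Finset.prod_ne_zero_iff.1 (left_ne_zero_of_mul hp) k (Finset.mem_range.2 (by omega)))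

theorem span_paramVec (hn : ∀ k i, n ≤ i → ε k i = 0) {ρ : ℕ → ℕ → ℕ}
    (e : Fin d ≃ (i : Fin n) × Fin (ε 0 i)) {p : FrameParam ε r n d → L}
    (hp : genericDet ρ p ≠ 0) :
    Submodule.span L (Set.range (paramVec e p)) = stripImage ε (stripCoeff p) r := by
  have h1 := span_boxVec e (hn 0) (right_ne_zero_of_mul hp)
  rw [stripImage, ← h1, ← Submodule.span_image, ← Set.range_comp]
  rfl

theorem linearIndependent_paramVec {ρ : ℕ → ℕ → ℕ} (e : Fin d ≃ (i : Fin n) × Fin (ε 0 i))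
    {p : FrameParam ε r n d → L} (hp : genericDet ρ p ≠ 0) :
    LinearIndependent L (paramVec e p) := by
  have h1 := Matrix.linearIndependent_rows_of_det_ne_zero (right_ne_zero_of_mul hp)
  have h2 := h1.map' (stripComp ε (stripCoeff p) 0 r ∘ₗ boxVec e)
    (LinearMap.ker_eq_bot.2 ((stripComp_injective _ _ _ _).comp (boxVec_injective e)))
  exact h2

/-- Generic parameters are determined by the tuple of vectors. -/
theorem paramVec_injective_of_genericDet_ne_zero (hε : IsStripChain ε)
    (hn : ∀ k i, n ≤ i → ε k i = 0) {ρ : ℕ → ℕ → ℕ}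
    (hρ : ∀ k, IsPivot (ε k) (ε (k + 1)) (ε (k + 2)) (ρ k))
    (e : Fin d ≃ (i : Fin n) × Fin (ε 0 i)) {p p' : FrameParam ε r n d → L}
    (hp : genericDet ρ p ≠ 0) (hp' : genericDet ρ p' ≠ 0) (h : paramVec e p = paramVec e p') :
    p = p' := by
  have h1 : stripImage ε (stripCoeff p) r = stripImage ε (stripCoeff p') r := by
    rw [← span_paramVec hn e hp, h, span_paramVec hn e hp']
  have h2 : ∀ k s i, k < r → i < s → ε k s < ε (k + 1) s → ε (k + 1) i ≤ ε k i →
      stripCoeff p k s i = stripCoeff p' k s i := fun k s i hk his hs hi =>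
    hε.param_unique r (isTransverse_of_genericDet_ne_zero hn hρ hp') h1 hk his hs hi
  funext x
  rcases x with x | ⟨l, m⟩
  · rw [← stripCoeff_apply p, ← stripCoeff_apply p']
    exact h2 _ _ _ x.1.1.2 x.2.1 x.2.2.1 x.2.2.2
  · have h3 := congrFun h l
    rw [paramVec, paramVec, stripComp_congr h2] at h3
    exact congrFun (boxVec_injective e (stripComp_injective _ _ _ _ h3)) m

end ParamVec

section Chain

variable {K : Type*} [Field K] {α β γ : YoungDiagram} {ε : ℕ → ℕ → ℕ} {ρ : ℕ → ℕ → ℕ} {d : ℕ}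

theorem IsVChain.exists_isPivot (hε : IsVChain α β γ ε) :
    ∃ ρ : ℕ → ℕ → ℕ, ∀ k, IsPivot (ε k) (ε (k + 1)) (ε (k + 2)) (ρ k) := by
  choose ρ hρ using fun k => (hε.lattice k).exists_isPivot (hε.strip k) (hε.strip (k + 1))
    (hε.eq_zero (k + 2))
  exact ⟨ρ, hρ⟩

theorem IsVChain.hasType_levelSubmodule (hε : IsVChain α β γ ε) {A : ℕ → ℕ → ℕ → K}
    (hA : ∀ m, m + 2 ≤ β.rowLen 0 → IsTransverse (ε m) (ε (m + 1)) (ε (m + 2)) (A m)) (k : ℕ) :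
    HasType (γ.colLen 0) (ε k) (levelSubmodule γ.rowLen (stripImage ε A (β.rowLen 0)) k) := by
  set r := β.rowLen 0 with hr
  have hγ : ε r = γ.rowLen := hε.top r le_rfl
  rcases le_total k r with hk | hk
  · have h1 : levelSubmodule γ.rowLen (stripImage ε A r) k
        = (boxModule K (ε k)).map (stripComp ε A k (r - k)) := by
      ext x
      rw [← hε.isStripChain.mem_stripImage_iff k (r - k) (by rwa [Nat.add_sub_cancel' hk]),
        Nat.add_sub_cancel' hk, hγ, mem_levelSubmodule]
    rw [h1]
    refine hasType_map_boxModule (hε.eq_zero k) (fun x => ?_) (stripComp_injective _ _ _ _).injOn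
    have := rowShift_pow_stripComp ε A k (r - k) 1 x
    rw [pow_one] at this
    exact this.symm
  · have h1 : levelSubmodule γ.rowLen (stripImage ε A r) k = boxModule K γ.rowLen := by
      refine le_antisymm inf_le_left fun x hx => ⟨hx, ?_⟩
      have h2 := hε.isStripChain.rowShift_pow_mem_stripImage r (A := A) (hγ.symm ▸ hx)
      have h3 := rowShift_pow_mem_stripImage (k - r) h2
      rw [← Module.End.mul_apply, ← pow_add, Nat.sub_add_cancel hk] at h3
      exact h3
    rw [h1, hε.top k hk]
    have h2 := hasType_map_boxModule (K := K) (g := LinearMap.id) (n := γ.colLen 0) (μ := γ.rowLen)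
      (fun _ => YoungDiagram.rowLen_eq_zero) (fun _ => rfl) Function.injective_id.injOn
    rwa [Submodule.map_id] at h2

/-- A submodule whose levels have the types of a chain of strips is an extension. -/
theorem IsVChain.isExtensionSubmodule (hε : IsVChain α β γ ε) {N : Submodule K (RowSeq K)}
    (hle : N ≤ boxModule K γ.rowLen) (hτ : ∀ x ∈ N, rowShift K x ∈ N)
    (htype : ∀ k, HasType (γ.colLen 0) (ε k) (levelSubmodule γ.rowLen N k)) :
    IsExtensionSubmodule α β γ N := by
  have h0 := htype 0
  rw [levelSubmodule_zero hle] at h0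
  have hdim : ∀ k, Module.finrank K (levelSubmodule γ.rowLen N k)
      = ∑ i ∈ Finset.range (γ.colLen 0), ε k i := fun k =>
    (htype k).finrank_eq γ.antitone_rowLen (hε.le_rowLen k) inf_le_left
  refine ⟨hle, hτ, ?_, fun k => ?_⟩
  · rw [← hε.zero]
    refine h0.of_support (hε.eq_zero 0) fun i hi => ?_
    rw [hε.zero]
    exact YoungDiagram.rowLen_eq_zero hi
  · conv_rhs => rw [← levelSubmodule_zero hle]
    rw [hdim, hdim]
    induction k with
    | zero => simp
    | succ k ih =>
      rw [Finset.sum_range_succ, ← add_assoc, ← ih]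
      have h1 := hε.size k
      rw [Finset.sum_sub_distrib] at h1
      have h2 : ((∑ i ∈ Finset.range (γ.colLen 0), ε (k + 1) i : ℕ) : ℤ)
          = ((∑ i ∈ Finset.range (γ.colLen 0), ε k i + β.colLen k : ℕ) : ℤ) := by
        push_cast
        linarith
      exact_mod_cast h2

theorem IsVChain.stripImage_le (hε : IsVChain α β γ ε) (A : ℕ → ℕ → ℕ → K) :
    stripImage ε A (β.rowLen 0) ≤ boxModule K γ.rowLen := by
  rintro _ ⟨x, hx, rfl⟩
  have h1 := stripComp_mem_boxModule hε.isStripChain.le A 0 (β.rowLen 0) hx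
  rwa [zero_add, hε.top _ le_rfl] at h1

end Chain

section Algebraic

variable {k : Type} [Field k] {d n r : ℕ} {ε : ℕ → ℕ → ℕ}

/-- The polynomial map from the parameters to the entries of the vectors. -/
noncomputable def paramHom (k : Type) [Field k] (r : ℕ) (e : Fin d ≃ (i : Fin n) × Fin (ε 0 i)) :
    MvPolynomial (Fin d × ℕ × ℕ) k →ₐ[k] MvPolynomial (FrameParam ε r n d) k :=
  MvPolynomial.aeval fun x => paramVec e MvPolynomial.X x.1 x.2.1 x.2.2

theorem aeval_paramHom {S : Type*} [CommRing S] [Algebra k S]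
    (e : Fin d ≃ (i : Fin n) × Fin (ε 0 i)) (p : FrameParam ε r n d → S)
    (f : MvPolynomial (Fin d × ℕ × ℕ) k) :
    MvPolynomial.aeval p (paramHom k r e f)
      = MvPolynomial.aeval (fun x => paramVec e p x.1 x.2.1 x.2.2) f := by
  rw [← AlgHom.comp_apply]
  refine DFunLike.congr_fun (MvPolynomial.algHom_ext fun x => ?_) f
  rw [AlgHom.comp_apply, paramHom, MvPolynomial.aeval_X, MvPolynomial.aeval_X]
  have h1 := map_paramVec
    (MvPolynomial.aeval p : MvPolynomial (FrameParam ε r n d) k →ₐ[k] S).toRingHom e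
    MvPolynomial.X x.1
  have h2 := congrFun (congrFun h1 x.2.1) x.2.2
  refine h2.trans ?_
  congr
  funext y
  exact MvPolynomial.aeval_X p y

/-- The parameters are algebraic over the entries of the vectors, as generic parameters are
determined by these entries. -/
theorem isAlgebraic_paramHom (hε : IsStripChain ε) (hn : ∀ k i, n ≤ i → ε k i = 0)
    {ρ : ℕ → ℕ → ℕ} (hρ : ∀ k, IsPivot (ε k) (ε (k + 1)) (ε (k + 2)) (ρ k))
    (e : Fin d ≃ (i : Fin n) × Fin (ε 0 i)) :
    Algebra.IsAlgebraic (Algebra.adjoin k (Set.range fun i => paramHom k r e (MvPolynomial.X i)))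
      (MvPolynomial (FrameParam ε r n d) k) := by
  let B := MvPolynomial (FrameParam ε r n d) k
  have hmap : ∀ {S : Type} [CommRing S] [Algebra k S] (φ : B →ₐ[k] S),
      φ (genericDet ρ MvPolynomial.X) = genericDet ρ fun x => φ (MvPolynomial.X x) :=
    fun φ => map_genericDet φ.toRingHom ρ _
  refine isAlgebraic_adjoin_of_algHom_ext _ (q := genericDet ρ MvPolynomial.X) ?_
    fun φ φ' hφ hφ' h => ?_
  · intro h0
    obtain ⟨p, hp⟩ := exists_genericDet_eq_one (R := k) (d := d) (r := r) hn hρ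
    have h1 := hmap (MvPolynomial.aeval p)
    rw [h0, map_zero, show (fun x => MvPolynomial.aeval p (MvPolynomial.X (R := k) x)) = p from
      funext fun x => MvPolynomial.aeval_X p x, hp] at h1
    exact zero_ne_one h1
  · rw [hmap] at hφ hφ'
    have h1 : (fun x => φ (MvPolynomial.X x)) = fun x => φ' (MvPolynomial.X x) := by
      refine paramVec_injective_of_genericDet_ne_zero hε hn hρ e hφ hφ' ?_
      funext l s j
      have h2 := h (l, s, j)
      rw [paramHom, MvPolynomial.aeval_X] at h2
      have h3 := fun ψ : B →ₐ[k] AlgebraicClosure (FractionRing B) =>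
        congrFun (congrFun (map_paramVec ψ.toRingHom e MvPolynomial.X l) s) j
      exact (h3 φ).symm.trans (h2.trans (h3 φ'))
    exact MvPolynomial.algHom_ext fun x => congrFun h1 x

end Algebraic

end Generic

/-! ### The number of parameters -/

section Count

/-- The number of pairs `i < s` below `n` such that `s` has the property `p` and `i` has not. -/
theorem sum_pairs_eq (p : ℕ → Prop) [DecidablePred p] (n : ℕ) :
    2 * ∑ s ∈ Finset.range n, ∑ i ∈ Finset.range s, (if p s ∧ ¬ p i then (1 : ℤ) else 0)
      = 2 * ∑ s ∈ Finset.range n, (if p s then (s : ℤ) else 0)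
        + ∑ s ∈ Finset.range n, (if p s then (1 : ℤ) else 0)
        - (∑ s ∈ Finset.range n, if p s then (1 : ℤ) else 0) ^ 2 := by
  induction n with
  | zero => simp
  | succ n ih =>
    rw [Finset.sum_range_succ, Finset.sum_range_succ (fun s => if p s then (s : ℤ) else 0),
      Finset.sum_range_succ (fun s => if p s then (1 : ℤ) else 0), mul_add, ih]
    by_cases hp : p n
    · have h1 : ∑ i ∈ Finset.range n, (if p n ∧ ¬ p i then (1 : ℤ) else 0)
          = n - ∑ i ∈ Finset.range n, (if p i then (1 : ℤ) else 0) := by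
        rw [eq_sub_iff_add_eq, ← Finset.sum_add_distrib, Finset.sum_congr rfl (g := fun _ => 1)]
        · simp
        · intro i _
          by_cases h : p i <;> simp [hp, h]
      rw [h1, if_pos hp, if_pos hp]
      ring
    · simp [hp]

/-- The number of parameters does not depend on the chain of strips. -/
theorem IsVChain.card_frameParam {α β γ : YoungDiagram} {ε : ℕ → ℕ → ℕ} (hε : IsVChain α β γ ε)
    (d : ℕ) :
    2 * (Nat.card (FrameParam ε (β.rowLen 0) (γ.colLen 0) d) : ℤ)
      = 2 * (d * d + ∑ s ∈ Finset.range (γ.colLen 0), (s : ℤ) * (γ.rowLen s - α.rowLen s))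
        + ∑ k ∈ Finset.range (β.rowLen 0), ((β.colLen k : ℤ) - (β.colLen k : ℤ) ^ 2) := by
  classical
  set r := β.rowLen 0 with hr
  set n := γ.colLen 0 with hn
  have h1 : (Nat.card (StripParam ε r n) : ℤ) = ∑ k ∈ Finset.range r, ∑ s ∈ Finset.range n,
      ∑ i ∈ Finset.range s,
        (if ε k s < ε (k + 1) s ∧ ¬ ε k i < ε (k + 1) i then (1 : ℤ) else 0) := by
    rw [Nat.card_eq_fintype_card, Fintype.card_subtype, Finset.card_filter, Fintype.sum_prod_type,
      Finset.sum_range]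
    push_cast
    refine Finset.sum_congr rfl fun k _ => ?_
    rw [Fintype.sum_prod_type, Finset.sum_range]
    refine Finset.sum_congr rfl fun s _ => ?_
    refine (Finset.sum_range (n := n) fun i => if i < (s : ℕ) ∧ ε k s < ε (k + 1) s ∧
      ε (k + 1) i ≤ ε k i then (1 : ℤ) else 0).symm.trans ?_
    rw [← Finset.sum_subset (Finset.range_mono s.2.le : Finset.range s ⊆ Finset.range n)]
    · refine Finset.sum_congr rfl fun i hi => ?_
      simp only [Finset.mem_range.1 hi, true_and, not_lt]
    · intro i _ hi
      rw [if_neg]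
      intro h
      exact hi (Finset.mem_range.2 h.1)
  have hdiff : ∀ k s, (if ε k s < ε (k + 1) s then (1 : ℤ) else 0) = (ε (k + 1) s : ℤ) - ε k s := by
    intro k s
    have := hε.strip k s
    split_ifs <;> omega
  have hdiff' : ∀ k s, (if ε k s < ε (k + 1) s then (s : ℤ) else 0)
      = s * ((ε (k + 1) s : ℤ) - ε k s) := by
    intro k s
    rw [← hdiff]
    split_ifs <;> ring
  have hsize : ∀ k, ∑ i ∈ Finset.range n, ((ε (k + 1) i : ℤ) - ε k i) = β.colLen k := hε.size
  have h2 : 2 * (Nat.card (StripParam ε r n) : ℤ)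
      = 2 * ∑ s ∈ Finset.range n, (s : ℤ) * (γ.rowLen s - α.rowLen s)
        + ∑ k ∈ Finset.range r, ((β.colLen k : ℤ) - (β.colLen k : ℤ) ^ 2) := by
    rw [h1, Finset.mul_sum, Finset.sum_congr rfl fun k _ =>
      sum_pairs_eq (fun s => ε k s < ε (k + 1) s) n]
    simp only [hdiff, hdiff', hsize]
    simp only [add_sub_assoc]
    rw [Finset.sum_add_distrib, ← Finset.mul_sum, Finset.sum_comm]
    congr 2
    refine Finset.sum_congr rfl fun s _ => ?_
    rw [← Finset.mul_sum, Finset.sum_range_sub fun k => (ε k s : ℤ), hε.zero, hε.top r le_rfl]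
  rw [Nat.card_sum, Nat.card_prod, Nat.card_eq_fintype_card (α := Fin d), Fintype.card_fin]
  push_cast
  linarith

end Count

/-! ### Irreducible components -/

section Topology

/-- If a space is covered by finitely many irreducible subsets, none of which is contained in the
closure of another one, their closures are the irreducible components. -/
theorem irreducibleComponents_eq_range_closure {Y ι : Type*} [TopologicalSpace Y] [Finite ι]
    (Z : ι → Set Y) (hZ : ∀ i, IsIrreducible (Z i)) (hcover : ∀ y, ∃ i, y ∈ Z i)
    (hne : ∀ i j, Z i ⊆ closure (Z j) → i = j) :
    irreducibleComponents Y = Set.range fun i => closure (Z i) := by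
  have key : ∀ W : Set Y, IsIrreducible W → ∃ j, W ⊆ closure (Z j) := by
    intro W hW
    obtain ⟨t, ht, hWt⟩ := (isIrreducible_iff_sUnion_isClosed.1 hW)
      (Set.finite_range fun i => closure (Z i)).toFinset (by
        intro t ht
        obtain ⟨i, rfl⟩ := (Set.Finite.mem_toFinset _).1 ht
        exact isClosed_closure) (by
        intro y _
        obtain ⟨i, hi⟩ := hcover y
        refine Set.mem_sUnion.2 ⟨closure (Z i), ?_, subset_closure hi⟩
        simp)
    obtain ⟨j, rfl⟩ := (Set.Finite.mem_toFinset _).1 ht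
    exact ⟨j, hWt⟩
  ext W
  constructor
  · intro hW
    obtain ⟨j, hj⟩ := key W hW.1
    exact ⟨j, Set.Subset.antisymm (hW.2 (hZ j).closure hj) hj⟩
  · rintro ⟨i, rfl⟩
    refine ⟨(hZ i).closure, fun W hW hle => ?_⟩
    obtain ⟨j, hj⟩ := key W hW
    obtain rfl := hne i j (subset_closure.trans (hle.trans hj))
    exact hj

theorem encard_irreducibleComponents {Y ι : Type*} [TopologicalSpace Y] [Finite ι] {X : Set Y}
    (Z : ι → Set Y) (hX : X = ⋃ i, Z i) (hZ : ∀ i, IsIrreducible (Z i))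
    (hne : ∀ i j, Z i ⊆ closure (Z j) → i = j) :
    (irreducibleComponents X).encard = ENat.card ι := by
  have hsub : ∀ i, Z i ⊆ X := fun i => hX ▸ Set.subset_iUnion Z i
  let Z' : ι → Set X := fun i => Subtype.val ⁻¹' Z i
  have himg : ∀ i, Subtype.val '' Z' i = Z i := fun i => by
    rw [Subtype.image_preimage_coe, Set.inter_eq_right.2 (hsub i)]
  have hne' : ∀ i j, Z' i ⊆ closure (Z' j) → i = j := by
    intro i j h
    refine hne i j ?_
    rw [← himg i, ← himg j]
    refine (Set.image_mono h).trans ?_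
    exact image_closure_subset_closure_image continuous_subtype_val
  rw [irreducibleComponents_eq_range_closure Z' (fun i => ?_) (fun y => ?_) hne', ← Set.image_univ,
    Function.Injective.encard_image, Set.encard_univ]
  · intro i j h
    exact hne' i j (subset_closure.trans h.le)
  · refine ⟨?_, ?_⟩
    · obtain ⟨y, hy⟩ := (hZ i).1
      exact ⟨⟨y, hsub i hy⟩, hy⟩
    · rintro _ _ ⟨U, hU, rfl⟩ ⟨U', hU', rfl⟩ ⟨y, hy, hyU⟩ ⟨y', hy', hyU'⟩
      obtain ⟨x, hx, hxU⟩ := (hZ i).2 U U' hU hU' ⟨y, hy, hyU⟩ ⟨y', hy', hyU'⟩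
      exact ⟨⟨x, hsub i hx⟩, hx, hxU⟩
  · have h : ∀ x ∈ X, ∃ i, x ∈ Z i := fun x hx => Set.mem_iUnion.1 (hX ▸ hx)
    exact h y.1 y.2

/-! ### The Zariski topology of the Grassmannian -/

/-- The algebra of polynomial functions on a vector space. -/
def polyFun (W : Type*) [AddCommGroup W] [Module ℂ W] : Subalgebra ℂ (W → ℂ) :=
  Algebra.adjoin ℂ (Set.range fun φ : Module.Dual ℂ W => (φ : W → ℂ))

section PolyFun

variable {W W' : Type*} [AddCommGroup W] [Module ℂ W] [AddCommGroup W'] [Module ℂ W']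

theorem dual_mem_polyFun (φ : Module.Dual ℂ W) : (φ : W → ℂ) ∈ polyFun W :=
  Algebra.subset_adjoin ⟨φ, rfl⟩

theorem comp_mem_polyFun {p : W' → ℂ} (hp : p ∈ polyFun W') (f : W →ₗ[ℂ] W') :
    (fun w => p (f w)) ∈ polyFun W := by
  change p ∈ Algebra.adjoin ℂ (Set.range fun φ : Module.Dual ℂ W' => (φ : W' → ℂ)) at hp
  induction hp using Algebra.adjoin_induction with
  | mem p hp =>
    obtain ⟨φ, rfl⟩ := hp
    exact dual_mem_polyFun (φ ∘ₗ f)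
  | algebraMap c => exact (polyFun W).algebraMap_mem c
  | add p q _ _ hp hq => exact (polyFun W).add_mem hp hq
  | mul p q _ _ hp hq => exact (polyFun W).mul_mem hp hq

theorem det_mem_polyFun {m : Type*} [Fintype m] [DecidableEq m] {P : m → m → W → ℂ}
    (hP : ∀ i j, P i j ∈ polyFun W) :
    (fun w => (Matrix.of fun i j => P i j w).det) ∈ polyFun W := by
  have : (fun w => (Matrix.of fun i j => P i j w).det)
      = ∑ σ : Equiv.Perm m, (Equiv.Perm.sign σ : ℤ) • ∏ i, P (σ i) i := by
    funext w
    rw [Matrix.det_apply, Finset.sum_apply]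
    refine Finset.sum_congr rfl fun σ _ => ?_
    rw [Pi.smul_apply, Finset.prod_apply]
    rfl
  rw [this]
  exact sum_mem fun σ _ => zsmul_mem (prod_mem fun i _ => hP _ _) _

theorem isOpen_ne_zero {p : W → ℂ} (hp : p ∈ polyFun W) :
    @IsOpen W (zariskiTopology W) {w | p w ≠ 0} :=
  TopologicalSpace.isOpen_generateFrom_of_mem ⟨p, hp, rfl⟩

/-- The sets `{p ≠ 0}` form a basis of the Zariski topology. -/
theorem exists_polyFun_of_isOpen {U : Set W} (hU : @IsOpen W (zariskiTopology W) U) {w : W}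
    (hw : w ∈ U) : ∃ p ∈ polyFun W, p w ≠ 0 ∧ ∀ w', p w' ≠ 0 → w' ∈ U := by
  change TopologicalSpace.GenerateOpen _ U at hU
  induction hU with
  | basic U hU =>
    obtain ⟨p, hp, rfl⟩ := hU
    exact ⟨p, hp, hw, fun _ h => h⟩
  | univ => exact ⟨1, (polyFun W).one_mem, one_ne_zero, fun _ _ => Set.mem_univ _⟩
  | inter U U' _ _ ih ih' =>
    obtain ⟨p, hp, hpw, hpU⟩ := ih hw.1
    obtain ⟨q, hq, hqw, hqU⟩ := ih' hw.2
    refine ⟨p * q, (polyFun W).mul_mem hp hq, mul_ne_zero hpw hqw, fun w' h => ?_⟩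
    exact ⟨hpU w' (left_ne_zero_of_mul h), hqU w' (right_ne_zero_of_mul h)⟩
  | sUnion S _ ih =>
    obtain ⟨U, hU, hwU⟩ := hw
    obtain ⟨p, hp, hpw, hpU⟩ := ih U hU hwU
    exact ⟨p, hp, hpw, fun w' h => ⟨U, hU, hpU w' h⟩⟩

end PolyFun

section Grassmannian

variable {V : Type*} [AddCommGroup V] [Module ℂ V] {d : ℕ}

theorem Frame.continuous_span : Continuous (Frame.span : Frame d V → SubspaceGrassmannian d V) :=
  continuous_coinduced_rng

theorem Frame.exists_span_eq [FiniteDimensional ℂ V] (L : SubspaceGrassmannian d V) :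
    ∃ v : Frame d V, v.span = L := by
  obtain ⟨L, hL⟩ := L
  let b := Module.finBasisOfFinrankEq ℂ L hL
  refine ⟨⟨fun l => (b l : V), b.linearIndependent.map' L.subtype (Submodule.ker_subtype L)⟩, ?_⟩
  refine Subtype.ext ?_
  change Submodule.span ℂ (Set.range fun l => (b l : V)) = L
  have : (Set.range fun l => (b l : V)) = L.subtype '' Set.range b := by
    rw [← Set.range_comp]; rfl
  rw [this, Submodule.span_image, b.span_eq, Submodule.map_top, Submodule.range_subtype]

/-- The function `p` vanishes at all bases of the elements of `X`. -/
def VanishesOn (p : (Fin d → V) → ℂ) (X : Set (SubspaceGrassmannian d V)) : Prop :=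
  ∀ v : Frame d V, v.span ∈ X → p v.1 = 0

/-- A set of subspaces is irreducible if its ideal in the ring of polynomials on tuples is prime. -/
theorem isPreirreducible_of_vanishesOn [FiniteDimensional ℂ V] {X : Set (SubspaceGrassmannian d V)}
    (h : ∀ p ∈ polyFun (Fin d → V), ∀ q ∈ polyFun (Fin d → V), VanishesOn (p * q) X →
      VanishesOn p X ∨ VanishesOn q X) : IsPreirreducible X := by
  have key : ∀ U : Set (SubspaceGrassmannian d V), IsOpen U → (X ∩ U).Nonempty →
      ∃ p ∈ polyFun (Fin d → V), ¬ VanishesOn p X ∧ ∀ v : Frame d V, p v.1 ≠ 0 → v.span ∈ U := by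
    rintro U hU ⟨L, hLX, hLU⟩
    obtain ⟨v, rfl⟩ := Frame.exists_span_eq L
    obtain ⟨U', hU', hUU'⟩ := hU.preimage Frame.continuous_span
    have hv : v.1 ∈ U' := by
      have : v ∈ Subtype.val ⁻¹' U' := hUU' ▸ hLU
      exact this
    obtain ⟨p, hp, hpv, hpU⟩ := exists_polyFun_of_isOpen hU' hv
    refine ⟨p, hp, fun h0 => hpv (h0 v hLX), fun w hw => ?_⟩
    have : w ∈ Frame.span ⁻¹' U := hUU' ▸ hpU w.1 hw
    exact this
  intro U U' hU hU' hXU hXU'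
  obtain ⟨p, hp, hpX, hpU⟩ := key U hU hXU
  obtain ⟨q, hq, hqX, hqU⟩ := key U' hU' hXU'
  have h1 : ¬ VanishesOn (p * q) X := fun h0 => (h p hp q hq h0).elim hpX hqX
  simp only [VanishesOn, not_forall] at h1
  obtain ⟨v, hv, hpq⟩ := h1
  exact ⟨v.span, hv, hpU v (left_ne_zero_of_mul hpq), hqU v (right_ne_zero_of_mul hpq)⟩

/-- The base change of tuples by a matrix. -/
def tupleMap (V : Type*) [AddCommGroup V] [Module ℂ V] (g : Matrix (Fin d) (Fin d) ℂ) :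
    (Fin d → V) →ₗ[ℂ] (Fin d → V) where
  toFun v l := ∑ m, g l m • v m
  map_add' v w := by
    funext l
    simp [smul_add, Finset.sum_add_distrib]
  map_smul' c v := by
    funext l
    simp only [Pi.smul_apply, RingHom.id_apply, Finset.smul_sum]
    exact Finset.sum_congr rfl fun m _ => smul_comm _ _ _

theorem tupleMap_tupleMap (g h : Matrix (Fin d) (Fin d) ℂ) (v : Fin d → V) :
    tupleMap V g (tupleMap V h v) = tupleMap V (g * h) v := by
  funext l
  simp only [tupleMap, LinearMap.coe_mk, AddHom.coe_mk, Finset.smul_sum, smul_smul,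
    Matrix.mul_apply, Finset.sum_smul]
  exact Finset.sum_comm

theorem tupleMap_injective {v : Fin d → V} (hv : LinearIndependent ℂ v)
    {g h : Matrix (Fin d) (Fin d) ℂ} (hgh : tupleMap V g v = tupleMap V h v) : g = h := by
  ext l m
  have h1 := congrFun hgh l
  have h2 : ∑ m, (g l m - h l m) • v m = 0 := by
    simp only [sub_smul, Finset.sum_sub_distrib]
    exact sub_eq_zero.2 h1
  exact sub_eq_zero.1 (Fintype.linearIndependent_iff.1 hv _ h2 m)

theorem exists_tupleMap_eq {v w : Fin d → V} (h : ∀ l, w l ∈ Submodule.span ℂ (Set.range v)) :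
    ∃ g, w = tupleMap V g v := by
  choose c hc using fun l => (Submodule.mem_span_range_iff_exists_fun ℂ).1 (h l)
  exact ⟨c, funext fun l => (hc l).symm⟩

theorem exists_unit_tupleMap_eq {v w : Frame d V} (h : v.span = w.span) :
    ∃ g : Matrix (Fin d) (Fin d) ℂ, IsUnit g ∧ w.1 = tupleMap V g v.1 := by
  have hspan : Submodule.span ℂ (Set.range v.1) = Submodule.span ℂ (Set.range w.1) :=
    congrArg Subtype.val h
  obtain ⟨g, hg⟩ := exists_tupleMap_eq (v := v.1) (w := w.1) fun l => by
    rw [hspan]; exact Submodule.subset_span ⟨l, rfl⟩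
  obtain ⟨g', hg'⟩ := exists_tupleMap_eq (v := w.1) (w := v.1) fun l => by
    rw [← hspan]; exact Submodule.subset_span ⟨l, rfl⟩
  refine ⟨g, ?_, hg⟩
  have h1 : g' * g = 1 := by
    refine tupleMap_injective v.2 ?_
    rw [← tupleMap_tupleMap, ← hg, ← hg']
    funext l
    simp [tupleMap, Matrix.one_apply]
  exact IsUnit.of_mul_eq_one g' (mul_eq_one_comm.1 h1)

/-- Another frame of the same subspace. -/
theorem exists_frame_tupleMap [FiniteDimensional ℂ V] (v : Frame d V)
    {g : Matrix (Fin d) (Fin d) ℂ} (hg : IsUnit g) :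
    ∃ w : Frame d V, w.1 = tupleMap V g v.1 ∧ w.span = v.span := by
  have hli : LinearIndependent ℂ (tupleMap V g v.1) := by
    rw [Fintype.linearIndependent_iff]
    intro c hc
    have h1 : ∑ m, (Matrix.vecMul c g) m • v.1 m = 0 := by
      rw [← hc]
      simp only [tupleMap, LinearMap.coe_mk, AddHom.coe_mk, Finset.smul_sum, smul_smul,
        Matrix.vecMul, dotProduct, Finset.sum_smul]
      exact Finset.sum_comm
    have h2 : Matrix.vecMul c g = 0 := funext (Fintype.linearIndependent_iff.1 v.2 _ h1)
    have h3 := Matrix.vecMul_injective_of_isUnit hg (h2.trans (Matrix.zero_vecMul g).symm)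
    exact congrFun h3
  refine ⟨⟨_, hli⟩, rfl, Subtype.ext ?_⟩
  refine Submodule.eq_of_le_of_finrank_eq ?_ ?_
  · refine Submodule.span_le.2 ?_
    rintro _ ⟨l, rfl⟩
    have h1 : ∀ m, v.1 m ∈ Submodule.span ℂ (Set.range v.1) := fun m =>
      Submodule.subset_span (Set.mem_range_self m)
    change ∑ m, g l m • v.1 m ∈ Submodule.span ℂ (Set.range v.1)
    exact Submodule.sum_mem _ fun m _ => Submodule.smul_mem _ _ (h1 m)
  · change Module.finrank ℂ (Submodule.span ℂ (Set.range (tupleMap V g v.1)))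
      = Module.finrank ℂ (Submodule.span ℂ (Set.range v.1))
    rw [finrank_span_eq_card hli, finrank_span_eq_card v.2]

/-- The quotient map from the frames to the Grassmannian is open. -/
theorem isOpen_image_span [FiniteDimensional ℂ V] {p : (Fin d → V) → ℂ}
    (hp : p ∈ polyFun (Fin d → V)) :
    IsOpen (Frame.span '' {v : Frame d V | p v.1 ≠ 0}) := by
  rw [isOpen_coinduced]
  have : Frame.span ⁻¹' (Frame.span '' {v : Frame d V | p v.1 ≠ 0})
      = Subtype.val ⁻¹' (⋃ g : {g : Matrix (Fin d) (Fin d) ℂ // IsUnit g},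
        {v | p (tupleMap V g.1 v) ≠ 0}) := by
    ext w
    constructor
    · rintro ⟨v, hv, hvw⟩
      obtain ⟨g, hg, hgv⟩ := exists_unit_tupleMap_eq hvw.symm
      exact Set.mem_iUnion.2 ⟨⟨g, hg⟩, fun h => hv (by rw [hgv]; exact h)⟩
    · intro h
      obtain ⟨⟨g, hg⟩, hgv⟩ := Set.mem_iUnion.1 h
      obtain ⟨v, hv, hvw⟩ := exists_frame_tupleMap w hg
      exact ⟨v, fun h => hgv (by rw [← hv]; exact h), hvw⟩
  rw [this]
  refine isOpen_induced (t := zariskiTopology (Fin d → V)) ?_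
  exact @isOpen_iUnion _ _ (zariskiTopology (Fin d → V)) _ fun g =>
    isOpen_ne_zero (comp_mem_polyFun hp (tupleMap V g.1))

theorem vanishesOn_of_subset_closure [FiniteDimensional ℂ V]
    {X Y : Set (SubspaceGrassmannian d V)} (h : Y ⊆ closure X)
    {p : (Fin d → V) → ℂ} (hp : p ∈ polyFun (Fin d → V)) (hX : VanishesOn p X) :
    VanishesOn p Y := by
  intro v hv
  by_contra hne
  obtain ⟨_, ⟨w, hw, rfl⟩, hwX⟩ := mem_closure_iff.1 (h hv) _ (isOpen_image_span hp) ⟨v, hne, rfl⟩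
  exact hw (hX w hwX)

/-- The dimension of the intersection with a fixed subspace is upper semicontinuous. -/
theorem exists_polyFun_finrank_inf_le [FiniteDimensional ℂ V] (U : Submodule ℂ V) (v : Frame d V) :
    ∃ p ∈ polyFun (Fin d → V), p v.1 ≠ 0 ∧ ∀ w : Frame d V, p w.1 ≠ 0 →
      Module.finrank ℂ (w.span.1 ⊓ U : Submodule ℂ V)
        ≤ Module.finrank ℂ (v.span.1 ⊓ U : Submodule ℂ V) := by
  classical
  have hdim : ∀ w : Frame d V, d = Module.finrank ℂ (w.span.1.map U.mkQ)
      + Module.finrank ℂ (w.span.1 ⊓ U : Submodule ℂ V) := by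
    intro w
    have h1 := finrank_eq_map_add_inf_ker U.mkQ w.span.1
    rw [Submodule.ker_mkQ, w.span.2] at h1
    exact h1
  have hmap : ∀ w : Frame d V, w.span.1.map U.mkQ
      = Submodule.span ℂ (Set.range fun l => U.mkQ (w.1 l)) := by
    intro w
    rw [Frame.span, Submodule.map_span, ← Set.range_comp]
    rfl
  obtain ⟨κ, a, ha, hspan, hli⟩ := exists_linearIndependent' ℂ fun l => U.mkQ (v.1 l)
  have : Finite κ := Finite.of_injective a ha
  have := Fintype.ofFinite κ
  -- linear forms dual to the linearly independent vectors
  obtain ⟨φ, hφ⟩ : ∃ φ : κ → Module.Dual ℂ (V ⧸ U), ∀ i j,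
      φ i (U.mkQ (v.1 (a j))) = if i = j then 1 else 0 := by
    obtain ⟨f, hf⟩ := LinearMap.exists_leftInverse_of_injective
      (Fintype.linearCombination ℂ fun j => U.mkQ (v.1 (a j)))
      (LinearMap.ker_eq_bot.2 hli.fintypeLinearCombination_injective)
    refine ⟨fun i => LinearMap.proj i ∘ₗ f, fun i j => ?_⟩
    have h1 := DFunLike.congr_fun hf (Pi.single j 1)
    rw [LinearMap.comp_apply, Fintype.linearCombination_apply_single, one_smul] at h1
    rw [LinearMap.comp_apply, h1]
    simp [Pi.single_apply]
  let p : (Fin d → V) → ℂ := fun w => (Matrix.of fun i j => φ i (U.mkQ (w (a j)))).det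
  have hp : p ∈ polyFun (Fin d → V) := det_mem_polyFun fun i j =>
    dual_mem_polyFun (W := Fin d → V) (φ i ∘ₗ U.mkQ ∘ₗ LinearMap.proj (a j))
  refine ⟨p, hp, ?_, fun w hw => ?_⟩
  · have : (Matrix.of fun i j => φ i (U.mkQ (v.1 (a j)))) = (1 : Matrix κ κ ℂ) := by
      ext i j
      rw [Matrix.of_apply, hφ, Matrix.one_apply]
    simp only [p, this, Matrix.det_one]
    exact one_ne_zero
  · have hli' : LinearIndependent ℂ fun j => U.mkQ (w.1 (a j)) := by
      rw [Fintype.linearIndependent_iff]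
      intro c hc
      have h1 : Matrix.mulVec (Matrix.of fun i j => φ i (U.mkQ (w.1 (a j)))) c = 0 := by
        funext i
        have h2 := congrArg (φ i) hc
        rw [map_sum, map_zero] at h2
        rw [Matrix.mulVec, dotProduct, Pi.zero_apply, ← h2]
        refine Finset.sum_congr rfl fun j _ => ?_
        rw [map_smul, smul_eq_mul, mul_comm, Matrix.of_apply]
      exact congrFun (Matrix.eq_zero_of_mulVec_eq_zero hw h1)
    have h1 : Module.finrank ℂ (v.span.1.map U.mkQ) = Fintype.card κ := by
      rw [hmap, ← hspan]
      exact finrank_span_eq_card hli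
    have h2 : Fintype.card κ ≤ Module.finrank ℂ (w.span.1.map U.mkQ) := by
      rw [← finrank_span_eq_card hli', hmap]
      refine Submodule.finrank_mono (Submodule.span_mono ?_)
      rintro _ ⟨j, rfl⟩
      exact ⟨a j, rfl⟩
    have h3 := hdim v
    have h4 := hdim w
    omega

end Grassmannian

end Topology

/-! ### The strata of the variety of extensions -/

section Strata

theorem YoungDiagram.card_eq_sum_rowLen {μ : YoungDiagram} {n : ℕ} (hn : μ.colLen 0 ≤ n) :
    μ.card = ∑ i ∈ Finset.range n, μ.rowLen i := by
  rw [YoungDiagram.card, Finset.card_eq_sum_card_fiberwise (f := Prod.fst) (t := Finset.range n)]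
  · refine Finset.sum_congr rfl fun i _ => ?_
    rw [YoungDiagram.rowLen_eq_card]
    rfl
  · rintro ⟨i, j⟩ hij
    have h1 : (i, 0) ∈ μ := μ.up_left_mem le_rfl (Nat.zero_le j) hij
    have h2 := YoungDiagram.mem_iff_lt_colLen.1 h1
    exact Finset.mem_coe.2 (Finset.mem_range.2 (by simpa using h2.trans_le hn))

variable {V : Type} [AddCommGroup V] [Module ℂ V] {d n : ℕ} {γ : ℕ → ℕ}
  {emb : V →ₗ[ℂ] RowSeq ℂ}

theorem exists_seqEval_of_dual (hn : ∀ i, n ≤ i → γ i = 0) (hinj : Function.Injective emb)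
    (hrange : LinearMap.range emb = boxModule ℂ γ) (φ : Module.Dual ℂ (Fin d → V)) :
    ∃ f : MvPolynomial (Fin d × ℕ × ℕ) ℂ, ∀ v, φ v = seqEval (fun l => emb (v l)) f := by
  have hu : ∀ i j, ∃ u : V, j < γ i → emb u = unitSeq ℂ i j := by
    intro i j
    by_cases hj : j < γ i
    · have : unitSeq ℂ i j ∈ LinearMap.range emb := by
        rw [hrange]
        intro i' j' hj'
        rw [unitSeq_apply, if_neg]
        rintro ⟨rfl, rfl⟩
        omega
      obtain ⟨u, hu⟩ := this
      exact ⟨u, fun _ => hu⟩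
    · exact ⟨0, fun h => absurd h hj⟩
  choose u hu using hu
  have hx : ∀ x : V, x = ∑ i ∈ Finset.range n, ∑ j ∈ Finset.range (γ i), emb x i j • u i j := by
    intro x
    refine hinj ?_
    have h1 : ∀ i ∈ Finset.range n, emb (∑ j ∈ Finset.range (γ i), emb x i j • u i j)
        = ∑ j ∈ Finset.range (γ i), emb x i j • unitSeq ℂ i j := by
      intro i _
      rw [map_sum]
      refine Finset.sum_congr rfl fun j hj => ?_
      rw [map_smul, hu i j (Finset.mem_range.1 hj)]
    rw [map_sum, Finset.sum_congr rfl h1]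
    funext i' j'
    simp only [Finset.sum_apply, Pi.smul_apply, unitSeq_apply, smul_eq_mul, mul_ite, mul_one,
      mul_zero]
    have hxm : emb x ∈ boxModule ℂ γ := hrange ▸ LinearMap.mem_range_self emb x
    rcases Nat.lt_or_ge j' (γ i') with hj | hj
    · have hi : i' < n := by
        by_contra hlt
        rw [hn i' (by omega)] at hj
        omega
      rw [Finset.sum_eq_single_of_mem i' (Finset.mem_range.2 hi),
        Finset.sum_eq_single_of_mem j' (Finset.mem_range.2 hj)]
      · simp
      · intro j _ hne
        rw [if_neg fun h => hne h.2.symm]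
      · intro i _ hne
        exact Finset.sum_eq_zero fun j _ => if_neg fun h => hne h.1.symm
    · rw [hxm i' j' hj]
      refine (Finset.sum_eq_zero fun i _ => Finset.sum_eq_zero fun j hj' => if_neg ?_).symm
      rintro ⟨rfl, rfl⟩
      have := Finset.mem_range.1 hj'
      omega
  refine ⟨∑ l, ∑ i ∈ Finset.range n, ∑ j ∈ Finset.range (γ i),
    MvPolynomial.C (φ (Pi.single l (u i j))) * MvPolynomial.X (l, i, j), fun v => ?_⟩
  have h2 : v = ∑ l, Pi.single l (v l) := (Finset.univ_sum_single v).symm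
  conv_lhs => rw [h2]
  rw [map_sum, map_sum]
  refine Finset.sum_congr rfl fun l _ => ?_
  have h3 : φ (Pi.single l (v l)) = (φ ∘ₗ LinearMap.single ℂ (fun _ => V) l) (v l) := rfl
  rw [h3]
  conv_lhs => rw [hx (v l)]
  simp only [map_sum, map_mul, map_smul, smul_eq_mul]
  refine Finset.sum_congr rfl fun i _ => Finset.sum_congr rfl fun j _ => ?_
  rw [seqEval, MvPolynomial.aeval_X, MvPolynomial.algHom_C, mul_comm]
  rfl

/-- Polynomial functions on tuples of elements of `M_γ` are polynomials in the entries of the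
sequences. -/
theorem exists_seqEval_of_polyFun (hn : ∀ i, n ≤ i → γ i = 0) (hinj : Function.Injective emb)
    (hrange : LinearMap.range emb = boxModule ℂ γ) {p : (Fin d → V) → ℂ}
    (hp : p ∈ polyFun (Fin d → V)) :
    ∃ f : MvPolynomial (Fin d × ℕ × ℕ) ℂ, ∀ v, p v = seqEval (fun l => emb (v l)) f := by
  change p ∈ Algebra.adjoin ℂ (Set.range fun φ : Module.Dual ℂ (Fin d → V) => (φ : _ → ℂ)) at hp
  induction hp using Algebra.adjoin_induction with
  | mem p hp =>
    obtain ⟨φ, rfl⟩ := hp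
    exact exists_seqEval_of_dual hn hinj hrange φ
  | algebraMap c => exact ⟨MvPolynomial.C c, fun v => (MvPolynomial.algHom_C _ c).symm⟩
  | add p q _ _ hp hq =>
    obtain ⟨f, hf⟩ := hp
    obtain ⟨g, hg⟩ := hq
    exact ⟨f + g, fun v => by rw [Pi.add_apply, hf, hg, map_add]⟩
  | mul p q _ _ hp hq =>
    obtain ⟨f, hf⟩ := hp
    obtain ⟨g, hg⟩ := hq
    exact ⟨f * g, fun v => by rw [Pi.mul_apply, hf, hg, map_mul]⟩

theorem seqEval_mem_polyFun (emb : V →ₗ[ℂ] RowSeq ℂ) (f : MvPolynomial (Fin d × ℕ × ℕ) ℂ) :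
    (fun v : Fin d → V => seqEval (fun l => emb (v l)) f) ∈ polyFun (Fin d → V) := by
  induction f using MvPolynomial.induction_on with
  | C c =>
    have : (fun v : Fin d → V => seqEval (fun l => emb (v l)) (MvPolynomial.C c))
        = algebraMap ℂ ((Fin d → V) → ℂ) c := funext fun v => MvPolynomial.algHom_C _ c
    rw [this]
    exact (polyFun _).algebraMap_mem c
  | add p q hp hq =>
    simp only [map_add]
    exact (polyFun _).add_mem hp hq
  | mul_X p x hp =>
    simp only [map_mul]
    refine (polyFun _).mul_mem hp ?_
    have : (fun v : Fin d → V => seqEval (fun l => emb (v l)) (MvPolynomial.X x))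
        = ((LinearMap.proj x.2.2 ∘ₗ LinearMap.proj x.2.1 ∘ₗ emb ∘ₗ LinearMap.proj x.1 :
          Module.Dual ℂ (Fin d → V)) : (Fin d → V) → ℂ) :=
      funext fun v => by rw [seqEval, MvPolynomial.aeval_X]; rfl
    rw [this]
    exact dual_mem_polyFun _

/-- The dimensions that define the types of the levels are dimensions of intersections of `N` with
fixed subspaces, up to constants. -/
theorem finrank_levelSubmodule_inf_ker (hn : ∀ i, n ≤ i → γ i = 0) (N : Submodule ℂ (RowSeq ℂ))
    (k j : ℕ) :
    Module.finrank ℂ (levelSubmodule γ N k ⊓ LinearMap.ker (rowShift ℂ ^ j) :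
        Submodule ℂ (RowSeq ℂ))
      = Module.finrank ℂ
          (N ⊓ (boxModule ℂ γ ⊓ LinearMap.ker (rowShift ℂ ^ j)).map (rowShift ℂ ^ k) :
            Submodule ℂ (RowSeq ℂ))
        + Module.finrank ℂ (boxModule ℂ γ ⊓ LinearMap.ker (rowShift ℂ ^ j)
          ⊓ LinearMap.ker (rowShift ℂ ^ k) : Submodule ℂ (RowSeq ℂ)) := by
  have := finiteDimensional_boxModule (K := ℂ) hn
  have : FiniteDimensional ℂ (levelSubmodule γ N k ⊓ LinearMap.ker (rowShift ℂ ^ j) :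
      Submodule ℂ (RowSeq ℂ)) := Submodule.finiteDimensional_of_le (inf_le_left.trans inf_le_left)
  rw [finrank_eq_map_add_inf_ker (rowShift ℂ ^ k)]
  refine congrArg₂
    (fun P Q : Submodule ℂ (RowSeq ℂ) => Module.finrank ℂ P + Module.finrank ℂ Q) ?_ ?_
  · ext x
    constructor
    · rintro ⟨y, ⟨⟨hy1, hy2⟩, hy3⟩, rfl⟩
      exact ⟨hy2, y, ⟨hy1, hy3⟩, rfl⟩
    · rintro ⟨hx, y, ⟨hy1, hy3⟩, rfl⟩
      exact ⟨y, ⟨⟨hy1, hx⟩, hy3⟩, rfl⟩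
  · ext x
    constructor
    · rintro ⟨⟨⟨hx1, -⟩, hx3⟩, hx4⟩
      exact ⟨⟨hx1, hx3⟩, hx4⟩
    · rintro ⟨⟨hx1, hx3⟩, hx4⟩
      refine ⟨⟨⟨hx1, ?_⟩, hx3⟩, hx4⟩
      change (rowShift ℂ ^ k) x ∈ N
      rw [LinearMap.mem_ker.1 hx4]
      exact N.zero_mem

/-- The subspaces of `M_γ` that are stable under `t` and whose levels have the types `ε k`. -/
def stratum (n : ℕ) (γ : ℕ → ℕ) (emb : V →ₗ[ℂ] RowSeq ℂ) (d : ℕ) (ε : ℕ → ℕ → ℕ) :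
    Set (SubspaceGrassmannian d V) :=
  {L | (∀ x ∈ L.1.map emb, rowShift ℂ x ∈ L.1.map emb) ∧
    ∀ k, HasType n (ε k) (levelSubmodule γ (L.1.map emb) k)}

theorem map_emb_le (hrange : LinearMap.range emb = boxModule ℂ γ) (L : Submodule ℂ V) :
    L.map emb ≤ boxModule ℂ γ := hrange ▸ LinearMap.map_le_range

theorem Frame.map_span (emb : V →ₗ[ℂ] RowSeq ℂ) (v : Frame d V) :
    v.span.1.map emb = Submodule.span ℂ (Set.range fun l => emb (v.1 l)) := by
  rw [Frame.span, Submodule.map_span, ← Set.range_comp]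
  rfl

end Strata

section StratumChain

variable {V : Type} [AddCommGroup V] [Module ℂ V] {d : ℕ} {α β γ : YoungDiagram}
  {emb : V →ₗ[ℂ] RowSeq ℂ} {ε : ℕ → ℕ → ℕ}

/-- Generic parameters define a basis of an element of the stratum. -/
theorem exists_frame_of_genericDet_ne_zero (hε : IsVChain α β γ ε)
    (hrange : LinearMap.range emb = boxModule ℂ γ.rowLen) {ρ : ℕ → ℕ → ℕ}
    (hρ : ∀ k, IsPivot (ε k) (ε (k + 1)) (ε (k + 2)) (ρ k))
    (e : Fin d ≃ (i : Fin (γ.colLen 0)) × Fin (ε 0 i))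
    {p : FrameParam ε (β.rowLen 0) (γ.colLen 0) d → ℂ} (hp : genericDet ρ p ≠ 0) :
    ∃ v : Frame d V, v.span ∈ stratum (γ.colLen 0) γ.rowLen emb d ε ∧
      ∀ l, emb (v.1 l) = paramVec e p l := by
  have hspan := span_paramVec hε.eq_zero e hp
  have hmem : ∀ l, paramVec e p l ∈ LinearMap.range emb := by
    intro l
    rw [hrange]
    refine hε.stripImage_le (stripCoeff p) ?_
    rw [← hspan]
    exact Submodule.subset_span ⟨l, rfl⟩
  choose v hv using hmem
  have hv' : emb ∘ v = paramVec e p := funext hv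
  have hli : LinearIndependent ℂ v := by
    refine LinearIndependent.of_comp emb ?_
    rw [hv']
    exact linearIndependent_paramVec e hp
  let w : Frame d V := ⟨v, hli⟩
  refine ⟨w, ?_, hv⟩
  have hN : w.span.1.map emb = stripImage ε (stripCoeff p) (β.rowLen 0) := by
    rw [Frame.map_span, ← hspan]
    exact congrArg (fun w => Submodule.span ℂ (Set.range w)) hv'
  refine ⟨fun x hx => ?_, fun k => ?_⟩
  · rw [hN] at hx ⊢
    exact rowShift_pow_mem_stripImage 1 hx
  · rw [hN]
    exact hε.hasType_levelSubmodule
      (fun m hm => isTransverse_of_genericDet_ne_zero hε.eq_zero hρ hp m hm) k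

theorem IsVChain.genericDet_X_ne_zero (hε : IsVChain α β γ ε) {ρ : ℕ → ℕ → ℕ}
    (hρ : ∀ k, IsPivot (ε k) (ε (k + 1)) (ε (k + 2)) (ρ k)) :
    genericDet ρ (MvPolynomial.X (R := ℂ) (σ := FrameParam ε (β.rowLen 0) (γ.colLen 0) d)) ≠ 0 := by
  intro h0
  obtain ⟨p, hp⟩ := exists_genericDet_eq_one (R := ℂ) (d := d) (r := β.rowLen 0) hε.eq_zero hρ
  have h1 := map_genericDet (MvPolynomial.aeval p :
    MvPolynomial (FrameParam ε (β.rowLen 0) (γ.colLen 0) d) ℂ →ₐ[ℂ] ℂ).toRingHom ρ MvPolynomial.X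
  rw [h0, map_zero] at h1
  refine zero_ne_one (h1.trans (Eq.trans ?_ hp))
  congr 1
  funext x
  exact MvPolynomial.aeval_X p x

/-- The ideal of a stratum is the kernel of its parametrization. -/
theorem vanishesOn_stratum_iff (hε : IsVChain α β γ ε)
    (hrange : LinearMap.range emb = boxModule ℂ γ.rowLen)
    (e : Fin d ≃ (i : Fin (γ.colLen 0)) × Fin (ε 0 i)) (f : MvPolynomial (Fin d × ℕ × ℕ) ℂ) :
    VanishesOn (fun v : Fin d → V => seqEval (fun l => emb (v l)) f)
      (stratum (γ.colLen 0) γ.rowLen emb d ε) ↔ paramHom ℂ (β.rowLen 0) e f = 0 := by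
  obtain ⟨ρ, hρ⟩ := hε.exists_isPivot
  constructor
  · -- it suffices to consider generic parameters, by multiplication with the polynomial that
    -- expresses genericity
    intro h
    refine (mul_eq_zero.1 ?_).resolve_right (hε.genericDet_X_ne_zero (d := d) hρ)
    refine MvPolynomial.funext fun p => ?_
    rw [map_mul, map_zero]
    by_cases hp : genericDet ρ p = 0
    · have h1 := map_genericDet (MvPolynomial.eval p) ρ MvPolynomial.X
      simp only [MvPolynomial.eval_X] at h1
      rw [h1, hp, mul_zero]
    · obtain ⟨v, hv, hvp⟩ := exists_frame_of_genericDet_ne_zero hε hrange hρ e hp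
      have h1 := h v hv
      have h2 := aeval_paramHom (k := ℂ) e p f
      have h3 : MvPolynomial.eval p (paramHom ℂ (β.rowLen 0) e f) = 0 := by
        refine h2.trans (Eq.trans ?_ h1)
        simp only [← hvp]
        rfl
      rw [h3, zero_mul]
  · -- every element of the stratum comes from a chain of endomorphisms
    intro h v hv
    have hN : IsExtensionSubmodule α β γ (v.span.1.map emb) :=
      hε.isExtensionSubmodule (map_emb_le hrange _) hv.1 hv.2
    obtain ⟨ε', g, hε', htype, hcomm, hpres, hNg⟩ := hN.exists_isVChain
    obtain rfl : ε' = ε := funext fun k => HasType.unique (hε'.isStripChain.anti k)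
      (hε.isStripChain.anti k) (hε'.eq_zero k) (hε.eq_zero k) (htype k) (hv.2 k)
    have hmem : ∀ l, ∃ h ∈ boxModule ℂ (ε' 0), chainComp g (β.rowLen 0) h = emb (v.1 l) := by
      intro l
      have : emb (v.1 l) ∈ v.span.1.map emb := by
        rw [Frame.map_span]
        exact Submodule.subset_span ⟨l, rfl⟩
      rw [hNg] at this
      exact this
    choose h0 hh0 hh0v using hmem
    have hmain := seqEval_chainComp_eq_zero hε.isStripChain hε.eq_zero hcomm hpres (β.rowLen 0) f
      (fun A u hu => by
        have hu' : ∀ l, ∃ c : Fin d → ℂ, boxVec e c = u l := by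
          intro l
          have := hu l
          rw [← range_boxVec e (hε.eq_zero 0)] at this
          exact this
        choose c hc using hu'
        let p : FrameParam ε' (β.rowLen 0) (γ.colLen 0) d → ℂ :=
          Sum.elim (fun x => A x.1.1 x.1.2.1 x.1.2.2) (fun x => c x.1 x.2)
        have h2 := aeval_paramHom (k := ℂ) e p f
        rw [h, map_zero] at h2
        rw [seqEval]
        refine Eq.trans ?_ h2.symm
        congr 2
        funext x
        have h3 : stripComp ε' A 0 (β.rowLen 0) = stripComp ε' (stripCoeff p) 0 (β.rowLen 0) := by
          refine stripComp_congr fun k s i hk his hs hi => ?_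
          have hsn : s < γ.colLen 0 := by
            by_contra hlt
            have := hε.eq_zero (k + 1) s (by omega)
            omega
          exact (stripCoeff_apply p ⟨(⟨k, hk⟩, ⟨s, hsn⟩, ⟨i, by omega⟩), his, hs, hi⟩).symm
        rw [paramVec, h3, ← hc]
        rfl) hh0
    simp only [hh0v] at hmain
    exact hmain

/-- The variety of extensions has as many irreducible components as there are chains of strips. -/
theorem encard_irreducibleComponents_extension [FiniteDimensional ℂ V]
    (hinj : Function.Injective emb) (hrange : LinearMap.range emb = boxModule ℂ γ.rowLen) :
    (irreducibleComponents {L : SubspaceGrassmannian α.card V |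
      IsExtensionSubmodule α β γ (L.1.map emb)}).encard
      = {ε : ℕ → ℕ → ℕ | IsVChain α β γ ε}.encard := by
  have hn : ∀ i, γ.colLen 0 ≤ i → γ.rowLen i = 0 := fun i => YoungDiagram.rowLen_eq_zero
  set I := {ε : ℕ → ℕ → ℕ | IsVChain α β γ ε} with hI
  have hfin : I.Finite := finite_isVChain β α γ
  have := hfin.to_subtype
  set Z : I → Set (SubspaceGrassmannian α.card V) :=
    fun ε => stratum (γ.colLen 0) γ.rowLen emb α.card ε.1 with hZ
  have he : ∀ ε : I, Nonempty (Fin α.card ≃ (i : Fin (γ.colLen 0)) × Fin (ε.1 0 i)) := by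
    rintro ⟨ε, hε⟩
    have hε : IsVChain α β γ ε := hε
    refine ⟨(Fintype.equivFinOfCardEq ?_).symm⟩
    have hle : α.colLen 0 ≤ γ.colLen 0 := by
      by_contra hlt
      have h1 := hε.eq_zero 0 (γ.colLen 0) le_rfl
      rw [hε.zero] at h1
      have h2 := YoungDiagram.lt_rowLen_iff (μ := α) (i := γ.colLen 0) (j := 0)
      omega
    rw [YoungDiagram.card_eq_sum_rowLen hle, Fintype.card_sigma, Finset.sum_range, ← hε.zero]
    simp
  have hker : ∀ (ε : I) (e : Fin α.card ≃ (i : Fin (γ.colLen 0)) × Fin (ε.1 0 i))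
      (f : MvPolynomial (Fin α.card × ℕ × ℕ) ℂ),
      VanishesOn (fun v : Fin α.card → V => seqEval (fun l => emb (v l)) f) (Z ε)
        ↔ paramHom ℂ (β.rowLen 0) e f = 0 :=
    fun ε e f => vanishesOn_stratum_iff ε.2 hrange e f
  rw [encard_irreducibleComponents Z]
  · rfl
  · ext L
    rw [Set.mem_iUnion]
    constructor
    · intro hL
      obtain ⟨ε, -, hε, htype, -⟩ := IsExtensionSubmodule.exists_isVChain hL
      exact ⟨⟨ε, hε⟩, hL.shift, htype⟩
    · rintro ⟨ε, hL⟩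
      exact ε.2.isExtensionSubmodule (map_emb_le hrange _) hL.1 hL.2
  · intro ε
    obtain ⟨e⟩ := he ε
    refine ⟨?_, isPreirreducible_of_vanishesOn fun p hp q hq hpq => ?_⟩
    · obtain ⟨ρ, hρ⟩ := ε.2.exists_isPivot
      obtain ⟨p, hp⟩ := exists_genericDet_eq_one (R := ℂ) (d := α.card) (r := β.rowLen 0)
        ε.2.eq_zero hρ
      obtain ⟨v, hv, -⟩ := exists_frame_of_genericDet_ne_zero ε.2 hrange hρ e
        (hp ▸ one_ne_zero)
      exact ⟨_, hv⟩
    · obtain ⟨f, hf⟩ := exists_seqEval_of_polyFun hn hinj hrange hp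
      obtain ⟨g, hg⟩ := exists_seqEval_of_polyFun hn hinj hrange hq
      obtain rfl : p = _ := funext hf
      obtain rfl : q = _ := funext hg
      rw [hker ε e, hker ε e, ← mul_eq_zero, ← map_mul, ← hker ε e]
      intro v hv
      exact (map_mul _ f g).trans (hpq v hv)
  · intro T S hTS
    obtain ⟨eT⟩ := he T
    obtain ⟨eS⟩ := he S
    -- the ideals of the two strata agree, as the strata have the same dimension
    have hle : RingHom.ker (paramHom ℂ (β.rowLen 0) eS)
        ≤ RingHom.ker (paramHom ℂ (β.rowLen 0) eT) := by
      intro f hf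
      exact (hker T eT f).1 (vanishesOn_of_subset_closure hTS (seqEval_mem_polyFun emb f)
        ((hker S eS f).2 hf))
    obtain ⟨ρ, hρ⟩ := T.2.exists_isPivot
    have hcard : Nat.card (FrameParam S.1 (β.rowLen 0) (γ.colLen 0) α.card)
        = Nat.card (FrameParam T.1 (β.rowLen 0) (γ.colLen 0) α.card) := by
      have h1 := S.2.card_frameParam α.card
      have h2 := T.2.card_frameParam α.card
      have := h1.trans h2.symm
      omega
    have hkereq := ker_eq_of_ker_le hcard _ _ hle
      (isAlgebraic_paramHom T.2.isStripChain T.2.eq_zero hρ eT)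
    -- the dimensions that determine the types are the same on both strata, by semicontinuity
    have hsemi : ∀ (S T : I) (_ : ∀ p ∈ polyFun (Fin α.card → V), VanishesOn p (Z S) →
        VanishesOn p (Z T)) (k j : ℕ), ∑ i ∈ Finset.range (γ.colLen 0), min (S.1 k i) j
          ≤ ∑ i ∈ Finset.range (γ.colLen 0), min (T.1 k i) j := by
      intro S T hST k j
      obtain ⟨e⟩ := he T
      obtain ⟨ρ, hρ⟩ := T.2.exists_isPivot
      obtain ⟨p0, hp0⟩ := exists_genericDet_eq_one (R := ℂ) (d := α.card) (r := β.rowLen 0)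
        T.2.eq_zero hρ
      obtain ⟨v, hv, -⟩ := exists_frame_of_genericDet_ne_zero T.2 hrange hρ e
        (hp0 ▸ one_ne_zero)
      set W := (boxModule ℂ γ.rowLen ⊓ LinearMap.ker (rowShift ℂ ^ j)).map (rowShift ℂ ^ k) with hW
      obtain ⟨p, hp, hpv, hpU⟩ := exists_polyFun_finrank_inf_le (W.comap emb) v
      have h1 : ¬ VanishesOn p (Z S) := fun h => hpv (hST p hp h v hv)
      simp only [VanishesOn, not_forall] at h1
      obtain ⟨w, hw, hpw⟩ := h1
      have h2 := hpU w hpw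
      have h3 : ∀ u : Frame α.card V,
          Module.finrank ℂ (u.span.1 ⊓ W.comap emb : Submodule ℂ V)
          = Module.finrank ℂ (u.span.1.map emb ⊓ W : Submodule ℂ (RowSeq ℂ)) := by
        intro u
        have : u.span.1.map emb ⊓ W = (u.span.1 ⊓ W.comap emb).map emb := by
          ext x
          constructor
          · rintro ⟨⟨y, hy, rfl⟩, hx⟩
            exact ⟨y, ⟨hy, hx⟩, rfl⟩
          · rintro ⟨y, ⟨hy, hx⟩, rfl⟩
            exact ⟨⟨y, hy, rfl⟩, hx⟩
        rw [this]
        exact (Submodule.equivMapOfInjective emb hinj _).finrank_eq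
      rw [h3, h3] at h2
      have h4 := finrank_levelSubmodule_inf_ker hn (w.span.1.map emb) k j
      have h5 := finrank_levelSubmodule_inf_ker hn (v.span.1.map emb) k j
      rw [hw.2 k] at h4
      rw [hv.2 k] at h5
      rw [h4, h5]
      exact Nat.add_le_add_right h2 _
    have hST := hsemi S T fun p hp hpS => vanishesOn_of_subset_closure hTS hp hpS
    have hTS' := hsemi T S fun p hp hpT => by
      obtain ⟨f, hf⟩ := exists_seqEval_of_polyFun hn hinj hrange hp
      obtain rfl : p = _ := funext hf
      rw [hker S eS]
      have h1 : f ∈ RingHom.ker (paramHom ℂ (β.rowLen 0) eT) := (hker T eT f).1 hpT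
      rw [← hkereq] at h1
      exact h1
    have hbox : ∀ (T : I) k, HasType (K := ℂ) (γ.colLen 0) (T.1 k) (boxModule ℂ (T.1 k)) := by
      intro T k
      have h2 := hasType_map_boxModule (K := ℂ) (g := LinearMap.id) (T.2.eq_zero k)
        (fun _ => rfl) Function.injective_id.injOn
      rwa [Submodule.map_id] at h2
    refine Subtype.ext (funext fun k => ?_)
    refine HasType.unique (T.2.isStripChain.anti k) (S.2.isStripChain.anti k) (T.2.eq_zero k)
      (S.2.eq_zero k) (hbox T k) fun j => ?_
    rw [hbox T k j]
    exact le_antisymm (hTS' k j) (hST k j)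

end StratumChain

/-! ### Torsion modules as modules of sequences -/

section Torsion

/-- The coefficients of a polynomial modulo `X ^ k`, in reverse order. -/
noncomputable def revCoeff (k : ℕ) : ℂ[X] →ₗ[ℂ] ℕ → ℂ where
  toFun p j := if j < k then p.coeff (k - 1 - j) else 0
  map_add' p q := by
    funext j
    by_cases h : j < k <;> simp [h]
  map_smul' c p := by
    funext j
    by_cases h : j < k <;> simp [h]

theorem revCoeff_apply (k : ℕ) (p : ℂ[X]) (j : ℕ) :
    revCoeff k p j = if j < k then p.coeff (k - 1 - j) else 0 := rfl

theorem revCoeff_eq_zero_iff {k : ℕ} {p : ℂ[X]} :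
    revCoeff k p = 0 ↔ p ∈ Ideal.span {(X : ℂ[X]) ^ k} := by
  rw [Ideal.mem_span_singleton, Polynomial.X_pow_dvd_iff]
  constructor
  · intro h j hj
    have := congrFun h (k - 1 - j)
    rw [revCoeff_apply, if_pos (by omega), show k - 1 - (k - 1 - j) = j by omega] at this
    exact this
  · intro h
    funext j
    rw [revCoeff_apply]
    split_ifs
    · exact h _ (by omega)
    · rfl

theorem revCoeff_X_mul (k : ℕ) (p : ℂ[X]) (j : ℕ) :
    revCoeff k (X * p) j = revCoeff k p (j + 1) := by
  rw [revCoeff_apply, revCoeff_apply]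
  rcases lt_trichotomy (j + 1) k with h | h | h
  · rw [if_pos (by omega), if_pos h, show k - 1 - j = (k - 1 - (j + 1)) + 1 by omega,
      Polynomial.coeff_X_mul]
  · rw [if_pos (by omega), if_neg (by omega), show k - 1 - j = 0 by omega,
      Polynomial.coeff_X_mul_zero]
  · rw [if_neg (by omega), if_neg (by omega)]

/-- The coordinates of `ℂ[t] / (t ^ k)` in which multiplication by `t` is the backward shift. -/
noncomputable def quotRevCoeff (k : ℕ) : (ℂ[X] ⧸ Ideal.span {(X : ℂ[X]) ^ k}) →ₗ[ℂ] ℕ → ℂ :=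
  ((Ideal.span {(X : ℂ[X]) ^ k}).restrictScalars ℂ).liftQ (revCoeff k)
    (fun _ hp => revCoeff_eq_zero_iff.2 hp) ∘ₗ
  (Submodule.Quotient.restrictScalarsEquiv ℂ (Ideal.span {(X : ℂ[X]) ^ k})).symm.toLinearMap

theorem quotRevCoeff_mk (k : ℕ) (p : ℂ[X]) :
    quotRevCoeff k (Ideal.Quotient.mk _ p) = revCoeff k p := rfl

theorem quotRevCoeff_injective (k : ℕ) : Function.Injective (quotRevCoeff k) := by
  refine (injective_iff_map_eq_zero _).2 fun x hx => ?_
  obtain ⟨p, rfl⟩ := Ideal.Quotient.mk_surjective x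
  rw [quotRevCoeff_mk, revCoeff_eq_zero_iff] at hx
  exact Ideal.Quotient.eq_zero_iff_mem.2 hx

theorem quotRevCoeff_X_smul (k : ℕ) (x : ℂ[X] ⧸ Ideal.span {(X : ℂ[X]) ^ k}) (j : ℕ) :
    quotRevCoeff k ((X : ℂ[X]) • x) j = quotRevCoeff k x (j + 1) := by
  obtain ⟨p, rfl⟩ := Ideal.Quotient.mk_surjective x
  exact revCoeff_X_mul k p j

/-- The embedding of a direct sum of modules `ℂ[t] / (t ^ μ_i)` in the module of sequences. -/
noncomputable def torsionEmb (n : ℕ) (μ : ℕ → ℕ) :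
    ((i : Fin n) → ℂ[X] ⧸ Ideal.span {(X : ℂ[X]) ^ μ i}) →ₗ[ℂ] RowSeq ℂ where
  toFun x i := if h : i < n then quotRevCoeff (μ i) (x ⟨i, h⟩) else 0
  map_add' x y := by
    funext i
    by_cases h : i < n <;> simp [h]
  map_smul' c x := by
    funext i
    by_cases h : i < n <;> simp [h]

theorem torsionEmb_apply {n : ℕ} (μ : ℕ → ℕ)
    (x : (i : Fin n) → ℂ[X] ⧸ Ideal.span {(X : ℂ[X]) ^ μ i}) (i : Fin n) :
    torsionEmb n μ x i = quotRevCoeff (μ i) (x i) := dif_pos i.2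

theorem torsionEmb_injective (n : ℕ) (μ : ℕ → ℕ) : Function.Injective (torsionEmb n μ) := by
  intro x y h
  funext i
  refine quotRevCoeff_injective _ ?_
  rw [← torsionEmb_apply, ← torsionEmb_apply, h]

theorem torsionEmb_X_smul (n : ℕ) (μ : ℕ → ℕ)
    (x : (i : Fin n) → ℂ[X] ⧸ Ideal.span {(X : ℂ[X]) ^ μ i}) :
    torsionEmb n μ ((X : ℂ[X]) • x) = rowShift ℂ (torsionEmb n μ x) := by
  funext i j
  rw [rowShift_apply]
  by_cases h : i < n
  · have h1 := torsionEmb_apply μ ((X : ℂ[X]) • x) ⟨i, h⟩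
    have h2 := torsionEmb_apply μ x ⟨i, h⟩
    simp only at h1 h2
    rw [h1, h2]
    exact quotRevCoeff_X_smul _ _ j
  · simp [torsionEmb, h]

theorem torsionEmb_X_pow_smul (n : ℕ) (μ : ℕ → ℕ) (k : ℕ)
    (x : (i : Fin n) → ℂ[X] ⧸ Ideal.span {(X : ℂ[X]) ^ μ i}) :
    torsionEmb n μ ((X : ℂ[X]) ^ k • x) = (rowShift ℂ ^ k) (torsionEmb n μ x) := by
  induction k with
  | zero => simp
  | succ k ih => rw [pow_succ', mul_smul, torsionEmb_X_smul, ih, pow_succ', Module.End.mul_apply]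

theorem range_torsionEmb {n : ℕ} {μ : ℕ → ℕ} (hn : ∀ i, n ≤ i → μ i = 0) :
    LinearMap.range (torsionEmb n μ) = boxModule ℂ μ := by
  refine le_antisymm ?_ fun y hy => ?_
  · rintro _ ⟨x, rfl⟩ i j hj
    by_cases h : i < n
    · have h1 := torsionEmb_apply μ x ⟨i, h⟩
      simp only at h1
      rw [h1]
      obtain ⟨p, hp⟩ := Ideal.Quotient.mk_surjective (x ⟨i, h⟩)
      rw [← hp, quotRevCoeff_mk, revCoeff_apply, if_neg (by omega)]
    · simp [torsionEmb, h]
  · refine ⟨fun i => Ideal.Quotient.mk _ (∑ m ∈ Finset.range (μ i),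
      Polynomial.C (y i (μ i - 1 - m)) * X ^ m), ?_⟩
    funext i j
    by_cases h : i < n
    · have h1 := torsionEmb_apply μ (fun i : Fin n => Ideal.Quotient.mk
        (Ideal.span {(X : ℂ[X]) ^ μ i}) (∑ m ∈ Finset.range (μ i),
          Polynomial.C (y i (μ i - 1 - m)) * X ^ m)) ⟨i, h⟩
      simp only at h1
      rw [h1, quotRevCoeff_mk, revCoeff_apply]
      split_ifs with hj
      · rw [Polynomial.finsetSum_coeff, Finset.sum_eq_single_of_mem (μ i - 1 - j)
          (Finset.mem_range.2 (by omega))]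
        · rw [Polynomial.coeff_C_mul_X_pow, if_pos rfl, show μ i - 1 - (μ i - 1 - j) = j by omega]
        · intro m _ hm
          rw [Polynomial.coeff_C_mul_X_pow, if_neg hm.symm]
      · exact (hy i j (by omega)).symm
    · rw [hy i j (by rw [hn i (by omega)]; omega)]
      simp [torsionEmb, h]

/-- The kernel of `t ^ j`. -/
noncomputable def torsionKer (Q : Type*) [AddCommGroup Q] [Module ℂ[X] Q] [Module ℂ Q]
    [IsScalarTower ℂ ℂ[X] Q] (j : ℕ) : Submodule ℂ Q :=
  (Submodule.torsionBy ℂ[X] Q ((X : ℂ[X]) ^ j)).restrictScalars ℂ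

theorem mem_torsionKer {Q : Type*} [AddCommGroup Q] [Module ℂ[X] Q] [Module ℂ Q]
    [IsScalarTower ℂ ℂ[X] Q] {j : ℕ} {x : Q} :
    x ∈ torsionKer Q j ↔ (X : ℂ[X]) ^ j • x = 0 := Iff.rfl

theorem finrank_torsionKer_congr {Q Q' : Type*} [AddCommGroup Q] [Module ℂ[X] Q] [Module ℂ Q]
    [IsScalarTower ℂ ℂ[X] Q] [AddCommGroup Q'] [Module ℂ[X] Q'] [Module ℂ Q']
    [IsScalarTower ℂ ℂ[X] Q'] (e : Q ≃ₗ[ℂ[X]] Q') (j : ℕ) :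
    Module.finrank ℂ (torsionKer Q j) = Module.finrank ℂ (torsionKer Q' j) := by
  have : torsionKer Q' j = (torsionKer Q j).map (e.restrictScalars ℂ).toLinearMap := by
    ext x
    constructor
    · intro hx
      refine ⟨e.symm x, ?_, e.apply_symm_apply x⟩
      rw [SetLike.mem_coe, mem_torsionKer] at *
      rw [← map_smul, hx, map_zero]
    · rintro ⟨y, hy, rfl⟩
      rw [SetLike.mem_coe, mem_torsionKer] at *
      change (X : ℂ[X]) ^ j • e y = 0
      rw [← map_smul, hy, map_zero]
  rw [this]
  exact (LinearEquiv.finrank_map_eq (e.restrictScalars ℂ) _).symm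

theorem finrank_torsionKer_pi {n : ℕ} {μ : ℕ → ℕ} (hn : ∀ i, n ≤ i → μ i = 0) (j : ℕ) :
    Module.finrank ℂ (torsionKer ((i : Fin n) → ℂ[X] ⧸ Ideal.span {(X : ℂ[X]) ^ μ i}) j)
      = ∑ i ∈ Finset.range n, min (μ i) j := by
  rw [← finrank_boxModule (K := ℂ) (μ := fun i => min (μ i) j) (fun i hi => by simp [hn i hi]),
    ← boxModule_inf_ker, ← range_torsionEmb hn]
  have : LinearMap.range (torsionEmb n μ) ⊓ LinearMap.ker (rowShift ℂ ^ j)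
      = (torsionKer ((i : Fin n) → ℂ[X] ⧸ Ideal.span {(X : ℂ[X]) ^ μ i}) j).map
        (torsionEmb n μ) := by
    ext x
    constructor
    · rintro ⟨⟨y, rfl⟩, hy⟩
      refine ⟨y, ?_, rfl⟩
      rw [SetLike.mem_coe, LinearMap.mem_ker, ← torsionEmb_X_pow_smul] at hy
      exact torsionEmb_injective n μ (hy.trans (map_zero _).symm)
    · rintro ⟨y, hy, rfl⟩
      refine ⟨⟨y, rfl⟩, ?_⟩
      rw [SetLike.mem_coe, mem_torsionKer] at hy
      rw [SetLike.mem_coe, LinearMap.mem_ker, ← torsionEmb_X_pow_smul, hy, map_zero]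
  rw [this]
  exact (Submodule.equivMapOfInjective _ (torsionEmb_injective n μ) _).finrank_eq

end Torsion

/-! ### Classification of torsion modules by dimensions of kernels -/

section Classification

/-- The number of parts `m + 1` is a second difference. -/
theorem card_filter_add_sum_min {ι : Type*} [Fintype ι] (k : ι → ℕ) (m : ℕ) :
    (Finset.univ.filter fun i => k i = m + 1).card + ∑ i, min (k i) (m + 2) + ∑ i, min (k i) m
      = 2 * ∑ i, min (k i) (m + 1) := by
  rw [Finset.card_filter, Finset.mul_sum, ← Finset.sum_add_distrib, ← Finset.sum_add_distrib]
  refine Finset.sum_congr rfl fun i _ => ?_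
  split_ifs <;> omega

theorem card_filter_eq_of_sum_min {ι κ : Type*} [Fintype ι] [Fintype κ] {k : ι → ℕ} {μ : κ → ℕ}
    (h : ∀ j, ∑ i, min (k i) j = ∑ i, min (μ i) j) (m : ℕ) :
    (Finset.univ.filter fun i => k i = m + 1).card
      = (Finset.univ.filter fun i => μ i = m + 1).card := by
  have h1 := card_filter_add_sum_min k m
  have h2 := card_filter_add_sum_min μ m
  rw [h, h, h] at h1
  omega

/-- The parts of a partition are determined by the numbers of boxes in its first columns. -/
theorem exists_equiv_of_sum_min {ι κ : Type*} [Fintype ι] [Fintype κ] {k : ι → ℕ} {μ : κ → ℕ}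
    (hμ : ∀ i, 0 < μ i) (h : ∀ j, ∑ i, min (k i) j = ∑ i, min (μ i) j) :
    ∃ e : {i // 0 < k i} ≃ κ, ∀ i, μ (e i) = k i := by
  have e : ∀ c, Nonempty ({i : {i // 0 < k i} // k i = c} ≃ {i // μ i = c}) := by
    intro c
    rcases c with _ | m
    · have h1 : IsEmpty {i : {i // 0 < k i} // k i = 0} := ⟨fun i => i.1.2.ne' i.2⟩
      have h2 : IsEmpty {i // μ i = 0} := ⟨fun i => (hμ i.1).ne' i.2⟩
      exact ⟨Equiv.equivOfIsEmpty _ _⟩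
    · refine ⟨(Equiv.subtypeSubtypeEquivSubtype (p := fun i => 0 < k i)
        (q := fun i => k i = m + 1) fun h => by omega).trans (Fintype.equivOfCardEq ?_)⟩
      rw [Fintype.card_subtype, Fintype.card_subtype]
      exact card_filter_eq_of_sum_min h m
  exact ⟨Equiv.ofFiberEquiv fun c => (e c).some, fun i => Equiv.ofFiberEquiv_map _ i⟩

theorem nonempty_pi_quotient_equiv {d n : ℕ} {k : Fin d → ℕ} {μ : Fin n → ℕ}
    (hμ : ∀ i, 0 < μ i) (h : ∀ j, ∑ i, min (k i) j = ∑ i, min (μ i) j) :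
    Nonempty (((i : Fin d) → ℂ[X] ⧸ Ideal.span {(X : ℂ[X]) ^ k i}) ≃ₗ[ℂ[X]]
      ((i : Fin n) → ℂ[X] ⧸ Ideal.span {(X : ℂ[X]) ^ μ i})) := by
  obtain ⟨e, he⟩ := exists_equiv_of_sum_min hμ h
  -- the summands with `k i = 0` vanish
  have hsub : ∀ i, ¬ 0 < k i → Subsingleton (ℂ[X] ⧸ Ideal.span {(X : ℂ[X]) ^ k i}) := by
    intro i hi
    rw [Ideal.Quotient.subsingleton_iff, show k i = 0 by omega, pow_zero, Ideal.span_singleton_one]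
  let r : ((i : Fin d) → ℂ[X] ⧸ Ideal.span {(X : ℂ[X]) ^ k i}) →ₗ[ℂ[X]]
      ((i : {i // 0 < k i}) → ℂ[X] ⧸ Ideal.span {(X : ℂ[X]) ^ k i}) :=
    LinearMap.pi fun i => LinearMap.proj i.1
  have hr : Function.Bijective r := by
    constructor
    · intro x y hxy
      funext i
      by_cases hi : 0 < k i
      · exact congrFun hxy ⟨i, hi⟩
      · have := hsub i hi
        exact Subsingleton.elim _ _
    · intro y
      refine ⟨fun i => if hi : 0 < k i then y ⟨i, hi⟩ else 0, ?_⟩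
      funext i
      exact dif_pos i.2
  refine ⟨(LinearEquiv.ofBijective r hr).trans ((LinearEquiv.piCongrRight fun i =>
    Submodule.quotEquivOfEq _ (Ideal.span {(X : ℂ[X]) ^ μ (e i)}) (by rw [he])).trans
    (LinearEquiv.piCongrLeft ℂ[X] (fun i => ℂ[X] ⧸ Ideal.span {(X : ℂ[X]) ^ μ i}) e))⟩

/-- A finitely generated module on which `t` is locally nilpotent is determined by the dimensions
of the kernels of the powers of `t`. -/
theorem nonempty_equiv_torsionModule_iff {Q : Type} [AddCommGroup Q] [Module ℂ[X] Q] [Module ℂ Q]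
    [IsScalarTower ℂ ℂ[X] Q] [Module.Finite ℂ[X] Q]
    (hQ : ∀ x : Q, ∃ k : ℕ, (X : ℂ[X]) ^ k • x = 0) (μ : YoungDiagram) :
    Nonempty (Q ≃ₗ[ℂ[X]] TorsionModule μ) ↔ ∀ j, Module.finrank ℂ (torsionKer Q j)
      = ∑ i ∈ Finset.range (μ.colLen 0), min (μ.rowLen i) j := by
  have hzero : ∀ i, μ.colLen 0 ≤ i → μ.rowLen i = 0 := fun i hi =>
    YoungDiagram.rowLen_eq_zero hi
  constructor
  · rintro ⟨e⟩ j
    rw [finrank_torsionKer_congr e j]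
    exact finrank_torsionKer_pi hzero j
  · intro h
    obtain ⟨d, k, e⟩ := Module.torsion_by_prime_power_decomposition (R := ℂ[X]) (M := Q)
      (p := X) Polynomial.irreducible_X ((Submodule.isTorsion'_powers_iff _).2 hQ)
    obtain ⟨k, hk, rfl⟩ : ∃ k' : ℕ → ℕ, (∀ i, d ≤ i → k' i = 0) ∧ k = fun i : Fin d => k' i :=
      ⟨fun i => if hi : i < d then k ⟨i, hi⟩ else 0, fun i hi => dif_neg (by omega),
        funext fun i => by simp⟩
    obtain ⟨e⟩ := e
    have e' : Q ≃ₗ[ℂ[X]] ((i : Fin d) → ℂ[X] ⧸ Ideal.span {(X : ℂ[X]) ^ k i}) :=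
      e.trans (DirectSum.linearEquivFunOnFintype ℂ[X] (Fin d) _)
    obtain ⟨f⟩ := nonempty_pi_quotient_equiv (k := fun i : Fin d => k i)
      (μ := fun i : Fin (μ.colLen 0) => μ.rowLen i)
      (fun i => YoungDiagram.mem_iff_lt_rowLen.1 (YoungDiagram.mem_iff_lt_colLen.2 i.2))
      (fun j => by
        have h1 := h j
        rw [finrank_torsionKer_congr e' j, finrank_torsionKer_pi hk, Finset.sum_range,
          Finset.sum_range] at h1
        exact h1)
    exact ⟨e'.trans f⟩

end Classification

/-! ### The variety of extensions in the module of sequences -/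

section Extension

theorem YoungDiagram.sum_min_rowLen_eq_sum_colLen (μ : YoungDiagram) (k : ℕ) :
    ∑ i ∈ Finset.range (μ.colLen 0), min (μ.rowLen i) k = ∑ j ∈ Finset.range k, μ.colLen j := by
  induction k with
  | zero => simp
  | succ k ih =>
    have h1 := sum_min_rowLen (α := μ) (n := μ.colLen 0)
      (fun i hi => YoungDiagram.rowLen_eq_zero hi) k
    rw [Finset.sum_sub_distrib, ← Nat.cast_sum, ← Nat.cast_sum] at h1
    rw [Finset.sum_range_succ, ← ih]
    omega

theorem finrank_torsionModule (μ : YoungDiagram) :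
    Module.finrank ℂ (TorsionModule μ) = μ.card := by
  have hn : ∀ i, μ.colLen 0 ≤ i → μ.rowLen i = 0 := fun i => YoungDiagram.rowLen_eq_zero
  rw [YoungDiagram.card_eq_sum_rowLen le_rfl, ← finrank_boxModule (K := ℂ) hn,
    ← range_torsionEmb hn]
  exact (LinearEquiv.ofInjective _ (torsionEmb_injective _ _)).finrank_eq

instance (μ : YoungDiagram) : FiniteDimensional ℂ (TorsionModule μ) := by
  have hn : ∀ i, μ.colLen 0 ≤ i → μ.rowLen i = 0 := fun i => YoungDiagram.rowLen_eq_zero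
  have := finiteDimensional_boxModule (K := ℂ) hn
  rw [← range_torsionEmb hn] at this
  exact (LinearEquiv.ofInjective _
    (torsionEmb_injective (μ.colLen 0) μ.rowLen)).symm.finiteDimensional

variable {γ : YoungDiagram}

/-- The embedding of `M_γ` in the module of sequences. -/
noncomputable abbrev TorsionModule.emb (γ : YoungDiagram) : TorsionModule γ →ₗ[ℂ] RowSeq ℂ :=
  torsionEmb (γ.colLen 0) γ.rowLen

theorem TorsionModule.range_emb (γ : YoungDiagram) :
    LinearMap.range (TorsionModule.emb γ) = boxModule ℂ γ.rowLen :=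
  range_torsionEmb fun _ => YoungDiagram.rowLen_eq_zero

theorem TorsionModule.X_pow_smul_eq_zero (x : TorsionModule γ) :
    (X : ℂ[X]) ^ γ.rowLen 0 • x = 0 := by
  refine torsionEmb_injective _ _ ?_
  have hx : TorsionModule.emb γ x ∈ boxModule ℂ γ.rowLen := by
    rw [← TorsionModule.range_emb]
    exact ⟨x, rfl⟩
  rw [map_zero, torsionEmb_X_pow_smul]
  funext i j
  rw [rowShift_pow_apply]
  have := γ.rowLen_anti 0 i (Nat.zero_le i)
  exact hx i _ (by omega)

theorem finrank_torsionKer_submodule (N : Submodule ℂ[X] (TorsionModule γ)) (j : ℕ) :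
    Module.finrank ℂ (torsionKer N j) = Module.finrank ℂ
      ((N.restrictScalars ℂ).map (TorsionModule.emb γ) ⊓ LinearMap.ker (rowShift ℂ ^ j) :
        Submodule ℂ (RowSeq ℂ)) := by
  let f : N →ₗ[ℂ] RowSeq ℂ := TorsionModule.emb γ ∘ₗ N.subtype.restrictScalars ℂ
  have hf : Function.Injective f := (torsionEmb_injective _ _).comp N.subtype_injective
  have : (N.restrictScalars ℂ).map (TorsionModule.emb γ) ⊓ LinearMap.ker (rowShift ℂ ^ j)
      = (torsionKer N j).map f := by
    ext y
    constructor
    · rintro ⟨⟨x, hx, rfl⟩, hy⟩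
      refine ⟨⟨x, hx⟩, ?_, rfl⟩
      rw [SetLike.mem_coe, LinearMap.mem_ker, ← torsionEmb_X_pow_smul] at hy
      exact Subtype.ext (torsionEmb_injective _ _ (hy.trans (map_zero _).symm))
    · rintro ⟨x, hx, rfl⟩
      refine ⟨⟨x, x.2, rfl⟩, ?_⟩
      rw [SetLike.mem_coe, mem_torsionKer] at hx
      have h1 : (X : ℂ[X]) ^ j • (x : TorsionModule γ) = 0 := congrArg Subtype.val hx
      rw [SetLike.mem_coe, LinearMap.mem_ker]
      change (rowShift ℂ ^ j) (TorsionModule.emb γ x) = 0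
      rw [← torsionEmb_X_pow_smul, h1, map_zero]
  rw [this]
  exact (Submodule.equivMapOfInjective f hf _).finrank_eq

theorem finrank_comap_eq_add_torsionKer (N : Submodule ℂ[X] (TorsionModule γ)) (k : ℕ) :
    Module.finrank ℂ ((N.comap (LinearMap.lsmul ℂ[X] (TorsionModule γ) (X ^ k))).restrictScalars ℂ)
      = Module.finrank ℂ (N.restrictScalars ℂ)
        + Module.finrank ℂ (torsionKer (TorsionModule γ ⧸ N) k) := by
  set A := (N.comap (LinearMap.lsmul ℂ[X] (TorsionModule γ) (X ^ k))).restrictScalars ℂ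
  have hmemA : ∀ x, x ∈ A ↔ (X : ℂ[X]) ^ k • x ∈ N := fun x => Iff.rfl
  have h2 : A.map (N.mkQ.restrictScalars ℂ) = torsionKer (TorsionModule γ ⧸ N) k := by
    ext y
    obtain ⟨x, rfl⟩ := N.mkQ_surjective y
    rw [mem_torsionKer, ← map_smul, Submodule.mkQ_apply N (X ^ k • x),
      Submodule.Quotient.mk_eq_zero]
    constructor
    · rintro ⟨z, hz, hzx⟩
      have h3 : z - x ∈ N := (Submodule.Quotient.eq N).1 hzx
      have h4 := N.sub_mem ((hmemA z).1 hz) (N.smul_mem ((X : ℂ[X]) ^ k) h3)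
      rwa [smul_sub, sub_sub_cancel] at h4
    · exact fun h => ⟨x, h, rfl⟩
  have h3 : A ⊓ LinearMap.ker (N.mkQ.restrictScalars ℂ) = N.restrictScalars ℂ := by
    ext x
    rw [Submodule.mem_inf, LinearMap.mem_ker, hmemA]
    change _ ∧ N.mkQ x = 0 ↔ x ∈ N
    rw [Submodule.mkQ_apply, Submodule.Quotient.mk_eq_zero]
    exact ⟨fun h => h.2, fun h => ⟨N.smul_mem _ h, h⟩⟩
  rw [finrank_eq_map_add_inf_ker (N.mkQ.restrictScalars ℂ) A, h2, h3, add_comm]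

theorem finrank_torsionKer_quotient (N : Submodule ℂ[X] (TorsionModule γ)) (k : ℕ) :
    Module.finrank ℂ (levelSubmodule γ.rowLen ((N.restrictScalars ℂ).map (TorsionModule.emb γ)) k)
      = Module.finrank ℂ ((N.restrictScalars ℂ).map (TorsionModule.emb γ))
        + Module.finrank ℂ (torsionKer (TorsionModule γ ⧸ N) k) := by
  have hinj : Function.Injective (TorsionModule.emb γ) := torsionEmb_injective _ _
  let A : Submodule ℂ (TorsionModule γ) :=
    (N.comap (LinearMap.lsmul ℂ[X] (TorsionModule γ) (X ^ k))).restrictScalars ℂ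
  have hmemA : ∀ x, x ∈ A ↔ (X : ℂ[X]) ^ k • x ∈ N := fun x => Iff.rfl
  have h1 : levelSubmodule γ.rowLen ((N.restrictScalars ℂ).map (TorsionModule.emb γ)) k
      = A.map (TorsionModule.emb γ) := by
    ext y
    rw [mem_levelSubmodule, ← TorsionModule.range_emb]
    constructor
    · rintro ⟨⟨x, rfl⟩, z, hz, hzx⟩
      rw [← torsionEmb_X_pow_smul] at hzx
      refine ⟨x, ?_, rfl⟩
      rw [SetLike.mem_coe, hmemA, ← hinj hzx]
      exact hz
    · rintro ⟨x, hx, rfl⟩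
      exact ⟨⟨x, rfl⟩, (X : ℂ[X]) ^ k • x, hx, torsionEmb_X_pow_smul _ _ _ _⟩
  rw [h1, ← (Submodule.equivMapOfInjective _ hinj A).finrank_eq,
    ← (Submodule.equivMapOfInjective _ hinj (N.restrictScalars ℂ)).finrank_eq,
    finrank_comap_eq_add_torsionKer]

theorem TorsionModule.nonempty_submodule_equiv_iff (N : Submodule ℂ[X] (TorsionModule γ))
    (μ : YoungDiagram) : Nonempty (N ≃ₗ[ℂ[X]] TorsionModule μ) ↔
      ∀ j, Module.finrank ℂ (torsionKer N j)
        = ∑ i ∈ Finset.range (μ.colLen 0), min (μ.rowLen i) j :=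
  nonempty_equiv_torsionModule_iff (Q := N)
    (fun x => ⟨γ.rowLen 0, Subtype.ext (TorsionModule.X_pow_smul_eq_zero x.1)⟩) μ

theorem TorsionModule.nonempty_quotient_equiv_iff (N : Submodule ℂ[X] (TorsionModule γ))
    (μ : YoungDiagram) : Nonempty ((TorsionModule γ ⧸ N) ≃ₗ[ℂ[X]] TorsionModule μ) ↔
      ∀ j, Module.finrank ℂ (torsionKer (TorsionModule γ ⧸ N) j)
        = ∑ i ∈ Finset.range (μ.colLen 0), min (μ.rowLen i) j :=
  nonempty_equiv_torsionModule_iff (fun x => by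
    obtain ⟨x, rfl⟩ := N.mkQ_surjective x
    exact ⟨γ.rowLen 0, by rw [← map_smul, TorsionModule.X_pow_smul_eq_zero, map_zero]⟩) μ

theorem isExtensionSubmodule_iff {α β : YoungDiagram} (N : Submodule ℂ[X] (TorsionModule γ)) :
    IsExtensionSubmodule α β γ ((N.restrictScalars ℂ).map (TorsionModule.emb γ)) ↔
      Nonempty (N ≃ₗ[ℂ[X]] TorsionModule α) ∧
        Nonempty ((TorsionModule γ ⧸ N) ≃ₗ[ℂ[X]] TorsionModule β) := by
  rw [TorsionModule.nonempty_submodule_equiv_iff, TorsionModule.nonempty_quotient_equiv_iff]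
  simp only [finrank_torsionKer_submodule, YoungDiagram.sum_min_rowLen_eq_sum_colLen β]
  constructor
  · refine fun h => ⟨h.sub, fun k => ?_⟩
    have h1 := h.quot k
    rw [finrank_torsionKer_quotient] at h1
    omega
  · rintro ⟨h1, h2⟩
    refine ⟨?_, ?_, h1, fun k => by rw [finrank_torsionKer_quotient, h2]⟩
    · rw [← TorsionModule.range_emb]
      exact LinearMap.map_le_range
    · rintro _ ⟨x, hx, rfl⟩
      exact ⟨(X : ℂ[X]) • x, N.smul_mem _ hx, torsionEmb_X_smul _ _ _⟩

theorem exists_restrictScalars_eq {L : Submodule ℂ (TorsionModule γ)}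
    (hL : ∀ x ∈ L.map (TorsionModule.emb γ), rowShift ℂ x ∈ L.map (TorsionModule.emb γ)) :
    ∃ N : Submodule ℂ[X] (TorsionModule γ), N.restrictScalars ℂ = L := by
  have hX : ∀ x ∈ L, (X : ℂ[X]) • x ∈ L := by
    intro x hx
    obtain ⟨y, hy, hyx⟩ := hL _ ⟨x, hx, rfl⟩
    rw [← torsionEmb_X_smul] at hyx
    rwa [← torsionEmb_injective _ _ hyx]
  refine ⟨{ L with smul_mem' := fun p x hx => ?_ }, rfl⟩
  induction p using Polynomial.induction_on' with
  | add p q hp hq =>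
    rw [add_smul]
    exact L.add_mem hp hq
  | monomial n a =>
    rw [← Polynomial.smul_X_eq_monomial, smul_assoc]
    refine L.smul_mem a ?_
    induction n with
    | zero => simpa using hx
    | succ n ih =>
      rw [pow_succ', mul_smul]
      exact hX _ ih

/-- The variety of extensions in terms of dimensions of kernels. -/
theorem extensionVariety_eq (α β γ : YoungDiagram) : extensionVariety α β γ =
    {L | IsExtensionSubmodule α β γ (L.1.map (TorsionModule.emb γ))} := by
  ext L
  constructor
  · rintro ⟨N, hN, h⟩
    have h1 := (isExtensionSubmodule_iff N).2 h
    rwa [hN] at h1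
  · intro h
    obtain ⟨N, hN⟩ := exists_restrictScalars_eq (IsExtensionSubmodule.shift h)
    refine ⟨N, hN, (isExtensionSubmodule_iff N).1 ?_⟩
    rw [hN]
    exact h

theorem encard_irreducibleComponents_extensionVariety (α β γ : YoungDiagram) :
    (irreducibleComponents (extensionVariety α β γ)).encard
      = {ε : ℕ → ℕ → ℕ | IsVChain α β γ ε}.encard := by
  rw [extensionVariety_eq]
  exact encard_irreducibleComponents_extension (torsionEmb_injective _ _)
    (TorsionModule.range_emb γ)

end Extension

/-! ### Orthogonal complements in Grassmannians -/

section Orthogonal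

theorem comp_mem_polyFun_of_forall_dual {W W' : Type*} [AddCommGroup W] [Module ℂ W]
    [AddCommGroup W'] [Module ℂ W'] {p : W' → ℂ} (hp : p ∈ polyFun W') {f : W → W'}
    (hf : ∀ φ : Module.Dual ℂ W', (fun w => φ (f w)) ∈ polyFun W) :
    (fun w => p (f w)) ∈ polyFun W := by
  change p ∈ Algebra.adjoin ℂ (Set.range fun φ : Module.Dual ℂ W' => (φ : W' → ℂ)) at hp
  induction hp using Algebra.adjoin_induction with
  | mem p hp =>
    obtain ⟨φ, rfl⟩ := hp
    exact hf φ
  | algebraMap c => exact (polyFun W).algebraMap_mem c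
  | add p q _ _ hp hq => exact (polyFun W).add_mem hp hq
  | mul p q _ _ hp hq => exact (polyFun W).mul_mem hp hq

variable {V : Type*} [AddCommGroup V] [Module ℂ V] [FiniteDimensional ℂ V] {d d' : ℕ}
  {B : LinearMap.BilinForm ℂ V}

/-- The orthogonal complement as a map between Grassmannians. -/
def SubspaceGrassmannian.orthogonal (hB : B.Nondegenerate) (hd : d + d' = Module.finrank ℂ V)
    (L : SubspaceGrassmannian d V) : SubspaceGrassmannian d' V :=
  ⟨B.orthogonal L.1, by
    rw [LinearMap.BilinForm.finrank_orthogonal hB, L.2]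
    omega⟩

/-- Near a given frame, a frame of the orthogonal complement can be chosen that depends
polynomially on the frame of the subspace. -/
theorem exists_orthogonal_frame (hB : B.Nondegenerate) (hs : B.IsSymm)
    (hd : d + d' = Module.finrank ℂ V) (v₀ : Frame d V) :
    ∃ (D : (Fin d → V) → ℂ) (w : (Fin d → V) → Fin d' → V), D ∈ polyFun (Fin d → V) ∧
      D v₀.1 ≠ 0 ∧ (∀ φ : Module.Dual ℂ (Fin d' → V), (fun v => φ (w v)) ∈ polyFun (Fin d → V)) ∧
      ∀ v : Frame d V, D v.1 ≠ 0 → ∃ u : Frame d' V, u.1 = w v.1 ∧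
        u.span = v.span.orthogonal hB hd := by
  obtain ⟨w₀, hw₀⟩ := Frame.exists_span_eq (v₀.span.orthogonal hB hd)
  have hortho : ∀ i k, B (v₀.1 i) (w₀.1 k) = 0 := by
    intro i k
    have h1 : w₀.1 k ∈ (v₀.span.orthogonal hB hd).1 := by
      rw [← hw₀]
      exact Submodule.subset_span ⟨k, rfl⟩
    exact h1 _ (Submodule.subset_span ⟨i, rfl⟩)
  -- linear forms dual to the frame, and the vectors that represent them
  obtain ⟨ψ, hψ⟩ : ∃ ψ : Fin d → Module.Dual ℂ V, ∀ i j, ψ i (v₀.1 j) = if i = j then 1 else 0 := by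
    obtain ⟨f, hf⟩ := LinearMap.exists_leftInverse_of_injective
      (Fintype.linearCombination ℂ v₀.1)
      (LinearMap.ker_eq_bot.2 v₀.2.fintypeLinearCombination_injective)
    refine ⟨fun i => LinearMap.proj i ∘ₗ f, fun i j => ?_⟩
    have h1 := DFunLike.congr_fun hf (Pi.single j 1)
    rw [LinearMap.comp_apply, Fintype.linearCombination_apply_single, one_smul] at h1
    rw [LinearMap.comp_apply, h1]
    simp [Pi.single_apply]
  let ρ : Fin d → V := fun j => (B.toDual hB).symm (ψ j)
  have hρ : ∀ x j, B x (ρ j) = ψ j x := fun x j => by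
    rw [hs.eq]
    exact LinearMap.BilinForm.apply_toDual_symm_apply (hB := hB) (ψ j) x
  let G : (Fin d → V) → Matrix (Fin d) (Fin d) ℂ := fun v => Matrix.of fun i j => ψ j (v i)
  let b : Fin d' → (Fin d → V) → Fin d → ℂ := fun k v i => B (v i) (w₀.1 k)
  have hG : ∀ i j, (fun v => G v i j) ∈ polyFun (Fin d → V) := fun i j =>
    dual_mem_polyFun (W := Fin d → V) (ψ j ∘ₗ LinearMap.proj i)
  have hb : ∀ k i, (fun v => b k v i) ∈ polyFun (Fin d → V) := fun k i =>
    dual_mem_polyFun (W := Fin d → V) (B.flip (w₀.1 k) ∘ₗ LinearMap.proj i)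
  have hD : (fun v => (G v).det) ∈ polyFun (Fin d → V) := det_mem_polyFun hG
  have hc : ∀ k j, (fun v => Matrix.cramer (G v) (b k v) j) ∈ polyFun (Fin d → V) := by
    intro k j
    simp only [Matrix.cramer_apply]
    refine det_mem_polyFun (P := fun i l v => (G v).updateCol j (b k v) i l) fun i l => ?_
    by_cases h : l = j
    · subst h
      simpa only [Matrix.updateCol_self] using hb k i
    · simpa only [Matrix.updateCol_ne h] using hG i l
  -- Cramer's rule makes the vectors `w₀ k` orthogonal to the given ones
  let w : (Fin d → V) → Fin d' → V := fun v k =>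
    (G v).det • w₀.1 k - ∑ j, Matrix.cramer (G v) (b k v) j • ρ j
  refine ⟨fun v => (G v).det, w, hD, ?_, fun φ => ?_, fun v hv => ?_⟩
  · have : G v₀.1 = 1 := by
      ext i j
      simp only [G, Matrix.of_apply, hψ, Matrix.one_apply, eq_comm]
    simp only [this, Matrix.det_one]
    exact one_ne_zero
  · have : (fun v => φ (w v)) = ∑ k, ((fun v => (G v).det) *
        (algebraMap ℂ _ (φ (Pi.single k (w₀.1 k)))) - ∑ j,
        (fun v => Matrix.cramer (G v) (b k v) j) * algebraMap ℂ _ (φ (Pi.single k (ρ j)))) := by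
      funext v
      have h1 : w v = ∑ k, ((G v).det • (Pi.single k (w₀.1 k) : Fin d' → V)
          - ∑ j, Matrix.cramer (G v) (b k v) j • (Pi.single k (ρ j) : Fin d' → V)) := by
        rw [← Finset.univ_sum_single (w v)]
        refine Finset.sum_congr rfl fun k _ => ?_
        funext l
        by_cases h : l = k
        · subst h
          simp [w]
        · simp [h]
      rw [h1, map_sum, Finset.sum_apply]
      refine Finset.sum_congr rfl fun k _ => ?_
      rw [map_sub, map_smul, map_sum, Pi.sub_apply, Finset.sum_apply]
      simp only [map_smul, smul_eq_mul]
      rfl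
    rw [this]
    exact sum_mem fun k _ => sub_mem (mul_mem hD (Subalgebra.algebraMap_mem _ _))
      (sum_mem fun j _ => mul_mem (hc k j) (Subalgebra.algebraMap_mem _ _))
  · have hmem : ∀ k, w v.1 k ∈ (v.span.orthogonal hB hd).1 := by
      intro k
      have h1 : v.span.1 ≤ LinearMap.ker (B.flip (w v.1 k)) := by
        refine Submodule.span_le.2 ?_
        rintro _ ⟨i, rfl⟩
        have h2 := congrFun (Matrix.mulVec_cramer (G v.1) (b k v.1)) i
        change B (v.1 i) (w v.1 k) = 0
        simp only [w, map_sub, map_smul, map_sum, hρ, smul_eq_mul]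
        rw [sub_eq_zero]
        simp only [Matrix.mulVec, dotProduct, Pi.smul_apply, smul_eq_mul] at h2
        rw [← h2]
        refine Finset.sum_congr rfl fun j _ => ?_
        rw [mul_comm]
        rfl
      exact fun x hx => h1 hx
    have hli : LinearIndependent ℂ (w v.1) := by
      rw [Fintype.linearIndependent_iff]
      intro a ha
      -- pairing with the frame `v₀` isolates the coefficients of the vectors `ρ j`
      have h1 : (G v.1).det • ∑ k, a k • w₀.1 k
          = ∑ j, (∑ k, a k * Matrix.cramer (G v.1) (b k v.1) j) • ρ j := by
        simp only [w, smul_sub, Finset.sum_sub_distrib, sub_eq_zero] at ha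
        rw [Finset.smul_sum]
        refine (Finset.sum_congr rfl fun k _ => smul_comm _ _ _).trans (ha.trans ?_)
        simp only [Finset.smul_sum, smul_smul, Finset.sum_smul]
        exact Finset.sum_comm
      have h2 : ∀ i, ∑ k, a k * Matrix.cramer (G v.1) (b k v.1) i = 0 := by
        intro i
        have h3 := congrArg (B (v₀.1 i)) h1
        simp only [map_smul, map_sum, hρ, hψ, hortho, Finset.sum_const_zero,
          smul_eq_mul, mul_ite, mul_one, mul_zero, Finset.sum_ite_eq', Finset.mem_univ,
          if_true] at h3
        exact h3.symm
      simp only [h2, zero_smul, Finset.sum_const_zero] at h1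
      exact Fintype.linearIndependent_iff.1 w₀.2 a ((smul_eq_zero.1 h1).resolve_left hv)
    let u : Frame d' V := ⟨w v.1, hli⟩
    refine ⟨u, rfl, Subtype.ext ?_⟩
    refine Submodule.eq_of_le_of_finrank_eq (Submodule.span_le.2 ?_) ?_
    · rintro _ ⟨k, rfl⟩
      exact hmem k
    · rw [u.span.2, (v.span.orthogonal hB hd).2]

theorem SubspaceGrassmannian.continuous_orthogonal (hB : B.Nondegenerate) (hs : B.IsSymm)
    (hd : d + d' = Module.finrank ℂ V) :
    Continuous (SubspaceGrassmannian.orthogonal hB hd) := by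
  refine continuous_coinduced_dom.2 (continuous_def.2 fun U hU => ?_)
  rw [isOpen_iff_mem_nhds]
  intro v₀ hv₀
  obtain ⟨D, w, hD, hD₀, hw, hspan⟩ := exists_orthogonal_frame hB hs hd v₀
  obtain ⟨u₀, hu₀, hu₀'⟩ := hspan v₀ hD₀
  obtain ⟨U', hU', hUU'⟩ := hU.preimage Frame.continuous_span
  have hmem : ∀ u : Frame d' V, u.span ∈ U ↔ u.1 ∈ U' := fun u =>
    (Set.ext_iff.1 hUU' u).symm
  have h0 : w v₀.1 ∈ U' := by
    rw [← hu₀, ← hmem, hu₀']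
    exact hv₀
  obtain ⟨p, hp, hp₀, hpU⟩ := exists_polyFun_of_isOpen hU' h0
  have hq := mul_mem hD (comp_mem_polyFun_of_forall_dual hp hw)
  refine mem_nhds_iff.2 ⟨Subtype.val ⁻¹' {v | (D * fun v => p (w v)) v ≠ 0}, fun v hv => ?_,
    isOpen_induced (t := zariskiTopology (Fin d → V)) (isOpen_ne_zero hq), mul_ne_zero hD₀ hp₀⟩
  obtain ⟨u, hu, hu'⟩ := hspan v (left_ne_zero_of_mul hv)
  change v.span.orthogonal hB hd ∈ U
  rw [← hu', hmem, hu]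
  exact hpU _ (right_ne_zero_of_mul hv)

/-- The orthogonal complement is a homeomorphism between Grassmannians. -/
def SubspaceGrassmannian.orthogonalHomeomorph (hB : B.Nondegenerate) (hs : B.IsSymm)
    (hd : d + d' = Module.finrank ℂ V) :
    SubspaceGrassmannian d V ≃ₜ SubspaceGrassmannian d' V where
  toFun := SubspaceGrassmannian.orthogonal hB hd
  invFun := SubspaceGrassmannian.orthogonal hB ((add_comm d' d).trans hd)
  left_inv L := Subtype.ext (LinearMap.BilinForm.orthogonal_orthogonal hB hs.isRefl L.1)
  right_inv L := Subtype.ext (LinearMap.BilinForm.orthogonal_orthogonal hB hs.isRefl L.1)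
  continuous_toFun := SubspaceGrassmannian.continuous_orthogonal hB hs _
  continuous_invFun := SubspaceGrassmannian.continuous_orthogonal hB hs _

theorem Homeomorph.encard_irreducibleComponents_eq {Y Y' : Type*} [TopologicalSpace Y]
    [TopologicalSpace Y'] (e : Y ≃ₜ Y') :
    (irreducibleComponents Y).encard = (irreducibleComponents Y').encard :=
  (Set.encard_congr (irreducibleComponentsEquivOfIsPreirreducibleFiber e e.continuous e.isOpenMap
    (fun _ => (Set.subsingleton_singleton.preimage e.injective).isPreirreducible)
    e.surjective).toEquiv).symm

end Orthogonal

/-! ### Duality of torsion modules -/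

section Duality

theorem quotRevCoeff_X_pow_smul (k m : ℕ) (x : ℂ[X] ⧸ Ideal.span {(X : ℂ[X]) ^ k}) (j : ℕ) :
    quotRevCoeff k ((X : ℂ[X]) ^ m • x) j = quotRevCoeff k x (j + m) := by
  induction m generalizing j with
  | zero => simp
  | succ m ih =>
    rw [pow_succ', mul_smul, quotRevCoeff_X_smul, ih, add_right_comm, add_assoc]

/-- The symmetric bilinear form on `M_γ` for which multiplication by `t` is self-adjoint: on
`ℂ[t] / (t ^ k)` it is the coefficient of `t ^ (k - 1)` in the product. -/
noncomputable def torsionPairing (γ : YoungDiagram) :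
    LinearMap.BilinForm ℂ (TorsionModule γ) :=
  LinearMap.mk₂ ℂ (fun x y => ∑ i : Fin (γ.colLen 0), quotRevCoeff (γ.rowLen i) (x i * y i) 0)
    (fun x x' y => by
      simp only [Pi.add_apply, add_mul, map_add, Finset.sum_add_distrib])
    (fun c x y => by
      simp only [Pi.smul_apply, smul_mul_assoc, map_smul, Finset.smul_sum])
    (fun x y y' => by
      simp only [Pi.add_apply, mul_add, map_add, Finset.sum_add_distrib])
    (fun c x y => by
      simp only [Pi.smul_apply, mul_smul_comm, map_smul, Finset.smul_sum])

variable {γ : YoungDiagram}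

theorem torsionPairing_apply (x y : TorsionModule γ) :
    torsionPairing γ x y = ∑ i : Fin (γ.colLen 0), quotRevCoeff (γ.rowLen i) (x i * y i) 0 := rfl

theorem torsionPairing_isSymm (γ : YoungDiagram) : (torsionPairing γ).IsSymm := by
  refine ⟨fun x y => ?_⟩
  simp only [torsionPairing_apply]
  exact Finset.sum_congr rfl fun i _ => by rw [mul_comm]

theorem torsionPairing_smul (p : ℂ[X]) (x y : TorsionModule γ) :
    torsionPairing γ x (p • y) = torsionPairing γ (p • x) y := by
  simp only [torsionPairing_apply, Pi.smul_apply, mul_smul_comm, smul_mul_assoc]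

theorem eq_zero_of_torsionPairing {x : TorsionModule γ} (h : ∀ y, torsionPairing γ x y = 0) :
    x = 0 := by
  funext i
  refine quotRevCoeff_injective _ ?_
  funext j
  rw [Pi.zero_apply, map_zero, Pi.zero_apply]
  have h1 := h (Pi.single i ((X : ℂ[X]) ^ j • 1))
  rw [torsionPairing_apply, Finset.sum_eq_single i (fun l _ hl => by
    rw [Pi.single_eq_of_ne hl, mul_zero, map_zero, Pi.zero_apply])
    (fun h => absurd (Finset.mem_univ i) h), Pi.single_eq_same, mul_smul_comm, mul_one,
    quotRevCoeff_X_pow_smul, zero_add] at h1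
  exact h1

theorem torsionPairing_nondegenerate (γ : YoungDiagram) : (torsionPairing γ).Nondegenerate :=
  ⟨fun _ => eq_zero_of_torsionPairing, fun y h => eq_zero_of_torsionPairing fun x => by
    rw [(torsionPairing_isSymm γ).eq]
    exact h x⟩

/-- The orthogonal complement of a submodule is a submodule, as `t` is self-adjoint. -/
noncomputable def orthogonalSubmodule (N : Submodule ℂ[X] (TorsionModule γ)) :
    Submodule ℂ[X] (TorsionModule γ) :=
  { (torsionPairing γ).orthogonal (N.restrictScalars ℂ) with
    smul_mem' := fun p y hy x hx => by
      have h1 := hy (p • x) (N.smul_mem p hx)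
      rw [← h1]
      exact torsionPairing_smul p x y }

theorem orthogonalSubmodule_restrictScalars (N : Submodule ℂ[X] (TorsionModule γ)) :
    (orthogonalSubmodule N).restrictScalars ℂ
      = (torsionPairing γ).orthogonal (N.restrictScalars ℂ) := rfl

theorem orthogonalSubmodule_orthogonalSubmodule (N : Submodule ℂ[X] (TorsionModule γ)) :
    orthogonalSubmodule (orthogonalSubmodule N) = N := by
  refine Submodule.restrictScalars_injective ℂ _ _ ?_
  rw [orthogonalSubmodule_restrictScalars, orthogonalSubmodule_restrictScalars]
  exact LinearMap.BilinForm.orthogonal_orthogonal (torsionPairing_nondegenerate γ)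
    (torsionPairing_isSymm γ).isRefl _

/-- The orthogonal complement of `N` is the dual of the quotient by `N`: with `T = t ^ j`, both
kernels have the codimension of `N + T M_γ` as dimension. -/
theorem finrank_torsionKer_orthogonalSubmodule (N : Submodule ℂ[X] (TorsionModule γ)) (j : ℕ) :
    Module.finrank ℂ (torsionKer (orthogonalSubmodule N) j)
      = Module.finrank ℂ (torsionKer (TorsionModule γ ⧸ N) j) := by
  let T : TorsionModule γ →ₗ[ℂ] TorsionModule γ :=
    (LinearMap.lsmul ℂ[X] (TorsionModule γ) (X ^ j)).restrictScalars ℂ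
  have hT : ∀ x, T x = (X : ℂ[X]) ^ j • x := fun x => rfl
  let N' : Submodule ℂ (TorsionModule γ) := N.restrictScalars ℂ
  have h1 : (torsionKer (orthogonalSubmodule N) j).map
      ((orthogonalSubmodule N).subtype.restrictScalars ℂ)
      = (torsionPairing γ).orthogonal (N' ⊔ LinearMap.range T) := by
    ext y
    constructor
    · rintro ⟨z, hz, rfl⟩ x hx
      obtain ⟨a, ha, _, ⟨b, rfl⟩, rfl⟩ := Submodule.mem_sup.1 hx
      have h2 : (X : ℂ[X]) ^ j • (z : TorsionModule γ) = 0 := congrArg Subtype.val hz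
      have h3 : torsionPairing γ a z = 0 := z.2 a ha
      change torsionPairing γ (a + T b) (z : TorsionModule γ) = 0
      rw [map_add, LinearMap.add_apply, h3, hT, ← torsionPairing_smul, h2, map_zero, add_zero]
    · intro hy
      refine ⟨⟨y, fun x hx => hy x (Submodule.mem_sup_left hx)⟩, ?_, rfl⟩
      refine Subtype.ext (eq_zero_of_torsionPairing fun x => ?_)
      rw [(torsionPairing_isSymm γ).eq]
      change torsionPairing γ x ((X : ℂ[X]) ^ j • y) = 0
      rw [torsionPairing_smul]
      exact hy _ (Submodule.mem_sup_right ⟨x, rfl⟩)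
  have h2 : Module.finrank ℂ (torsionKer (orthogonalSubmodule N) j)
      = Module.finrank ℂ (TorsionModule γ)
        - Module.finrank ℂ (N' ⊔ LinearMap.range T : Submodule ℂ (TorsionModule γ)) := by
    rw [← LinearMap.BilinForm.finrank_orthogonal (torsionPairing_nondegenerate γ), ← h1]
    exact (Submodule.equivMapOfInjective ((orthogonalSubmodule N).subtype.restrictScalars ℂ)
      (orthogonalSubmodule N).subtype_injective _).finrank_eq
  -- the preimage of `N` under `T`
  have h3 := finrank_eq_map_add_inf_ker T (N'.comap T)
  have h4 : N'.comap T ⊓ LinearMap.ker T = LinearMap.ker T :=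
    inf_eq_right.2 (LinearMap.ker_le_comap T)
  have h5 := Submodule.map_comap_eq T N'
  rw [h4, h5] at h3
  have h6 := Submodule.finrank_sup_add_finrank_inf_eq N' (LinearMap.range T)
  rw [inf_comm] at h6
  have h7 := LinearMap.finrank_range_add_finrank_ker T
  have h8 := finrank_comap_eq_add_torsionKer N j
  change Module.finrank ℂ (N'.comap T) = Module.finrank ℂ N' + _ at h8
  have h9 := Submodule.finrank_le (N' ⊔ LinearMap.range T)
  omega

theorem nonempty_orthogonalSubmodule_equiv {α β : YoungDiagram}
    {N : Submodule ℂ[X] (TorsionModule γ)} (hα : Nonempty (N ≃ₗ[ℂ[X]] TorsionModule α))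
    (hβ : Nonempty ((TorsionModule γ ⧸ N) ≃ₗ[ℂ[X]] TorsionModule β)) :
    Nonempty (orthogonalSubmodule N ≃ₗ[ℂ[X]] TorsionModule β) ∧
      Nonempty ((TorsionModule γ ⧸ orthogonalSubmodule N) ≃ₗ[ℂ[X]] TorsionModule α) := by
  rw [TorsionModule.nonempty_submodule_equiv_iff, TorsionModule.nonempty_quotient_equiv_iff] at *
  refine ⟨fun j => ?_, fun j => ?_⟩
  · rw [finrank_torsionKer_orthogonalSubmodule, hβ]
  · rw [← finrank_torsionKer_orthogonalSubmodule, orthogonalSubmodule_orthogonalSubmodule, hα]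

theorem card_add_card_of_mem_extensionVariety {α β : YoungDiagram}
    {L : SubspaceGrassmannian α.card (TorsionModule γ)} (hL : L ∈ extensionVariety α β γ) :
    α.card + β.card = γ.card := by
  obtain ⟨N, _, ⟨e⟩, ⟨f⟩⟩ := hL
  have h1 := Submodule.finrank_quotient_add_finrank (N.restrictScalars ℂ)
  have h2 := (e.restrictScalars ℂ).finrank_eq
  have h3 := (f.restrictScalars ℂ).finrank_eq
  rw [finrank_torsionModule] at h1 h2 h3
  change Module.finrank ℂ (TorsionModule γ ⧸ N) + Module.finrank ℂ N = _ at h1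
  omega

/-- Duality exchanges the types of the submodule and of the quotient. -/
theorem encard_irreducibleComponents_extensionVariety_comm (α β γ : YoungDiagram) :
    (irreducibleComponents (extensionVariety α β γ)).encard
      = (irreducibleComponents (extensionVariety β α γ)).encard := by
  by_cases h : α.card + β.card = γ.card
  · rw [← finrank_torsionModule γ] at h
    let e := SubspaceGrassmannian.orthogonalHomeomorph (torsionPairing_nondegenerate γ)
      (torsionPairing_isSymm γ) h
    refine Homeomorph.encard_irreducibleComponents_eq (e.sets ?_)
    ext L
    constructor
    · rintro ⟨N, hN, hα, hβ⟩
      refine ⟨orthogonalSubmodule N, ?_, nonempty_orthogonalSubmodule_equiv hα hβ⟩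
      rw [orthogonalSubmodule_restrictScalars, hN]
      rfl
    · rintro ⟨N, hN, hβ, hα⟩
      refine ⟨orthogonalSubmodule N, ?_, nonempty_orthogonalSubmodule_equiv hβ hα⟩
      rw [orthogonalSubmodule_restrictScalars, hN]
      exact congrArg Subtype.val (e.left_inv L)
  · have h1 : IsEmpty (extensionVariety α β γ) :=
      ⟨fun L => h (card_add_card_of_mem_extensionVariety L.2)⟩
    have h2 : IsEmpty (extensionVariety β α γ) :=
      ⟨fun L => h ((add_comm _ _).trans (card_add_card_of_mem_extensionVariety L.2))⟩
    exact Homeomorph.encard_irreducibleComponents_eq (Homeomorph.empty)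

theorem encard_irreducibleComponents_eq_lrCoeff (α β γ : YoungDiagram) :
    (irreducibleComponents (extensionVariety α β γ)).encard = (lrCoeff α β γ : ℕ∞) := by
  rw [encard_irreducibleComponents_extensionVariety_comm,
    encard_irreducibleComponents_extensionVariety, lrCoeff_eq_ncard_isVChain,
    (finite_isVChain α β γ).cast_ncard_eq]

theorem nonempty_extensionVariety_iff (α β γ : YoungDiagram) :
    (extensionVariety α β γ).Nonempty ↔ lrCoeff α β γ ≠ 0 := by
  rw [← Nat.cast_ne_zero (R := ℕ∞), ← encard_irreducibleComponents_eq_lrCoeff,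
    Set.encard_ne_zero]
  constructor
  · exact fun ⟨L, hL⟩ => ⟨_, irreducibleComponent_mem_irreducibleComponents ⟨L, hL⟩⟩
  · rintro ⟨Z, hZ⟩
    obtain ⟨L, _⟩ := hZ.1.1
    exact ⟨L, L.2⟩

end Duality

theorem lemma3p1 (α β γ : YoungDiagram) :
    ((∃ (f : TorsionModule α →ₗ[ℂ[X]] TorsionModule γ)
        (g : TorsionModule γ →ₗ[ℂ[X]] TorsionModule β),
        Function.Injective f ∧ Function.Exact f g ∧ Function.Surjective g) ↔
      lrCoeff α β γ ≠ 0) ∧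
    (irreducibleComponents (extensionVariety α β γ)).encard = (lrCoeff α β γ : ℕ∞) := by
  refine ⟨?_, encard_irreducibleComponents_eq_lrCoeff α β γ⟩
  rw [← nonempty_extensionVariety_iff]
  constructor
  · rintro ⟨f, g, hf, hfg, hg⟩
    let e := LinearEquiv.ofInjective f hf
    have hL : Module.finrank ℂ ((LinearMap.range f).restrictScalars ℂ) = α.card := by
      rw [← finrank_torsionModule α]
      exact (e.restrictScalars ℂ).finrank_eq.symm
    exact ⟨⟨_, hL⟩, LinearMap.range f, rfl, ⟨e.symm⟩,
      ⟨(Submodule.quotEquivOfEq _ _ (LinearMap.exact_iff.1 hfg).symm).trans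
        (g.quotKerEquivOfSurjective hg)⟩⟩
  · rintro ⟨L, N, _, ⟨e⟩, ⟨e'⟩⟩
    refine ⟨N.subtype ∘ₗ e.symm.toLinearMap, e'.toLinearMap ∘ₗ N.mkQ,
      N.subtype_injective.comp e.symm.injective, ?_, e'.surjective.comp N.mkQ_surjective⟩
    rw [LinearMap.exact_iff, LinearMap.range_comp_of_range_eq_top _ e.symm.range,
      LinearMap.ker_comp_of_ker_eq_bot _ e'.ker, Submodule.ker_mkQ, Submodule.range_subtype]
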